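/- Let $k$ be a commutative ring with $1$, $K$ an associative (not necessarily commutative) unital $k$-algebra and $\alpha$ an endomorphism of the $k$-algebra $K$. Let $n\ge 2$ and let $f=\sum_{i=0}^n\lambda_i x^{n-i}$, with $\lambda_0=1$ and $\lambda_1,\dots,\lambda_n\in K$ such that $\alpha(\lambda_i)=\lambda_i$ and $\lambda_i\lambda=\alpha^i(\lambda)\lambda_i$ for all $\lambda\in K$, $1\le i\le n$. Let $B=K[x,\alpha]$ be the Ore extension (so $x\lambda=\alpha(\lambda)x$) and $A=B/\langle f\rangle$, which is free as a left $K$-module with basis $1,x,\dots,x^{n-1}$. For $P\in B$ let $\overline P\in B$ be the unique element such that $P-\overline P f$ is $0$ or of degree $<n$; its image in $A$ is denoted in the same way. Write $\otimes=\otimes_K$, $\overline A=A/K$, and $M\otimes=M/[M,K]$ for a $K$-bimodule $M$, so that $A\otimes\overline A^{\otimes r}\otimes$ is the module of normalized Hochschild $r$-chains of $A$ relative to $K$. Let $b$ be its Hochschild boundary and $$B_r[a_0\otimes\cdots\otimes a_r]=\sum_{i=0}^r(-1)^{ir}[1\otimes a_i\otimes\cdots\otimes a_r\otimes a_0\otimes\cdots\otimes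 a_{i-1}].$$ For $j\ge0$ let $[A,K]_{\alpha^j}$ be the $k$-submodule of $A$ generated by the elements $a\,\alpha^j(\lambda)-\lambda a$ with $a\in A$, $\lambda\in K$. Put $C^S_{2m}(A)=A/[A,K]_{\alpha^{mn}}$, $C^S_{2m+1}(A)=A/[A,K]_{\alpha^{mn+1}}$, with boundary maps $d_r:C^S_r(A)\to C^S_{r-1}(A)$, $$d_{2m+1}[a]=[ax-xa],\qquad d_{2m}[a]=\sum_{i=1}^n\sum_{\ell=0}^{i-1}[\lambda_{n-i}x^{i-\ell-1}a x^\ell].$$ Let $\phi_r:C^S_r(A)\to A\otimes\overline A^{\otimes r}\otimes$ and $\psi_r:A\otimes\overline A^{\otimes r}\otimes\to C^S_r(A)$ be the $k$-linear maps $$\phi_{2m}[a]=\sum_{\mathbf i}\sum_{\boldsymbol\ell}[\lambda_{n-i_1}\cdots\lambda_{n-i_m}\,a\,x^{\sum_j(i_j-\ell_j)-m}\otimes x\otimes x^{\ell_m}\otimes\cdots\otimes x\otimes x^{\ell_1}],$$ where $\mathbf i$ runs over the $m$-tuples with $1\le i_j\le n$ and $\boldsymbol\ell$ over the $m$-tuples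 with $1\le\ell_j<i_j$; $\phi_{2m+1}[a]$ is given by the same formula with an additional factor $\otimes\, x$ at the right end; and, for $a\in A$ and $1\le i_1,i_2,\dots<n$, $$\psi_{2m}[a\otimes x^{i_1}\otimes\cdots\otimes x^{i_{2m}}]=[a\,\overline{x^{i_1+i_2}}\cdots\overline{x^{i_{2m-1}+i_{2m}}}],$$ $$\psi_{2m+1}[a\otimes x^{i_1}\otimes\cdots\otimes x^{i_{2m+1}}]=\sum_{\ell=0}^{i_{2m+1}-1}[x^{i_{2m+1}-\ell-1}\,a\,\overline{x^{i_1+i_2}}\cdots\overline{x^{i_{2m-1}+i_{2m}}}\,x^\ell].$$ Let $D_r=\psi_{r+1}B_r\phi_r:C^S_r(A)\to C^S_{r+1}(A)$. Then $(C^S_*(A),d_*,D_*)$ is a mixed complex, that is, $dd=0$, $DD=0$ and $Dd+dD=0$, and it gives the cyclic homology of $A$ relative to $K$: writing $\mathrm{Tot}(X)_r=X_r\oplus X_{r-2}\oplus X_{r-4}\oplus\cdots$, with differential boundary $+$ Connes operator, for the complex whose homology is the cyclic homology $\mathrm{HC}_*$ of a mixed complex $X$, there is a chain map $$\mathrm{Tot}(C^S_*(A),d_*,D_*)\to\mathrm{Tot}(A\otimes\overline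 A^{\otimes *}\otimes,b,B)$$ which on the first summand $C^S_r(A)$ is $\phi_r$, which commutes with the periodicity maps $S$ (deletion of the first summand), and which induces isomorphisms $\mathrm{HC}_r(C^S_*(A),d_*,D_*)\cong\mathrm{HC}^K_r(A)$ of $k$-modules for all $r\ge0$. -/

import Mathlib

namespace MonogenicCyclic

open scoped TensorProduct
open Function

section Relative

variable {k K A : Type*} [CommRing k] [Ring K] [Algebra k K] [Ring A] [Algebra k A]

/-- The relations defining `A ⊗_K (A/K) ⊗_K ⋯ ⊗_K (A/K) ⊗_K` (cyclically closed, `r` factors `A/K`)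
as a quotient of `A ⊗_k ⋯ ⊗_k A`: elements of `K` pass through each tensor sign
(indices are cyclic: `i + 1 = 0` for `i = r`), and a tensor vanishes
when one of its entries with index `≥ 1` lies in the image of `K`. -/
def cycRel (ι : K →ₐ[k] A) (r : ℕ) : Submodule k (⨂[k] _ : Fin (r + 1), A) :=
  Submodule.span k
    ({t | ∃ (a : Fin (r + 1) → A) (i : Fin (r + 1)) (c : K),
        t = PiTensorProduct.tprod k (update a i (a i * ι c))
          - PiTensorProduct.tprod k (update a (i + 1) (ι c * a (i + 1)))} ∪
     {t | ∃ (a : Fin (r + 1) → A) (i : Fin (r + 1)) (c : K),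
        i ≠ 0 ∧ a i = ι c ∧ t = PiTensorProduct.tprod k a})

/-- `A ⊗ (A/K)^{⊗ r} ⊗`, the module of normalized Hochschild `r`-chains of `A` relative to `K`. -/
abbrev HochX (ι : K →ₐ[k] A) (r : ℕ) : Type _ := (⨂[k] _ : Fin (r + 1), A) ⧸ cycRel ι r

/-- The class `[a₀ ⊗ ⋯ ⊗ a_r]`, as a multilinear map. -/
noncomputable def cls (ι : K →ₐ[k] A) (r : ℕ) :
    MultilinearMap k (fun _ : Fin (r + 1) => A) (HochX ι r) :=
  (cycRel ι r).mkQ.compMultilinearMap (PiTensorProduct.tprod k)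

theorem cls_bal (ι : K →ₐ[k] A) {r : ℕ} (a : Fin (r + 1) → A) (i : Fin (r + 1)) (c : K) :
    cls ι r (update a i (a i * ι c)) = cls ι r (update a (i + 1) (ι c * a (i + 1))) := by
  refine (Submodule.Quotient.eq _).2 (Submodule.subset_span (Or.inl ⟨a, i, c, rfl⟩))

theorem cls_bal' (ι : K →ₐ[k] A) {r : ℕ} (u v a : Fin (r + 1) → A) (i j : Fin (r + 1)) (c : K)
    (hj : j = i + 1) (hu : u = update a i (a i * ι c)) (hv : v = update a j (ι c * a j)) :
    cls ι r u = cls ι r v := by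
  subst hj hu hv; exact cls_bal ι a i c

theorem cls_deg (ι : K →ₐ[k] A) {r : ℕ} (a : Fin (r + 1) → A) (i : Fin (r + 1)) (c : K)
    (hi : i ≠ 0) (ha : a i = ι c) : cls ι r a = 0 :=
  (Submodule.Quotient.mk_eq_zero _).2 (Submodule.subset_span (Or.inr ⟨a, i, c, hi, ha, rfl⟩))

/-- A multilinear map which respects the relations descends to relative Hochschild chains. -/
noncomputable def hochLift (ι : K →ₐ[k] A) {r : ℕ} {N : Type*} [AddCommGroup N] [Module k N]
    (F : MultilinearMap k (fun _ : Fin (r + 1) => A) N)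
    (h1 : ∀ (a : Fin (r + 1) → A) (i : Fin (r + 1)) (c : K),
      F (update a i (a i * ι c)) = F (update a (i + 1) (ι c * a (i + 1))))
    (h2 : ∀ (a : Fin (r + 1) → A) (i : Fin (r + 1)) (c : K), i ≠ 0 → a i = ι c → F a = 0) :
    HochX ι r →ₗ[k] N :=
  (cycRel ι r).liftQ (PiTensorProduct.lift F) (by
    refine Submodule.span_le.2 ?_
    rintro t (⟨a, i, c, rfl⟩ | ⟨a, i, c, hi, ha, rfl⟩)
    · simp [h1 a i c]
    · simp [h2 a i c hi ha])

@[simp] theorem hochLift_cls (ι : K →ₐ[k] A) {r : ℕ} {N : Type*} [AddCommGroup N] [Module k N]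
    (F : MultilinearMap k (fun _ : Fin (r + 1) => A) N) (h1 h2) (a : Fin (r + 1) → A) :
    hochLift ι F h1 h2 (cls ι r a) = F a := by
  change PiTensorProduct.lift F (PiTensorProduct.tprod k a) = F a
  simp

/-- If `T` replaces one entry of a tuple by a linear function of one entry of the argument,
then `cls ∘ T` is multilinear. -/
noncomputable def tupleMap (ι : K →ₐ[k] A) {r s : ℕ}
    (T : (Fin (r + 1) → A) → (Fin (s + 1) → A))
    (hT : ∀ a p, ∃ (q : Fin (s + 1)) (L : A →ₗ[k] A), ∀ v, T (update a p v) = update (T a) q (L v)) :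
    MultilinearMap k (fun _ : Fin (r + 1) => A) (HochX ι s) where
  toFun a := cls ι s (T a)
  map_update_add' := by
    intro inst a p x y
    obtain rfl : inst = instDecidableEqFin (r + 1) := Subsingleton.elim _ _
    obtain ⟨q, L, h⟩ := hT a p
    simp [h]
  map_update_smul' := by
    intro inst a p c x
    obtain rfl : inst = instDecidableEqFin (r + 1) := Subsingleton.elim _ _
    obtain ⟨q, L, h⟩ := hT a p
    simp [h]

/-- The `i`-th face `a₀ ⊗ ⋯ ⊗ aᵢaᵢ₊₁ ⊗ ⋯ ⊗ a_{r+1}` for `i ≤ r`, and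
`a_{r+1}a₀ ⊗ a₁ ⊗ ⋯ ⊗ a_r` for `i = r + 1`. -/
def face {r : ℕ} (i : Fin (r + 2)) (a : Fin (r + 2) → A) (j : Fin (r + 1)) : A :=
  if i = Fin.last (r + 1) then
    if j = 0 then a (Fin.last (r + 1)) * a 0 else a j.castSucc
  else if (j : ℕ) < i then a j.castSucc
  else if (j : ℕ) = i then a j.castSucc * a j.succ
  else a j.succ

theorem exists_nat_tuple {r : ℕ} (a : Fin r → A) :
    ∃ g : ℕ → A, a = fun j : Fin r => g j :=
  ⟨fun j => if h : j < r then a ⟨j, h⟩ else 0, by ext j; simp⟩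

theorem update_nat {A : Type*} {r : ℕ} (g : ℕ → A) (p : Fin r) (v : A) :
    update (fun j : Fin r => g j) p v = fun j : Fin r => if (j : ℕ) = p then v else g j := by
  ext j; simp [update_apply, Fin.ext_iff]

/-- `ℕ`-indexed form of `face`. -/
def faceN (r i : ℕ) (g : ℕ → A) (j : ℕ) : A :=
  if i = r + 1 then (if j = 0 then g (r + 1) * g 0 else g j)
  else if j < i then g j else if j = i then g j * g (j + 1) else g (j + 1)

theorem face_nat {r : ℕ} (i : Fin (r + 2)) (g : ℕ → A) :
    face i (fun j : Fin (r + 2) => g j) = fun j : Fin (r + 1) => faceN r i g j := by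
  ext j
  simp only [face, faceN, Fin.ext_iff, Fin.val_last, Fin.val_zero, Fin.val_castSucc, Fin.val_succ]

theorem face_update {r : ℕ} (i : Fin (r + 2)) (a : Fin (r + 2) → A) (p : Fin (r + 2)) :
    ∃ (q : Fin (r + 1)) (L : A →ₗ[k] A), ∀ v, face i (update a p v) = update (face i a) q (L v) := by
  obtain ⟨g, rfl⟩ := exists_nat_tuple a
  have key : ∀ (q : Fin (r + 1)) (L : A →ₗ[k] A),
      (∀ v, ∀ j : ℕ, j < r + 1 → faceN r i (fun j => if j = (p : ℕ) then v else g j) j =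
        if j = q then L v else faceN r i g j) →
      ∀ v, face i (update (fun j : Fin (r + 2) => g j) p v) =
        update (face i (fun j : Fin (r + 2) => g j)) q (L v) := by
    intro q L h v
    rw [update_nat, face_nat i (fun j => if j = (p : ℕ) then v else g j), face_nat]
    ext j
    rw [h v j j.2]
    simp only [update_apply, Fin.ext_iff]
  have hi := i.2
  have hp := p.2
  by_cases h : (i : ℕ) = r + 1
  · by_cases h1 : (p : ℕ) = r + 1
    · refine ⟨0, LinearMap.mulRight k (g 0), key _ _ fun v j hj => ?_⟩
      simp only [faceN, Fin.val_zero, LinearMap.mulRight_apply]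
      split_ifs <;> first | omega | rfl
    · by_cases h0 : (p : ℕ) = 0
      · refine ⟨0, LinearMap.mulLeft k (g (r + 1)), key _ _ fun v j hj => ?_⟩
        simp only [faceN, Fin.val_zero, LinearMap.mulLeft_apply]
        split_ifs <;> first | omega | rfl
      · refine ⟨⟨p, by omega⟩, LinearMap.id, key _ _ fun v j hj => ?_⟩
        simp only [faceN, LinearMap.id_apply]
        split_ifs <;> first | omega | rfl
  · by_cases h1 : (p : ℕ) < i
    · refine ⟨⟨p, by omega⟩, LinearMap.id, key _ _ fun v j hj => ?_⟩
      simp only [faceN, LinearMap.id_apply]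
      split_ifs <;> first | omega | rfl
    · by_cases h2 : (p : ℕ) = i
      · refine ⟨⟨p, by omega⟩, LinearMap.mulRight k (g (i + 1)), key _ _ fun v j hj => ?_⟩
        simp only [faceN, LinearMap.mulRight_apply]
        split_ifs <;> first | omega | rfl | simp [*]
      · by_cases h3 : (p : ℕ) = i + 1
        · refine ⟨⟨i, by omega⟩, LinearMap.mulLeft k (g i), key _ _ fun v j hj => ?_⟩
          simp only [faceN, LinearMap.mulLeft_apply]
          split_ifs <;> first | omega | rfl | simp [*]
        · refine ⟨⟨p - 1, by omega⟩, LinearMap.id, key _ _ fun v j hj => ?_⟩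
          simp only [faceN, LinearMap.id_apply]
          split_ifs <;> first | omega | rfl

/-- The Hochschild boundary on `k`-tensors,
`a₀ ⊗ ⋯ ⊗ a_{r+1} ↦ ∑ᵢ (-1)ⁱ [i-th face]`. -/
noncomputable def hochBMulti (ι : K →ₐ[k] A) (r : ℕ) :
    MultilinearMap k (fun _ : Fin (r + 2) => A) (HochX ι r) :=
  ∑ i : Fin (r + 2), (-1 : k) ^ (i : ℕ) • tupleMap (r := r + 1) ι (face i) (face_update i)

theorem hochBMulti_apply (ι : K →ₐ[k] A) (r : ℕ) (a : Fin (r + 2) → A) :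
    hochBMulti ι r a = ∑ i : Fin (r + 2), (-1 : k) ^ (i : ℕ) • cls ι r (face i a) := by
  simp [hochBMulti, tupleMap]

theorem val_succ_cyc {r : ℕ} (p : Fin (r + 1)) :
    ((p + 1 : Fin (r + 1)) : ℕ) = (if (p : ℕ) = r then 0 else (p : ℕ) + 1 : ℕ) := by
  rw [Fin.val_add_one]; simp only [Fin.ext_iff, Fin.val_last]

/-- `ℕ`-indexed form of the balancing relation. -/
theorem cls_bal_nat (ι : K →ₐ[k] A) {r : ℕ} (u v g : ℕ → A) (p q : ℕ) (c : K)
    (hp : p ≤ r) (hq : q = if p = r then 0 else p + 1)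
    (hu : ∀ j ≤ r, u j = if j = p then g p * ι c else g j)
    (hv : ∀ j ≤ r, v j = if j = q then ι c * g q else g j) :
    cls ι r (fun j => u j) = cls ι r (fun j => v j) := by
  have h := cls_bal ι (fun j : Fin (r + 1) => g j) ⟨p, by omega⟩ c
  rw [update_nat, update_nat, val_succ_cyc] at h
  dsimp only at h
  rw [← hq] at h
  convert h using 2
  · ext j; exact hu j (by omega)
  · ext j; exact hv j (by omega)

set_option maxHeartbeats 1000000 in
theorem face_bal (ι : K →ₐ[k] A) {r : ℕ} (i : Fin (r + 2)) (a : Fin (r + 2) → A)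
    (p : Fin (r + 2)) (c : K) :
    cls ι r (face i (update a p (a p * ι c))) =
      cls ι r (face i (update a (p + 1) (ι c * a (p + 1)))) := by
  obtain ⟨g, rfl⟩ := exists_nat_tuple a
  rw [update_nat, update_nat, face_nat i (fun j => if j = (p : ℕ) then g p * ι c else g j),
    face_nat i (fun j => if j = ((p + 1 : Fin (r + 2)) : ℕ) then
      ι c * g ((p + 1 : Fin (r + 2)) : ℕ) else g j), val_succ_cyc]
  obtain ⟨i, hi⟩ := i
  obtain ⟨p, hp⟩ := p
  dsimp only
  obtain ⟨q, hq⟩ : ∃ q : ℕ, q = (if p = r + 1 then 0 else p + 1 : ℕ) := ⟨_, rfl⟩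
  rw [← hq]
  by_cases hip : i = p
  · congr 1
    ext ⟨j, hj⟩
    subst hip
    dsimp only [faceN]
    split_ifs at hq <;> subst hq <;> split_ifs <;> first | omega | grind [mul_assoc]
  · refine cls_bal_nat ι (faceN r i _) (faceN r i _) (faceN r i g)
      (if p = r + 1 then r else if i < p then p - 1 else p)
      (if p = r + 1 then 0 else if p = r ∧ p < i then 0 else if i < p then p else p + 1) c
      (by split_ifs <;> omega) (by split_ifs <;> omega) (fun j hj => ?_) (fun j hj => ?_)
    · dsimp only [faceN]
      by_cases h1 : p = r + 1
      · simp only [h1, if_true]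
        split_ifs <;> first | omega | grind [mul_assoc]
      · by_cases h2 : i < p
        · simp only [h1, h2, if_true, if_false]
          split_ifs <;> first | omega | grind [mul_assoc]
        · simp only [h1, h2, if_false]
          split_ifs <;> first | omega | grind [mul_assoc]
    · dsimp only [faceN]
      by_cases h1 : p = r + 1
      · simp only [h1, if_true] at hq ⊢
        subst hq
        split_ifs <;> first | omega | grind [mul_assoc]
      · simp only [h1, if_false] at hq ⊢
        subst hq
        by_cases h3 : p = r ∧ p < i
        · rw [if_pos h3]
          obtain ⟨h3, h4⟩ := h3
          subst h3
          split_ifs <;> first | omega | grind [mul_assoc]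
        · by_cases h2 : i < p
          · rw [if_neg h3, if_pos h2]
            split_ifs <;> first | omega | grind [mul_assoc]
          · rw [if_neg h3, if_neg h2]
            split_ifs <;> first | omega | grind [mul_assoc]

theorem hochBMulti_deg (ι : K →ₐ[k] A) {r : ℕ} (a : Fin (r + 2) → A) (p : Fin (r + 2)) (c : K)
    (hp : p ≠ 0) (ha : a p = ι c) : hochBMulti ι r a = 0 := by
  obtain ⟨g, rfl⟩ := exists_nat_tuple a
  obtain ⟨p, rfl⟩ := Fin.exists_succ_eq.2 hp
  obtain ⟨p, hpr⟩ := p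
  simp only [Fin.succ_mk] at ha hp ⊢
  rw [hochBMulti_apply, Finset.sum_eq_add (⟨p, by omega⟩ : Fin (r + 2)) ⟨p + 1, by omega⟩
    (by simp) _ (by simp) (by simp)]
  · rw [face_nat, face_nat]
    dsimp only
    have : cls ι r (fun j => faceN r p g j) = cls ι r (fun j => faceN r (p + 1) g j) := by
      refine cls_bal_nat ι _ _ (fun j => if j ≤ p then g j else g (j + 1)) p
        (if p = r then 0 else p + 1) c (by omega) rfl (fun j hj => ?_) (fun j hj => ?_)
      · dsimp only [faceN]
        split_ifs <;> first | omega | grind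
      · dsimp only [faceN]
        split_ifs <;> first | omega | grind
    rw [this, pow_succ]
    simp
  · rintro ⟨i, hi⟩ - ⟨h1, h2⟩
    simp only [ne_eq, Fin.mk.injEq] at h1 h2
    rw [face_nat]
    have : cls ι r (fun j => faceN r i g j) = 0 := by
      refine cls_deg ι _ (⟨if i ≤ p then p else p + 1, by split_ifs <;> omega⟩ : Fin (r + 1)) c ?_ ?_
      · intro h
        have h := congrArg Fin.val h
        simp only [Fin.val_zero] at h
        split_ifs at h; omega
      · dsimp only [faceN]
        split_ifs <;> first | omega | grind
    simp [this]

/-- The Hochschild boundary `b : A ⊗ (A/K)^{⊗ (r+1)} ⊗ → A ⊗ (A/K)^{⊗ r} ⊗`. -/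
noncomputable def hochB (ι : K →ₐ[k] A) (r : ℕ) : HochX ι (r + 1) →ₗ[k] HochX ι r :=
  hochLift ι (hochBMulti ι r)
    (fun a p c => by simp only [hochBMulti_apply, face_bal])
    (fun a p c hp ha => hochBMulti_deg ι a p c hp ha)

theorem hochB_cls (ι : K →ₐ[k] A) (r : ℕ) (a : Fin (r + 2) → A) :
    hochB ι r (cls ι (r + 1) a) = ∑ i : Fin (r + 2), (-1 : k) ^ (i : ℕ) • cls ι r (face i a) := by
  rw [hochB, hochLift_cls, hochBMulti_apply]

/-- The tuple `1 ⊗ aᵢ ⊗ ⋯ ⊗ a_r ⊗ a₀ ⊗ ⋯ ⊗ aᵢ₋₁` (indices of `a` are added cyclically). -/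
def rot {r : ℕ} (i : Fin (r + 1)) (a : Fin (r + 1) → A) : Fin (r + 2) → A :=
  Fin.cons 1 fun j => a (i + j)

theorem rot_update {r : ℕ} (i : Fin (r + 1)) (a : Fin (r + 1) → A) (p : Fin (r + 1)) (v : A) :
    rot i (update a p v) = update (rot i a) (p - i).succ v := by
  ext j
  refine Fin.cases ?_ (fun j => ?_) j
  · simp [rot, update_apply, (Fin.succ_ne_zero _).symm]
  · simp [rot, update_apply, eq_sub_iff_add_eq, add_comm]

theorem rot_bal (ι : K →ₐ[k] A) {r : ℕ} (i : Fin (r + 1)) (a : Fin (r + 1) → A)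
    (p : Fin (r + 1)) (c : K) :
    cls ι (r + 1) (rot i (update a p (a p * ι c))) =
      cls ι (r + 1) (rot i (update a (p + 1) (ι c * a (p + 1)))) := by
  rw [rot_update, rot_update]
  have hrot : ∀ q : Fin (r + 1), rot i a (q - i).succ = a q := fun q => by simp [rot]
  rw [← hrot p, ← hrot (p + 1)]
  have h1 : (p + 1 - i) = (p - i) + 1 := by abel
  rw [h1, cls_bal]
  generalize p - i = q
  by_cases hq : q = Fin.last r
  · subst hq
    rw [Fin.succ_last, Fin.last_add_one, Fin.last_add_one]
    have h0 : rot i a 0 = 1 := rfl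
    have := cls_bal ι (rot i a) 0 c
    rw [h0, one_mul] at this
    rw [h0, mul_one, this]
    simp
  · have : q.succ + 1 = (q + 1).succ := by
      ext
      rw [Fin.val_succ, val_succ_cyc, val_succ_cyc, Fin.val_succ]
      have : (q : ℕ) ≠ r := fun h => hq (Fin.ext h)
      simp [this]
    rw [this]

/-- Connes' operator `B : A ⊗ (A/K)^{⊗ r} ⊗ → A ⊗ (A/K)^{⊗ (r+1)} ⊗`,
`[a₀ ⊗ ⋯ ⊗ a_r] ↦ ∑ᵢ (-1)^{ir} [1 ⊗ aᵢ ⊗ ⋯ ⊗ a_r ⊗ a₀ ⊗ ⋯ ⊗ aᵢ₋₁]`. -/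
noncomputable def connesB (ι : K →ₐ[k] A) (r : ℕ) : HochX ι r →ₗ[k] HochX ι (r + 1) :=
  hochLift ι
    (∑ i : Fin (r + 1), (-1 : k) ^ ((i : ℕ) * r) •
      tupleMap (s := r + 1) ι (rot i) (fun a p => ⟨_, LinearMap.id, rot_update i a p⟩))
    (fun a p c => by
      simp only [sum_apply, smul_apply]
      exact Finset.sum_congr rfl fun i _ => congrArg _ (rot_bal ι i a p c))
    (fun a p c _ ha => by
      simp only [sum_apply, smul_apply]
      refine Finset.sum_eq_zero fun i _ => ?_
      have : tupleMap (s := r + 1) ι (rot i)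
          (fun a p => ⟨_, LinearMap.id, rot_update i a p⟩) a = 0 :=
        cls_deg ι (rot i a) (p - i).succ c (Fin.succ_ne_zero _) (by simp [rot, ha])
      rw [this, smul_zero])

theorem connesB_cls (ι : K →ₐ[k] A) (r : ℕ) (a : Fin (r + 1) → A) :
    connesB ι r (cls ι r a) =
      ∑ i : Fin (r + 1), (-1 : k) ^ ((i : ℕ) * r) • cls ι (r + 1) (rot i a) := by
  simp [connesB, tupleMap]

end Relative

section Mixed

variable {k : Type*} [CommRing k] {X : ℕ → Type*} [∀ r, AddCommGroup (X r)] [∀ r, Module k (X r)]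

/-- `(X, b, B)` is a mixed complex: `b b = 0`, `B B = 0` and `B b + b B = 0`
(where `b = 0` on `X 0`). -/
structure IsMixedComplex (b : ∀ r, X (r + 1) →ₗ[k] X r) (B : ∀ r, X r →ₗ[k] X (r + 1)) : Prop where
  b_b : ∀ r, b r ∘ₗ b (r + 1) = 0
  B_B : ∀ r, B (r + 1) ∘ₗ B r = 0
  b_B_zero : b 0 ∘ₗ B 0 = 0
  B_b_add_b_B : ∀ r, B r ∘ₗ b r + b (r + 1) ∘ₗ B (r + 1) = 0

/-- The degree `r` part `X_r ⊕ X_{r-2} ⊕ X_{r-4} ⊕ ⋯` of the total complex of the double complex `BC`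
of a mixed complex; the index `(j, s)`, with `2j + s = r`, stands for the copy of `X_s` in
column `j`. -/
abbrev Tot (X : ℕ → Type*) (r : ℕ) : Type _ := ∀ p : {p : ℕ × ℕ // 2 * p.1 + p.2 = r}, X p.1.2

/-- The `(j, s)`-component of the horizontal part `B` of the differential of the total complex: `B`
applied to the component `(j + 1, s - 1)`, and `0` for `s = 0`. -/
def totB (B : ∀ r, X r →ₗ[k] X (r + 1)) (r : ℕ) (j : ℕ) :
    ∀ s : ℕ, 2 * j + s = r → (Tot X (r + 1) →ₗ[k] X s)
  | 0, _ => 0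
  | s + 1, h => B s ∘ₗ LinearMap.proj
      (⟨(j + 1, s), by simp only; omega⟩ : {q : ℕ × ℕ // 2 * q.1 + q.2 = r + 1})

/-- The differential `b + B` of the total complex. -/
def totD (b : ∀ r, X (r + 1) →ₗ[k] X r) (B : ∀ r, X r →ₗ[k] X (r + 1)) (r : ℕ) :
    Tot X (r + 1) →ₗ[k] Tot X r :=
  LinearMap.pi fun p =>
    b p.1.2 ∘ₗ LinearMap.proj
      (⟨(p.1.1, p.1.2 + 1), by have := p.2; simp only; omega⟩ :
        {q : ℕ × ℕ // 2 * q.1 + q.2 = r + 1}) +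
    totB B r p.1.1 p.1.2 p.2

/-- The cycles of degree `r` of the total complex. -/
def totCycles (b : ∀ r, X (r + 1) →ₗ[k] X r) (B : ∀ r, X r →ₗ[k] X (r + 1)) :
    ∀ r : ℕ, Submodule k (Tot X r)
  | 0 => ⊤
  | r + 1 => LinearMap.ker (totD b B r)

/-- The cyclic homology `HC_r` of a mixed complex: cycles modulo boundaries
of the total complex of `BC`. -/
abbrev HC (b : ∀ r, X (r + 1) →ₗ[k] X r) (B : ∀ r, X r →ₗ[k] X (r + 1)) (r : ℕ) : Type _ :=
  totCycles b B r ⧸ (LinearMap.range (totD b B r)).submoduleOf (totCycles b B r)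

/-- The periodicity map `S`, which deletes column `0` and moves column `j + 1` to column `j`. -/
def periodicity (r : ℕ) : Tot X (r + 2) →ₗ[k] Tot X r :=
  LinearMap.pi fun p => LinearMap.proj
    (⟨(p.1.1 + 1, p.1.2), by have := p.2; simp only; omega⟩ :
      {q : ℕ × ℕ // 2 * q.1 + q.2 = r + 2})

/-- The element of the total complex with component `y` in column `0` and `0` in the other columns. -/
def firstColumn (r : ℕ) : X r →ₗ[k] Tot X r :=
  LinearMap.single k (fun p : {p : ℕ × ℕ // 2 * p.1 + p.2 = r} => X p.1.2)
    (⟨(0, r), by simp⟩ : {p : ℕ × ℕ // 2 * p.1 + p.2 = r})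

end Mixed

/-- The data defining a noncommutative monogenic extension of a `k`-algebra `K`: an endomorphism
`α` of the `k`-algebra `K` and the coefficients `λ₀ = 1, λ₁, …, λ_n` (`n ≥ 2`) of the monic polynomial
`f = ∑_{i=0}^n λᵢ x^{n-i}`, where `α(λᵢ) = λᵢ` and `λᵢ c = αⁱ(c) λᵢ` for `c ∈ K`.
(The values `lam i` with `i > n` are irrelevant.) -/
structure MonogenicData (k K : Type*) [CommRing k] [Ring K] [Algebra k K] where
  alpha : K →ₐ[k] K
  n : ℕ
  two_le : 2 ≤ n
  lam : ℕ → K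
  lam_zero : lam 0 = 1
  alpha_lam : ∀ i, 1 ≤ i → i ≤ n → alpha (lam i) = lam i
  lam_mul : ∀ i, 1 ≤ i → i ≤ n → ∀ c : K, lam i * c = (alpha ^ i) c * lam i

namespace MonogenicData

variable {k K : Type*} [CommRing k] [Ring K] [Algebra k K] (D : MonogenicData k K)

/-- The action of `Multiplicative ℕ` on `K` through the powers of `α`. -/
abbrev act : MulSemiringAction (Multiplicative ℕ) K where
  smul i c := (D.alpha ^ i.toAdd) c
  one_smul c := by change (D.alpha ^ 0) c = c; simp
  mul_smul i j c := by
    change (D.alpha ^ (i.toAdd + j.toAdd)) c = (D.alpha ^ i.toAdd) ((D.alpha ^ j.toAdd) c)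
    rw [pow_add]; rfl
  smul_zero i := map_zero (D.alpha ^ i.toAdd)
  smul_add i := map_add (D.alpha ^ i.toAdd)
  smul_one i := map_one (D.alpha ^ i.toAdd)
  smul_mul i := map_mul (D.alpha ^ i.toAdd)

/-- The Ore extension `B = K[x, α]`. -/
def Ore (_ : MonogenicData k K) : Type _ := SkewPolynomial K

noncomputable instance : Ring D.Ore :=
  letI := D.act
  inferInstanceAs (Ring (SkewPolynomial K))

/-- The monomial `c xⁱ` of `B`. -/
noncomputable def mon (i : ℕ) (c : K) : D.Ore := SkewPolynomial.monomial (R := K) i c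

/-- The coefficient of `xⁱ`. -/
noncomputable def coeff (i : ℕ) : D.Ore →+ K where
  toFun P := SkewPolynomial.coeff (R := K) P i
  map_zero' := rfl
  map_add' P Q := congrFun (congrArg DFunLike.coe (SkewMonoidAlgebra.coeff_add (k := K) P Q)) _

theorem mon_mul_mon (i j : ℕ) (a c : K) :
    D.mon i a * D.mon j c = D.mon (i + j) (a * (D.alpha ^ i) c) := by
  let := D.act
  exact SkewMonoidAlgebra.single_mul_single

theorem mon_add (i : ℕ) (a c : K) : D.mon i (a + c) = D.mon i a + D.mon i c :=
  SkewPolynomial.monomial_add (R := K) i a c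

theorem mon_zero (i : ℕ) : D.mon i 0 = 0 := SkewPolynomial.monomial_zero_right (R := K) i

theorem coeff_mon (i j : ℕ) (a : K) : D.coeff j (D.mon i a) = if i = j then a else 0 :=
  Finsupp.single_apply (a := Multiplicative.ofAdd i) (a' := Multiplicative.ofAdd j)

theorem mon_zero_one : D.mon 0 1 = 1 := rfl

theorem ore_ext {P Q : D.Ore} (h : ∀ i, D.coeff i P = D.coeff i Q) : P = Q :=
  SkewMonoidAlgebra.ext (k := K) (fun i => h i.toAdd)

theorem ore_induction {p : D.Ore → Prop} (P : D.Ore) (h0 : p 0)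
    (hm : ∀ i a, p (D.mon i a)) (ha : ∀ P Q, p P → p Q → p (P + Q)) : p P :=
  SkewPolynomial.induction (R := K) P h0 (fun i a _ _ _ hQ => ha _ _ (hm i a) hQ)

theorem exists_bound (P : D.Ore) : ∃ N, ∀ i, N ≤ i → D.coeff i P = 0 := by
  refine D.ore_induction (p := fun P => ∃ N, ∀ i, N ≤ i → D.coeff i P = 0) P ?_ ?_ ?_
  · exact ⟨0, fun i _ => map_zero _⟩
  · exact fun i a => ⟨i + 1, fun j hj => by rw [coeff_mon, if_neg (by omega)]⟩
  · rintro P Q ⟨M, hM⟩ ⟨N, hN⟩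
    exact ⟨max M N, fun i hi => by rw [map_add, hM i (by omega), hN i (by omega), add_zero]⟩

noncomputable instance : Algebra k D.Ore :=
  RingHom.toAlgebra'
    { toFun := fun c => D.mon 0 (algebraMap k K c)
      map_one' := by rw [map_one]; rfl
      map_mul' := fun a c => by rw [mon_mul_mon]; simp
      map_zero' := by rw [map_zero, mon_zero]
      map_add' := fun a c => by rw [map_add, mon_add] }
    (fun c P => by
      change D.mon 0 (algebraMap k K c) * P = P * D.mon 0 (algebraMap k K c)
      refine D.ore_induction (p := fun P => D.mon 0 (algebraMap k K c) * P =
        P * D.mon 0 (algebraMap k K c)) P (by simp) (fun i a => ?_) (fun P Q hP hQ => ?_)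
      · rw [mon_mul_mon, mon_mul_mon]
        simp [Algebra.commutes]
      · rw [mul_add, add_mul, hP, hQ])

theorem ore_smul_def (c : k) (P : D.Ore) : c • P = D.mon 0 (algebraMap k K c) * P :=
  Algebra.smul_def c P

/-- The monic polynomial `f = ∑_{i=0}^n λᵢ x^{n-i}`. -/
noncomputable def f : D.Ore := ∑ i ∈ Finset.range (D.n + 1), D.mon (D.n - i) (D.lam i)

theorem pow_alpha_lam (j i : ℕ) (hi : i ≤ D.n) : (D.alpha ^ j) (D.lam i) = D.lam i := by
  rcases Nat.eq_zero_or_pos i with rfl | h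
  · rw [D.lam_zero, map_one]
  · induction j with
    | zero => simp
    | succ j ih => rw [pow_succ, AlgHom.mul_apply, D.alpha_lam i h hi, ih]

theorem lam_mul' (i : ℕ) (hi : i ≤ D.n) (c : K) : D.lam i * c = (D.alpha ^ i) c * D.lam i := by
  rcases Nat.eq_zero_or_pos i with rfl | h
  · simp [D.lam_zero]
  · exact D.lam_mul i h hi c

theorem pow_alpha_add (i j : ℕ) (c : K) :
    (D.alpha ^ i) ((D.alpha ^ j) c) = (D.alpha ^ (i + j)) c := by rw [pow_add]; rfl

theorem f_mul_mon (i : ℕ) (c : K) : D.f * D.mon i c = D.mon i ((D.alpha ^ D.n) c) * D.f := by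
  rw [f, Finset.sum_mul, Finset.mul_sum]
  refine Finset.sum_congr rfl fun j hj => ?_
  have hj : j ≤ D.n := by simpa [Nat.lt_succ_iff] using hj
  rw [mon_mul_mon, mon_mul_mon, D.pow_alpha_lam _ _ hj, D.lam_mul' j hj, D.pow_alpha_add,
    Nat.add_sub_cancel' hj, add_comm]

theorem coeff_mul_mon (P : D.Ore) (t j : ℕ) (c : K) :
    D.coeff t (P * D.mon j c) =
      if j ≤ t then D.coeff (t - j) P * (D.alpha ^ (t - j)) c else 0 := by
  refine D.ore_induction (p := fun P => D.coeff t (P * D.mon j c) =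
      if j ≤ t then D.coeff (t - j) P * (D.alpha ^ (t - j)) c else 0) P ?_ ?_ ?_
  · simp
  · intro i a
    rw [mon_mul_mon, coeff_mon, coeff_mon]
    by_cases h : i + j = t
    · subst h; simp
    · rw [if_neg h]
      split_ifs with h1 h2
      · omega
      · simp
      · rfl
  · intro P Q hP hQ
    rw [add_mul, map_add, hP, hQ]
    split_ifs <;> simp [add_mul]

theorem coeff_mon_zero_mul (P : D.Ore) (t : ℕ) (c : K) :
    D.coeff t (D.mon 0 c * P) = c * D.coeff t P := by
  refine D.ore_induction (p := fun P => D.coeff t (D.mon 0 c * P) = c * D.coeff t P) P ?_ ?_ ?_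
  · simp
  · intro i a
    rw [mon_mul_mon, coeff_mon, coeff_mon]; simp
  · intro P Q hP hQ
    rw [mul_add, map_add, hP, hQ, map_add, mul_add]

theorem coeff_mul_f (P : D.Ore) (N : ℕ) (h : ∀ i, N < i → D.coeff i P = 0) :
    D.coeff (N + D.n) (P * D.f) = D.coeff N P := by
  rw [f, Finset.mul_sum, map_sum, Finset.sum_eq_single 0]
  · rw [coeff_mul_mon]; simp [D.lam_zero]
  · intro i hi h0
    have hi : i ≤ D.n := by simpa [Nat.lt_succ_iff] using hi
    rw [coeff_mul_mon, if_pos (by omega), h _ (by omega), zero_mul]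
  · simp

theorem eq_zero_of_mul_f (P : D.Ore) (h : ∀ i, D.n ≤ i → D.coeff i (P * D.f) = 0) : P = 0 := by
  obtain ⟨N, hN⟩ := D.exists_bound P
  induction N with
  | zero => exact D.ore_ext fun i => by rw [hN i (Nat.zero_le i), map_zero]
  | succ N ih =>
    refine ih fun i hi => ?_
    rcases Nat.lt_or_ge N i with h1 | h1
    · exact hN i h1
    · obtain rfl : i = N := le_antisymm h1 hi
      rw [← D.coeff_mul_f P i (fun j hj => hN j hj)]
      exact h _ (by omega)

/-- Existence of the division `P = Q f + R` with `R = 0` or `deg R < n`. -/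
theorem exists_quot (P : D.Ore) : ∃ Q : D.Ore, ∀ i, D.n ≤ i → D.coeff i (P - Q * D.f) = 0 := by
  obtain ⟨N, h0⟩ := D.exists_bound P
  have hN : ∀ i, N + D.n ≤ i → D.coeff i P = 0 := fun i hi => h0 i (by omega)
  clear h0
  induction N generalizing P with
  | zero => exact ⟨0, fun i hi => by rw [zero_mul, sub_zero]; exact hN i (by omega)⟩
  | succ N ih =>
    have key : ∀ i, N + D.n ≤ i →
        D.coeff i (P - D.mon N (D.coeff (N + D.n) P) * D.f) = 0 := by
      intro i hi
      obtain ⟨M, rfl⟩ : ∃ M, i = M + D.n := ⟨i - D.n, by omega⟩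
      rw [map_sub, D.coeff_mul_f _ M (fun j hj => by rw [coeff_mon, if_neg (by omega)]), coeff_mon]
      split_ifs with h1
      · rw [h1, sub_self]
      · rw [hN _ (by omega), sub_zero]
    obtain ⟨Q, hQ⟩ := ih _ key
    refine ⟨D.mon N (D.coeff (N + D.n) P) + Q, fun i hi => ?_⟩
    rw [add_mul, ← sub_sub]
    exact hQ i hi

/-- The quotient `P̄` of the division of `P` by `f`. -/
noncomputable def quot (P : D.Ore) : D.Ore := (D.exists_quot P).choose

/-- The remainder of the division of `P` by `f`. -/
noncomputable def rem (P : D.Ore) : D.Ore := P - D.quot P * D.f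

theorem coeff_rem (P : D.Ore) (i : ℕ) (hi : D.n ≤ i) : D.coeff i (D.rem P) = 0 :=
  (D.exists_quot P).choose_spec i hi

theorem quot_eq (P Q : D.Ore) (h : ∀ i, D.n ≤ i → D.coeff i (P - Q * D.f) = 0) :
    D.quot P = Q := by
  refine sub_eq_zero.1 (D.eq_zero_of_mul_f _ fun i hi => ?_)
  have h1 := D.coeff_rem P i hi
  have h2 := h i hi
  rw [rem, map_sub] at h1
  rw [map_sub] at h2
  rw [sub_mul, map_sub, ← sub_eq_zero.1 h1, ← sub_eq_zero.1 h2, sub_self]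

theorem quot_add (P Q : D.Ore) : D.quot (P + Q) = D.quot P + D.quot Q := by
  refine D.quot_eq _ _ fun i hi => ?_
  have : P + Q - (D.quot P + D.quot Q) * D.f = D.rem P + D.rem Q := by
    rw [rem, rem, add_mul]; abel
  rw [this, map_add, D.coeff_rem _ _ hi, D.coeff_rem _ _ hi, add_zero]

theorem rem_add (P Q : D.Ore) : D.rem (P + Q) = D.rem P + D.rem Q := by
  rw [rem, quot_add, rem, rem, add_mul]; abel

theorem rem_mul_f (P : D.Ore) : D.rem (P * D.f) = 0 := by
  have : D.quot (P * D.f) = P := D.quot_eq _ _ fun i _ => by rw [sub_self, map_zero]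
  rw [rem, this, sub_self]

theorem quot_small (P : D.Ore) (h : ∀ i, D.n ≤ i → D.coeff i P = 0) : D.quot P = 0 :=
  D.quot_eq _ _ fun i hi => by rw [zero_mul, sub_zero, h i hi]

theorem rem_small (P : D.Ore) (h : ∀ i, D.n ≤ i → D.coeff i P = 0) : D.rem P = P := by
  rw [rem, D.quot_small P h, zero_mul, sub_zero]

theorem quot_mon_zero_mul (c : K) (P : D.Ore) : D.quot (D.mon 0 c * P) = D.mon 0 c * D.quot P := by
  refine D.quot_eq _ _ fun i hi => ?_
  rw [mul_assoc, ← mul_sub, coeff_mon_zero_mul]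
  exact (congrArg _ (D.coeff_rem P i hi)).trans (mul_zero c)

theorem rem_mon_zero_mul (c : K) (P : D.Ore) : D.rem (D.mon 0 c * P) = D.mon 0 c * D.rem P := by
  rw [rem, quot_mon_zero_mul, rem, mul_sub, mul_assoc]

theorem quot_mul_mon_zero (c : K) (P : D.Ore) :
    D.quot (P * D.mon 0 c) = D.quot P * D.mon 0 ((D.alpha ^ D.n) c) := by
  refine D.quot_eq _ _ fun i hi => ?_
  rw [mul_assoc, ← f_mul_mon, ← mul_assoc, ← sub_mul, coeff_mul_mon, if_pos (Nat.zero_le i)]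
  exact (congrArg (· * _) (D.coeff_rem P i hi)).trans (zero_mul _)

theorem rem_mul_mon_zero (c : K) (P : D.Ore) :
    D.rem (P * D.mon 0 c) = D.rem P * D.mon 0 c := by
  rw [rem, quot_mul_mon_zero, rem, sub_mul, mul_assoc, mul_assoc, f_mul_mon]

/-- The two-sided ideal `⟨f⟩`. -/
noncomputable def idl : Ideal D.Ore := (TwoSidedIdeal.span ({D.f} : Set D.Ore)).asIdeal

instance : D.idl.IsTwoSided := inferInstanceAs (TwoSidedIdeal.asIdeal _).IsTwoSided

theorem f_mul (P : D.Ore) : ∃ Q : D.Ore, D.f * P = Q * D.f := by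
  refine D.ore_induction (p := fun P => ∃ Q : D.Ore, D.f * P = Q * D.f) P
    ⟨0, by simp⟩ (fun i a => ⟨_, D.f_mul_mon i a⟩) ?_
  rintro P Q ⟨P', hP⟩ ⟨Q', hQ⟩
  exact ⟨P' + Q', by rw [mul_add, add_mul, hP, hQ]⟩

theorem mem_idl {P : D.Ore} (h : P ∈ D.idl) : ∃ Q : D.Ore, P = Q * D.f := by
  let J : TwoSidedIdeal D.Ore := TwoSidedIdeal.mk' {P | ∃ Q : D.Ore, P = Q * D.f}
    ⟨0, by simp⟩
    (by rintro _ _ ⟨P, rfl⟩ ⟨Q, rfl⟩; exact ⟨P + Q, by rw [add_mul]⟩)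
    (by rintro _ ⟨P, rfl⟩; exact ⟨-P, by rw [neg_mul]⟩)
    (by rintro Q _ ⟨P, rfl⟩; exact ⟨Q * P, by rw [mul_assoc]⟩)
    (by
      rintro _ Q ⟨P, rfl⟩
      obtain ⟨Q', hQ⟩ := D.f_mul Q
      exact ⟨P * Q', by rw [mul_assoc, hQ, mul_assoc]⟩)
  have hJ : ∀ P : D.Ore, P ∈ J ↔ ∃ Q : D.Ore, P = Q * D.f := fun P => by
    simp [J]
  have : TwoSidedIdeal.span ({D.f} : Set D.Ore) ≤ J := by
    rw [TwoSidedIdeal.span_le]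
    rintro _ rfl
    exact (hJ _).2 ⟨1, by simp⟩
  exact (hJ P).1 (this (TwoSidedIdeal.mem_asIdeal.1 h))

/-- The monogenic extension `A = B / ⟨f⟩`. -/
abbrev Ext : Type _ := D.Ore ⧸ D.idl

/-- The projection `B → A`. -/
noncomputable def proj : D.Ore →ₐ[k] D.Ext := Ideal.Quotient.mkₐ k D.idl

/-- The structure map `K → A`. -/
noncomputable def incl : K →ₐ[k] D.Ext :=
  D.proj.comp
    { toFun := D.mon 0
      map_one' := rfl
      map_mul' := fun a c => by rw [mon_mul_mon]; simp
      map_zero' := D.mon_zero 0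
      map_add' := D.mon_add 0
      commutes' := fun _ => rfl }

/-- The class of `x` in `A`. -/
noncomputable def gen : D.Ext := D.proj (D.mon 1 1)

theorem proj_surjective : Surjective D.proj := Ideal.Quotient.mk_surjective

theorem incl_eq (c : K) : D.incl c = D.proj (D.mon 0 c) := rfl

theorem mon_one_pow (i : ℕ) : D.mon 1 1 ^ i = D.mon i 1 := by
  induction i with
  | zero => rfl
  | succ i ih => rw [pow_succ, ih, mon_mul_mon]; simp

theorem gen_pow (i : ℕ) : D.gen ^ i = D.proj (D.mon i 1) := by
  rw [gen, ← map_pow, mon_one_pow]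

theorem gen_pow_mul_incl (i : ℕ) (c : K) :
    D.gen ^ i * D.incl c = D.incl ((D.alpha ^ i) c) * D.gen ^ i := by
  rw [gen_pow, incl_eq, incl_eq, ← map_mul, ← map_mul, mon_mul_mon, mon_mul_mon]
  simp

theorem rem_eq_of_proj_eq {P Q : D.Ore} (h : D.proj P = D.proj Q) : D.rem P = D.rem Q := by
  obtain ⟨R, hR⟩ := D.mem_idl (Ideal.Quotient.eq.1 h)
  rw [sub_eq_iff_eq_add.1 hR, rem_add, rem_mul_f, zero_add]

theorem proj_rem (P : D.Ore) : D.proj (D.rem P) = D.proj P := by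
  refine Ideal.Quotient.eq.2 ?_
  have : D.rem P - P = -(D.quot P * D.f) := by rw [rem]; abel
  rw [this]
  exact D.idl.neg_mem (D.idl.mul_mem_left _
    (TwoSidedIdeal.mem_asIdeal.2 (TwoSidedIdeal.subset_span rfl)))

/-- The `i`-th coordinate of an element of `A` in the left `K`-basis `1, x, …, x^{n-1}`. -/
noncomputable def coord (i : ℕ) : D.Ext →ₗ[k] K where
  toFun a := D.coeff i (D.rem (D.proj_surjective a).choose)
  map_add' a b := by
    rw [← map_add, ← rem_add]
    congr 1
    refine D.rem_eq_of_proj_eq ?_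
    rw [map_add, (D.proj_surjective _).choose_spec, (D.proj_surjective _).choose_spec,
      (D.proj_surjective _).choose_spec]
  map_smul' c a := by
    have h : D.rem (D.proj_surjective (c • a)).choose =
        D.mon 0 (algebraMap k K c) * D.rem (D.proj_surjective a).choose := by
      rw [← rem_mon_zero_mul]
      refine D.rem_eq_of_proj_eq ?_
      rw [← ore_smul_def, map_smul, (D.proj_surjective _).choose_spec,
        (D.proj_surjective _).choose_spec]
    rw [h, coeff_mon_zero_mul, RingHom.id_apply, Algebra.smul_def]

theorem coord_proj (i : ℕ) (P : D.Ore) : D.coord i (D.proj P) = D.coeff i (D.rem P) :=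
  congrArg (D.coeff i) (D.rem_eq_of_proj_eq (D.proj_surjective (D.proj P)).choose_spec)

theorem coord_incl_mul (i : ℕ) (c : K) (a : D.Ext) :
    D.coord i (D.incl c * a) = c * D.coord i a := by
  obtain ⟨P, rfl⟩ := D.proj_surjective a
  rw [incl_eq, ← map_mul, coord_proj, coord_proj, rem_mon_zero_mul, coeff_mon_zero_mul]

theorem coord_mul_incl (i : ℕ) (c : K) (a : D.Ext) :
    D.coord i (a * D.incl c) = D.coord i a * (D.alpha ^ i) c := by
  obtain ⟨P, rfl⟩ := D.proj_surjective a
  rw [incl_eq, ← map_mul, coord_proj, coord_proj, rem_mul_mon_zero, coeff_mul_mon]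
  simp

theorem coord_gen_pow (i j : ℕ) (hj : j < D.n) :
    D.coord i (D.gen ^ j) = if j = i then 1 else 0 := by
  rw [gen_pow, coord_proj, rem_small, coeff_mon]
  intro t ht
  rw [coeff_mon, if_neg (by omega)]

theorem coord_incl (i : ℕ) (hi : i ≠ 0) (c : K) : D.coord i (D.incl c) = 0 := by
  have h := D.coord_incl_mul i c (D.gen ^ 0)
  rw [pow_zero, mul_one] at h
  rw [h, ← pow_zero D.gen, D.coord_gen_pow i 0 (by have := D.two_le; omega), if_neg hi.symm,
    mul_zero]

/-- The class in `A` of the quotient of the division of `x^s` by `f`. -/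
noncomputable def bar (s : ℕ) : D.Ext := D.proj (D.quot (D.mon s 1))

theorem bar_of_lt (s : ℕ) (h : s < D.n) : D.bar s = 0 := by
  rw [bar, quot_small, map_zero]
  intro t ht
  rw [coeff_mon, if_neg (by omega)]

theorem incl_mul_bar (s : ℕ) (c : K) :
    D.incl ((D.alpha ^ s) c) * D.bar s = D.bar s * D.incl ((D.alpha ^ D.n) c) := by
  rw [bar, incl_eq, incl_eq, ← map_mul, ← map_mul, ← quot_mul_mon_zero, ← quot_mon_zero_mul,
    mon_mul_mon, mon_mul_mon]
  simp

theorem incl_lam_mul_incl (i : ℕ) (hi : i ≤ D.n) (c : K) :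
    D.incl (D.lam i) * D.incl c = D.incl ((D.alpha ^ i) c) * D.incl (D.lam i) := by
  rw [← map_mul, ← map_mul, D.lam_mul' i hi]

/-- `[A, K]_{αʲ}`, the `k`-submodule of `A` generated by the twisted commutators
`a αʲ(c) - c a`. -/
noncomputable def twComm (j : ℕ) : Submodule k D.Ext :=
  Submodule.span k {t | ∃ (a : D.Ext) (c : K),
    t = a * D.incl ((D.alpha ^ j) c) - D.incl c * a}

/-- The exponent of the twist in degree `r`: `mn` for `r = 2m` and `mn + 1` for `r = 2m + 1`. -/
def tw (r : ℕ) : ℕ := r / 2 * D.n + r % 2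

/-- `C^S_r(A) = A / [A, K]_{α^{mn}}` for `r = 2m`, and `A / [A, K]_{α^{mn+1}}` for `r = 2m + 1`. -/
abbrev CS (r : ℕ) : Type _ := D.Ext ⧸ D.twComm (D.tw r)

/-- The class `[a]` in `C^S_r(A)`. -/
noncomputable def csMk (r : ℕ) : D.Ext →ₗ[k] D.CS r := (D.twComm (D.tw r)).mkQ

theorem csMk_comm (r : ℕ) (a : D.Ext) (c : K) :
    D.csMk r (a * D.incl ((D.alpha ^ D.tw r) c)) = D.csMk r (D.incl c * a) :=
  (Submodule.Quotient.eq _).2 (Submodule.subset_span ⟨a, c, rfl⟩)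

/-- A linear map on `A` which respects the twisted commutators descends to `C^S_r(A)`. -/
noncomputable def csLift (r : ℕ) {N : Type*} [AddCommGroup N] [Module k N] (F : D.Ext →ₗ[k] N)
    (h : ∀ (a : D.Ext) (c : K), F (a * D.incl ((D.alpha ^ D.tw r) c)) = F (D.incl c * a)) :
    D.CS r →ₗ[k] N :=
  (D.twComm (D.tw r)).liftQ F (by
    refine Submodule.span_le.2 ?_
    rintro _ ⟨a, c, rfl⟩
    rw [SetLike.mem_coe, LinearMap.mem_ker, map_sub, h, sub_self])

@[simp] theorem csLift_mk (r : ℕ) {N : Type*} [AddCommGroup N] [Module k N] (F : D.Ext →ₗ[k] N) (h)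
    (a : D.Ext) : D.csLift r F h (D.csMk r a) = F a := rfl

/-- `a ↦ a x - x a`. -/
noncomputable def dOdd : D.Ext →ₗ[k] D.Ext :=
  LinearMap.mulRight k D.gen - LinearMap.mulLeft k D.gen

/-- `a ↦ ∑_{i=1}^n ∑_{l=0}^{i-1} λ_{n-i} x^{i-l-1} a x^l`. -/
noncomputable def dEven : D.Ext →ₗ[k] D.Ext :=
  ∑ i ∈ Finset.Icc 1 D.n, ∑ l ∈ Finset.range i,
    LinearMap.mulLeft k (D.incl (D.lam (D.n - i)) * D.gen ^ (i - l - 1)) ∘ₗ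
      LinearMap.mulRight k (D.gen ^ l)

theorem dOdd_apply (a : D.Ext) : D.dOdd a = a * D.gen - D.gen * a := rfl

theorem dEven_apply (a : D.Ext) : D.dEven a = ∑ i ∈ Finset.Icc 1 D.n, ∑ l ∈ Finset.range i,
    D.incl (D.lam (D.n - i)) * D.gen ^ (i - l - 1) * a * D.gen ^ l := by
  simp [dEven, mul_assoc]

theorem dOdd_comm (m : ℕ) (a : D.Ext) (c : K) :
    D.csMk (2 * m) (D.dOdd (a * D.incl ((D.alpha ^ D.tw (2 * m + 1)) c))) =
      D.csMk (2 * m) (D.dOdd (D.incl c * a)) := by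
  have h1 : D.tw (2 * m + 1) = D.tw (2 * m) + 1 := by
    simp only [tw]
    rw [show (2 * m + 1) / 2 = 2 * m / 2 by omega]; omega
  rw [dOdd_apply, dOdd_apply, map_sub, map_sub]
  congr 1
  · rw [h1, add_comm, ← pow_alpha_add, pow_one, mul_assoc]
    have := D.gen_pow_mul_incl 1 ((D.alpha ^ D.tw (2 * m)) c)
    rw [pow_one, pow_one] at this
    rw [← this, ← mul_assoc, csMk_comm, mul_assoc]
  · have := D.gen_pow_mul_incl 1 c
    rw [pow_one, pow_one] at this
    rw [← mul_assoc, ← mul_assoc, this, h1, ← pow_alpha_add, pow_one, csMk_comm, mul_assoc]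

theorem dEven_comm (m : ℕ) (a : D.Ext) (c : K) :
    D.csMk (2 * m + 1) (D.dEven (a * D.incl ((D.alpha ^ D.tw (2 * m + 2)) c))) =
      D.csMk (2 * m + 1) (D.dEven (D.incl c * a)) := by
  have h1 : D.tw (2 * m + 2) = m * D.n + D.n := by
    simp only [tw]
    rw [show (2 * m + 2) / 2 = m + 1 by omega, show (2 * m + 2) % 2 = 0 by omega]; ring
  have h2 : D.tw (2 * m + 1) = m * D.n + 1 := by
    simp only [tw]
    rw [show (2 * m + 1) / 2 = m by omega, show (2 * m + 1) % 2 = 1 by omega]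
  rw [dEven_apply, dEven_apply, map_sum, map_sum]
  refine Finset.sum_congr rfl fun i hi => ?_
  rw [map_sum, map_sum]
  refine Finset.sum_congr rfl fun l hl => ?_
  rw [Finset.mem_Icc] at hi
  rw [Finset.mem_range] at hl
  have e1 : D.incl ((D.alpha ^ D.tw (2 * m + 2)) c) * D.gen ^ l =
      D.gen ^ l * D.incl ((D.alpha ^ D.tw (2 * m + 1)) ((D.alpha ^ (D.n - l - 1)) c)) := by
    have h3 : l + (D.tw (2 * m + 1) + (D.n - l - 1)) = D.tw (2 * m + 2) := by
      rw [h1, h2]; omega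
    rw [gen_pow_mul_incl, pow_alpha_add, pow_alpha_add, add_assoc, h3]
  have e2 : D.incl (D.lam (D.n - i)) * D.gen ^ (i - l - 1) * D.incl c =
      D.incl ((D.alpha ^ (D.n - l - 1)) c) * (D.incl (D.lam (D.n - i)) * D.gen ^ (i - l - 1)) := by
    have h3 : D.n - i + (i - l - 1) = D.n - l - 1 := by omega
    rw [mul_assoc, gen_pow_mul_incl, ← mul_assoc, D.incl_lam_mul_incl _ (by omega), pow_alpha_add,
      mul_assoc, h3]
  rw [← mul_assoc, ← mul_assoc, e2, mul_assoc _ (D.incl _) (D.gen ^ l), e1, ← mul_assoc, csMk_comm]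
  simp only [mul_assoc]

/-- The boundary `d : C^S_{r+1}(A) → C^S_r(A)`: `d_{2m+1}[a] = [a x - x a]` and
`d_{2m}[a] = ∑_{i=1}^n ∑_{l=0}^{i-1} [λ_{n-i} x^{i-l-1} a x^l]`. -/
noncomputable def d (r : ℕ) : D.CS (r + 1) →ₗ[k] D.CS r :=
  D.csLift (r + 1) (D.csMk r ∘ₗ if r % 2 = 0 then D.dOdd else D.dEven) (fun a c => by
    rcases Nat.even_or_odd' r with ⟨m, rfl | rfl⟩
    · simpa using D.dOdd_comm m a c
    · have : (2 * m + 1) % 2 ≠ 0 := by omega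
      simpa [this] using D.dEven_comm m a c)

/-- The entries with index `p ≥ 1` of `[a ⊗ x ⊗ x^{l_m} ⊗ ⋯ ⊗ x ⊗ x^{l_1}]` (for `r = 2m`) and
`[a ⊗ x ⊗ x^{l_m} ⊗ ⋯ ⊗ x ⊗ x^{l_1} ⊗ x]` (for `r = 2m + 1`), as exponents of `x`;
here `l_{t+1}` is `l t`. -/
def phiExp (r : ℕ) (l : Fin (r / 2) → ℕ) (p : Fin (r + 1)) : ℕ :=
  if h : (p : ℕ) % 2 = 1 ∨ (p : ℕ) = 0 then 1 else l ⟨r / 2 - p / 2, by omega⟩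

/-- The tuple `(a, x, x^{l_m}, …, x, x^{l_1})`, resp. `(a, x, x^{l_m}, …, x, x^{l_1}, x)`. -/
noncomputable def phiTuple (r : ℕ) (l : Fin (r / 2) → ℕ) (a : D.Ext) : Fin (r + 1) → D.Ext :=
  fun p => if p = 0 then a else D.gen ^ phiExp r l p

/-- The summand of `φ` with multi-indices `i` and `l`:
`a ↦ [λ_{n-i_1}⋯λ_{n-i_m} a x^{|i - l| - m} ⊗ x ⊗ x^{l_m} ⊗ ⋯ ⊗ x ⊗ x^{l_1} (⊗ x)]`. -/
noncomputable def phiTerm (r : ℕ) (i l : Fin (r / 2) → ℕ) : D.Ext →ₗ[k] HochX D.incl r :=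
  (cls D.incl r).toLinearMap (D.phiTuple r l 0) 0 ∘ₗ
    LinearMap.mulLeft k (D.incl (List.ofFn fun t => D.lam (D.n - i t)).prod) ∘ₗ
      LinearMap.mulRight k (D.gen ^ ((∑ t, (i t - l t)) - r / 2))

theorem update_phiTuple (r : ℕ) (l : Fin (r / 2) → ℕ) (a b : D.Ext) :
    update (D.phiTuple r l a) 0 b = D.phiTuple r l b := by
  ext p
  by_cases h : p = 0 <;> simp [h, phiTuple]

theorem phiTerm_apply (r : ℕ) (i l : Fin (r / 2) → ℕ) (a : D.Ext) :
    D.phiTerm r i l a = cls D.incl r (D.phiTuple r l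
      (D.incl (List.ofFn fun t => D.lam (D.n - i t)).prod * a *
        D.gen ^ ((∑ t, (i t - l t)) - r / 2))) := by
  simp [phiTerm, update_phiTuple, mul_assoc]

theorem phiTuple_move (r : ℕ) (l : Fin (r / 2) → ℕ) (b : D.Ext) (c : K) :
    cls D.incl r (D.phiTuple r l
      (b * D.incl ((D.alpha ^ (∑ p : Fin r, phiExp r l p.succ)) c))) =
    cls D.incl r (D.phiTuple r l (D.incl c * b)) := by
  -- the exponents as a function on `ℕ`
  obtain ⟨E, hE⟩ : ∃ E : ℕ → ℕ, ∀ p : Fin r, phiExp r l p.succ = E (p + 1) :=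
    ⟨fun j => if h : j < r + 1 then phiExp r l ⟨j, h⟩ else 0, fun p => by
      dsimp only; rw [dif_pos (by omega)]; rfl⟩
  let g : ℕ → D.Ext := fun j => if j = 0 then b else D.gen ^ E j
  have hT : ∀ a : D.Ext, D.phiTuple r l a = fun j : Fin (r + 1) =>
      (fun j : ℕ => if j = 0 then a else D.gen ^ E j) j := by
    intro a
    ext j
    refine Fin.cases ?_ (fun j => ?_) j
    · simp [phiTuple]
    · simp [phiTuple, hE]
  rw [hT, hT]
  simp only [hE]
  rw [Fin.sum_univ_eq_sum_range (fun p => E (p + 1)) r]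
  have key : ∀ s t : ℕ, s + t = r →
      cls D.incl r (fun j : Fin (r + 1) => (fun j : ℕ => if j = 0 then
        b * D.incl ((D.alpha ^ (∑ p ∈ Finset.range r, E (p + 1))) c) else D.gen ^ E j) j) =
      cls D.incl r (fun j : Fin (r + 1) => (fun j : ℕ => if j = s then
        g s * D.incl ((D.alpha ^ (∑ p ∈ Finset.Ico s r, E (p + 1))) c) else g j) j) := by
    intro s
    induction s with
    | zero =>
      intro t _
      congr 1
      ext j
      simp only [g, Finset.range_eq_Ico]
      split_ifs <;> simp_all
    | succ s ih =>
      intro t ht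
      rw [ih (t + 1) (by omega)]
      refine cls_bal_nat (r := r) D.incl
        (fun j => if j = s then
          g s * D.incl ((D.alpha ^ (∑ p ∈ Finset.Ico s r, E (p + 1))) c) else g j)
        (fun j => if j = s + 1 then
          g (s + 1) * D.incl ((D.alpha ^ (∑ p ∈ Finset.Ico (s + 1) r, E (p + 1))) c) else g j)
        g s (s + 1)
        ((D.alpha ^ (∑ p ∈ Finset.Ico s r, E (p + 1))) c) (by omega)
        (by rw [if_neg (by omega)]) (fun j hj => rfl) (fun j hj => ?_)
      have hg : g (s + 1) = D.gen ^ E (s + 1) := if_neg (by omega)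
      rw [hg, gen_pow_mul_incl, pow_alpha_add,
        Finset.sum_eq_sum_Ico_succ_bot (show s < r by omega) (fun p => E (p + 1))]
  rw [key r 0 rfl]
  refine cls_bal_nat (r := r) D.incl
    (fun j => if j = r then g r * D.incl ((D.alpha ^ ∑ p ∈ Finset.Ico r r, E (p + 1)) c) else g j)
    (fun j => if j = 0 then D.incl c * b else D.gen ^ E j) g r 0 c le_rfl (by simp) (fun j hj => ?_) (fun j hj => ?_)
  · simp
  · by_cases h : j = 0 <;> simp [h, g]

theorem sum_phiExp (r : ℕ) (l : Fin (r / 2) → ℕ) :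
    ∑ p : Fin r, phiExp r l p.succ = ∑ t, l t + (r / 2 + r % 2) := by
  obtain ⟨L, hL⟩ : ∃ L : ℕ → ℕ, ∀ t : Fin (r / 2), l t = L t :=
    ⟨fun j => if h : j < r / 2 then l ⟨j, h⟩ else 0, fun t => by simp⟩
  have h1 : ∀ p : Fin r, phiExp r l p.succ =
      if (p : ℕ) % 2 = 0 then 1 else L (r / 2 - (p + 1) / 2) := by
    intro p
    simp only [phiExp, Fin.val_succ, hL]
    by_cases h : (p : ℕ) % 2 = 0
    · rw [dif_pos (by omega), if_pos h]
    · rw [dif_neg (by omega), if_neg h]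
  simp only [h1, hL]
  rw [Fin.sum_univ_eq_sum_range (fun p => if p % 2 = 0 then 1 else L (r / 2 - (p + 1) / 2)) r,
    Fin.sum_univ_eq_sum_range L (r / 2)]
  have h2 : ∀ M m : ℕ, m ≤ M → ∑ p ∈ Finset.range (2 * m),
      (if p % 2 = 0 then 1 else L (M - (p + 1) / 2)) =
      m + ∑ q ∈ Finset.range m, L (M - 1 - q) := by
    intro M m
    induction m with
    | zero => simp
    | succ m ih =>
      intro hm
      rw [show 2 * (m + 1) = 2 * m + 1 + 1 by ring, Finset.sum_range_succ, Finset.sum_range_succ,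
        ih (by omega), Finset.sum_range_succ, if_pos (by omega), if_neg (by omega),
        show M - (2 * m + 1 + 1) / 2 = M - 1 - m by omega]
      ring
  have h3 := h2 (r / 2) (r / 2) le_rfl
  rw [Finset.sum_range_reflect] at h3
  rcases Nat.even_or_odd' r with ⟨m, hm | hm⟩
  · have e1 : r / 2 = m := by omega
    have e2 : r % 2 = 0 := by omega
    rw [e1] at h3 ⊢
    rw [e2, hm, h3]; ring
  · have e1 : r / 2 = m := by omega
    have e2 : r % 2 = 1 := by omega
    rw [e1] at h3 ⊢
    rw [e2, hm, Finset.sum_range_succ, h3, if_pos (by omega)]; ring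

theorem incl_lam_prod (m : ℕ) (i : Fin m → ℕ) (c : K) :
    D.incl (List.ofFn fun t => D.lam (D.n - i t)).prod * D.incl c =
      D.incl ((D.alpha ^ (∑ t, (D.n - i t))) c) *
        D.incl (List.ofFn fun t => D.lam (D.n - i t)).prod := by
  induction m with
  | zero => simp
  | succ m ih =>
    rw [List.ofFn_succ, List.prod_cons, map_mul, mul_assoc, ih, ← mul_assoc,
      D.incl_lam_mul_incl _ (Nat.sub_le _ _), Fin.sum_univ_succ, mul_assoc, pow_alpha_add]

/-- `𝕀_m`, the set of multi-indices `(i_1, …, i_m)` with `1 ≤ i_j ≤ n`. -/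
def idxI (m : ℕ) : Finset (Fin m → ℕ) := Fintype.piFinset fun _ => Finset.Icc 1 D.n

/-- `𝕁_i`, the set of multi-indices `(l_1, …, l_m)` with `1 ≤ l_j < i_j`. -/
def idxJ {m : ℕ} (i : Fin m → ℕ) : Finset (Fin m → ℕ) :=
  Fintype.piFinset fun t => Finset.Ico 1 (i t)

theorem phiTerm_comm (r : ℕ) (i l : Fin (r / 2) → ℕ) (hi : i ∈ D.idxI (r / 2)) (hl : l ∈ idxJ i)
    (a : D.Ext) (c : K) :
    D.phiTerm r i l (a * D.incl ((D.alpha ^ D.tw r) c)) = D.phiTerm r i l (D.incl c * a) := by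
  have hi : ∀ t, 1 ≤ i t ∧ i t ≤ D.n := fun t => by simpa using Fintype.mem_piFinset.1 hi t
  have hl : ∀ t, 1 ≤ l t ∧ l t < i t := fun t => by simpa using Fintype.mem_piFinset.1 hl t
  have hsum : (∑ t, (i t - l t) - r / 2) + (∑ t, l t + (r / 2 + r % 2)) + ∑ t, (D.n - i t) =
      D.tw r := by
    have h1 : r / 2 ≤ ∑ t, (i t - l t) := by
      have := Finset.sum_le_sum (s := Finset.univ) (f := fun _ : Fin (r / 2) => 1)
        (g := fun t => i t - l t) fun t _ => by have := hl t; omega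
      simpa using this
    have h2 : ∑ t, (i t - l t) + ∑ t, l t + ∑ t, (D.n - i t) = r / 2 * D.n := by
      rw [← Finset.sum_add_distrib, ← Finset.sum_add_distrib,
        Finset.sum_congr rfl (g := fun _ => D.n)]
      · simp
      · intro t _
        have := hl t; have := hi t; omega
    rw [tw, ← h2]; omega
  rw [phiTerm_apply, phiTerm_apply, ← mul_assoc _ (D.incl c), incl_lam_prod]
  have h := D.phiTuple_move r l (D.incl (List.ofFn fun t => D.lam (D.n - i t)).prod * a *
    D.gen ^ ((∑ t, (i t - l t)) - r / 2)) ((D.alpha ^ (∑ t, (D.n - i t))) c)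
  rw [sum_phiExp, pow_alpha_add] at h
  simp only [mul_assoc] at h ⊢
  rw [← h, gen_pow_mul_incl, pow_alpha_add, ← hsum, add_assoc]

/-- The map `φ_r : C^S_r(A) → A ⊗ (A/K)^{⊗ r} ⊗`,
`φ_{2m}[a] = ∑_{i ∈ 𝕀_m} ∑_{l ∈ 𝕁_i} [λ_{n-i_1}⋯λ_{n-i_m} a x^{|i-l|-m} ⊗ x ⊗ x^{l_m} ⊗ ⋯ ⊗ x ⊗ x^{l_1}]`
and `φ_{2m+1}[a]` is given by the same formula with `⊗ x` added on the right. -/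
noncomputable def phi (r : ℕ) : D.CS r →ₗ[k] HochX D.incl r :=
  D.csLift r (∑ i ∈ D.idxI (r / 2), ∑ l ∈ idxJ i, D.phiTerm r i l) (fun a c => by
    simp only [LinearMap.sum_apply]
    exact Finset.sum_congr rfl fun i hi => Finset.sum_congr rfl fun l hl =>
      D.phiTerm_comm r i l hi hl a c)

theorem phi_mk (r : ℕ) (a : D.Ext) : D.phi r (D.csMk r a) =
    ∑ i ∈ D.idxI (r / 2), ∑ l ∈ idxJ i, cls D.incl r (D.phiTuple r l
      (D.incl (List.ofFn fun t => D.lam (D.n - i t)).prod * a *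
        D.gen ^ ((∑ t, (i t - l t)) - r / 2))) := by
  simp [phi, phiTerm_apply]

/-- For exponents `e 1, …, e r`:
`a ↦ [a \overline{x^{e_1+e_2}} ⋯ \overline{x^{e_{2m-1}+e_{2m}}}]` if `r = 2m`, and
`a ↦ ∑_{l=0}^{e_r - 1} [x^{e_r-l-1} a \overline{x^{e_1+e_2}} ⋯ \overline{x^{e_{2m-1}+e_{2m}}} x^l]`
if `r = 2m + 1`. -/
noncomputable def psiVal (r : ℕ) (e : ℕ → ℕ) : D.Ext →ₗ[k] D.CS r :=
  let P := ((List.range (r / 2)).map fun q => D.bar (e (2 * q + 1) + e (2 * q + 2))).prod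
  if r % 2 = 0 then D.csMk r ∘ₗ LinearMap.mulRight k P
  else ∑ l ∈ Finset.range (e r),
    D.csMk r ∘ₗ LinearMap.mulLeft k (D.gen ^ (e r - l - 1)) ∘ₗ LinearMap.mulRight k (P * D.gen ^ l)

/-- The exponents `e 1, …, e r` given by a function on `Fin r`. -/
def expo {r s : ℕ} (i : Fin r → Fin s) (j : ℕ) : ℕ :=
  if h : 1 ≤ j ∧ j ≤ r then i ⟨j - 1, by omega⟩ else 0

/-- `α^{e_1 + ⋯ + e_{j-1}}` of the `e_j`-th coordinate of the entry with index `j ≥ 1`;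
the entry with index `0` is left unchanged. -/
noncomputable def psiEntry (e : ℕ → ℕ) (j : ℕ) : D.Ext →ₗ[k] D.Ext :=
  if j = 0 then LinearMap.id
  else D.incl.toLinearMap ∘ₗ (D.alpha ^ ∑ t ∈ Finset.Ico 1 j, e t).toLinearMap ∘ₗ D.coord (e j)

/-- `ψ_r` on `k`-tensors: one writes `a_j = ∑_{i_j < n} c_{j,i_j} x^{i_j}` for `j ≥ 1`, moves all
coefficients to the left, and applies `psiVal`. -/
noncomputable def psiMulti (r : ℕ) :
    MultilinearMap k (fun _ : Fin (r + 1) => D.Ext) (D.CS r) :=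
  ∑ i : Fin r → Fin D.n, (D.psiVal r (expo i)).compMultilinearMap
    ((MultilinearMap.mkPiAlgebraFin k (r + 1) D.Ext).compLinearMap
      fun j => D.psiEntry (expo i) j)

theorem psiMulti_apply (r : ℕ) (a : Fin (r + 1) → D.Ext) :
    D.psiMulti r a = ∑ i : Fin r → Fin D.n, D.psiVal r (expo i)
      (List.ofFn fun j : Fin (r + 1) => D.psiEntry (expo i) j (a j)).prod := by
  simp [psiMulti]

theorem psiEntry_mul_incl (e : ℕ → ℕ) (j : ℕ) (a : D.Ext) (c : K) :
    D.psiEntry e j (a * D.incl c) =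
      D.psiEntry e j a * D.incl ((D.alpha ^ ∑ t ∈ Finset.Ico 1 (j + 1), e t) c) := by
  by_cases h : j = 0
  · simp [psiEntry, h]
  · simp only [psiEntry, if_neg h, LinearMap.comp_apply, coord_mul_incl, AlgHom.toLinearMap_apply,
      map_mul, pow_alpha_add]
    rw [Finset.sum_Ico_succ_top (by omega)]

theorem psiEntry_incl_mul (e : ℕ → ℕ) (j : ℕ) (a : D.Ext) (c : K) :
    D.psiEntry e j (D.incl c * a) =
      D.incl ((D.alpha ^ ∑ t ∈ Finset.Ico 1 j, e t) c) * D.psiEntry e j a := by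
  by_cases h : j = 0
  · simp [psiEntry, h]
  · simp only [psiEntry, if_neg h, LinearMap.comp_apply, coord_incl_mul, AlgHom.toLinearMap_apply,
      map_mul]

theorem prod_move {R : Type*} [Monoid R] (g : ℕ → R) (z : R) (p N : ℕ) (h : p + 1 < N) :
    ((List.range N).map fun j => if j = p then g p * z else g j).prod =
      ((List.range N).map fun j => if j = p + 1 then z * g (p + 1) else g j).prod := by
  induction N with
  | zero => omega
  | succ N ih =>
    rcases Nat.lt_or_ge (p + 1) N with h1 | h1
    · rw [List.range_succ, List.map_append, List.map_append, List.prod_append, List.prod_append,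
        ih h1]
      simp only [List.map_cons, List.map_nil, List.prod_cons, List.prod_nil]
      rw [if_neg (by omega), if_neg (by omega)]
    · obtain rfl : N = p + 1 := by omega
      rw [List.range_succ, List.range_succ]
      simp only [List.map_append, List.prod_append, List.map_cons, List.map_nil, List.prod_cons,
        List.prod_nil, mul_one, if_true]
      rw [if_neg (by omega), if_neg (by omega)]
      have : ∀ j ∈ List.range p, (if j = p then g p * z else g j) =
          if j = p + 1 then z * g (p + 1) else g j := by
        intro j hj
        rw [List.mem_range] at hj
        rw [if_neg (by omega), if_neg (by omega)]
      rw [List.map_congr_left this]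
      simp only [mul_assoc]

theorem prod_last {R : Type*} [Monoid R] (g : ℕ → R) (z : R) (N : ℕ) :
    ((List.range (N + 1)).map fun j => if j = N then g N * z else g j).prod =
      ((List.range (N + 1)).map g).prod * z := by
  rw [List.range_succ]
  simp only [List.map_append, List.prod_append, List.map_cons, List.map_nil, List.prod_cons,
    List.prod_nil, mul_one, if_true]
  have : ∀ j ∈ List.range N, (if j = N then g N * z else g j) = g j := by
    intro j hj
    rw [List.mem_range] at hj
    rw [if_neg (by omega)]
  rw [List.map_congr_left this, mul_assoc]

theorem prod_first {R : Type*} [Monoid R] (g : ℕ → R) (z : R) (N : ℕ) :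
    ((List.range (N + 1)).map fun j => if j = 0 then z * g 0 else g j).prod =
      z * ((List.range (N + 1)).map g).prod := by
  rw [List.range_succ_eq_map]
  simp [mul_assoc, Function.comp_def]

theorem ofFn_nat {R : Type*} {N : ℕ} (g : ℕ → R) :
    (List.ofFn fun j : Fin N => g j) = (List.range N).map g := by
  rw [List.ofFn_eq_map, ← List.map_coe_finRange_eq_range, List.map_map]
  rfl

theorem bar_prod_comm (e : ℕ → ℕ) (m : ℕ) (c : K) :
    D.incl ((D.alpha ^ ∑ t ∈ Finset.Ico 1 (2 * m + 1), e t) c) *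
        ((List.range m).map fun q => D.bar (e (2 * q + 1) + e (2 * q + 2))).prod =
      ((List.range m).map fun q => D.bar (e (2 * q + 1) + e (2 * q + 2))).prod *
        D.incl ((D.alpha ^ (m * D.n)) c) := by
  induction m generalizing c with
  | zero => simp
  | succ m ih =>
    have h1 : ∑ t ∈ Finset.Ico 1 (2 * (m + 1) + 1), e t =
        ∑ t ∈ Finset.Ico 1 (2 * m + 1), e t + (e (2 * m + 1) + e (2 * m + 2)) := by
      rw [show 2 * (m + 1) + 1 = 2 * m + 1 + 1 + 1 by ring, Finset.sum_Ico_succ_top (by omega),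
        Finset.sum_Ico_succ_top (by omega), add_assoc]
    rw [List.range_succ]
    simp only [List.map_append, List.prod_append, List.map_cons, List.map_nil, List.prod_cons,
      List.prod_nil, mul_one]
    rw [h1, ← pow_alpha_add, ← mul_assoc, ih, mul_assoc, pow_alpha_add, add_comm (m * D.n),
      ← pow_alpha_add, incl_mul_bar, pow_alpha_add, ← mul_assoc]
    congr 4; ring

theorem psiVal_comm (r : ℕ) (e : ℕ → ℕ) (a : D.Ext) (c : K) :
    D.psiVal r e (a * D.incl ((D.alpha ^ ∑ t ∈ Finset.Ico 1 (r + 1), e t) c)) =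
      D.psiVal r e (D.incl c * a) := by
  rcases Nat.even_or_odd' r with ⟨m, rfl | rfl⟩
  · have h1 : D.tw (2 * m) = m * D.n := by
      simp only [tw]
      rw [show 2 * m / 2 = m by omega, show 2 * m % 2 = 0 by omega, add_zero]
    have h0 : (2 * m) % 2 = 0 := by omega
    have h2 : 2 * m / 2 = m := by omega
    simp only [psiVal, if_pos h0, h2, LinearMap.comp_apply, LinearMap.mulRight_apply]
    rw [mul_assoc, bar_prod_comm, ← h1, ← mul_assoc, csMk_comm, mul_assoc]
  · have h1 : D.tw (2 * m + 1) = m * D.n + 1 := by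
      simp only [tw]
      rw [show (2 * m + 1) / 2 = m by omega, show (2 * m + 1) % 2 = 1 by omega]
    have h0 : ¬ (2 * m + 1) % 2 = 0 := by omega
    have h2 : (2 * m + 1) / 2 = m := by omega
    simp only [psiVal, if_neg h0, h2, LinearMap.sum_apply, LinearMap.comp_apply,
      LinearMap.mulRight_apply, LinearMap.mulLeft_apply]
    refine Finset.sum_congr rfl fun l hl => ?_
    rw [Finset.mem_range] at hl
    generalize hP : ((List.range m).map fun q => D.bar (e (2 * q + 1) + e (2 * q + 2))).prod = P
    have h3 : D.incl ((D.alpha ^ ∑ t ∈ Finset.Ico 1 (2 * m + 1 + 1), e t) c) * (P * D.gen ^ l) =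
        P * (D.gen ^ l * D.incl ((D.alpha ^ D.tw (2 * m + 1))
          ((D.alpha ^ (e (2 * m + 1) - l - 1)) c))) := by
      have h4 : m * D.n + e (2 * m + 1) =
          l + (m * D.n + 1 + (e (2 * m + 1) - l - 1)) := by omega
      rw [Finset.sum_Ico_succ_top (by omega), ← pow_alpha_add, ← mul_assoc, ← hP, bar_prod_comm, hP,
        gen_pow_mul_incl, pow_alpha_add, pow_alpha_add, pow_alpha_add, h1, h4, mul_assoc,
        add_assoc l]
    have h5 : D.gen ^ (e (2 * m + 1) - l - 1) * (a * (P * (D.gen ^ l *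
        D.incl ((D.alpha ^ D.tw (2 * m + 1)) ((D.alpha ^ (e (2 * m + 1) - l - 1)) c))))) =
        D.gen ^ (e (2 * m + 1) - l - 1) * (a * (P * D.gen ^ l)) *
        D.incl ((D.alpha ^ D.tw (2 * m + 1)) ((D.alpha ^ (e (2 * m + 1) - l - 1)) c)) := by
      simp only [mul_assoc]
    rw [mul_assoc a, h3, h5, csMk_comm, ← mul_assoc, ← gen_pow_mul_incl]
    simp only [mul_assoc]

theorem psiVal_eq_zero (r : ℕ) (e : ℕ → ℕ) (he : ∀ j, e j < D.n) (j : ℕ) (hj1 : 1 ≤ j)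
    (hj : j ≤ r) (h0 : e j = 0) : D.psiVal r e = 0 := by
  have hP : (∃ q < r / 2, j = 2 * q + 1 ∨ j = 2 * q + 2) →
      ((List.range (r / 2)).map fun q => D.bar (e (2 * q + 1) + e (2 * q + 2))).prod = 0 := by
    rintro ⟨q, hq, hjq⟩
    obtain ⟨s, t, hst⟩ := List.append_of_mem (List.mem_range.2 hq)
    have hb : D.bar (e (2 * q + 1) + e (2 * q + 2)) = 0 := by
      refine D.bar_of_lt _ ?_
      rcases hjq with rfl | rfl
      · rw [h0, zero_add]; exact he _
      · rw [h0, add_zero]; exact he _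
    rw [hst]
    simp [hb]
  refine LinearMap.ext fun a => ?_
  by_cases hr : r % 2 = 0
  · have := hP ⟨(j - 1) / 2, by omega, by omega⟩
    simp [psiVal, hr, this]
  · by_cases hjr : j = r
    · subst hjr
      simp [psiVal, hr, h0]
    · have := hP ⟨(j - 1) / 2, by omega, by omega⟩
      simp [psiVal, hr, this]

theorem expo_lt {r : ℕ} (i : Fin r → Fin D.n) (j : ℕ) : expo i j < D.n := by
  rw [expo]
  split_ifs
  · exact (i _).2
  · have := D.two_le; omega

theorem psiMulti_bal (r : ℕ) (a : Fin (r + 1) → D.Ext) (p : Fin (r + 1)) (c : K) :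
    D.psiMulti r (update a p (a p * D.incl c)) =
      D.psiMulti r (update a (p + 1) (D.incl c * a (p + 1))) := by
  obtain ⟨g, rfl⟩ := exists_nat_tuple a
  rw [update_nat, update_nat, psiMulti_apply, psiMulti_apply]
  refine Finset.sum_congr rfl fun i _ => ?_
  generalize expo i = e
  obtain ⟨p, hp⟩ := p
  dsimp only
  obtain ⟨q, hq⟩ : ∃ q : ℕ, ((⟨p, hp⟩ + 1 : Fin (r + 1)) : ℕ) = q := ⟨_, rfl⟩
  rw [hq]
  rw [val_succ_cyc] at hq
  dsimp only at hq
  have e1 : ∀ j : ℕ, D.psiEntry e j (if j = p then g p * D.incl c else g j) =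
      if j = p then D.psiEntry e p (g p) *
        D.incl ((D.alpha ^ ∑ t ∈ Finset.Ico 1 (p + 1), e t) c) else D.psiEntry e j (g j) := by
    intro j
    by_cases h : j = p
    · rw [if_pos h, if_pos h, h, psiEntry_mul_incl]
    · rw [if_neg h, if_neg h]
  have e2 : ∀ q j : ℕ, D.psiEntry e j (if j = q then D.incl c * g q else g j) =
      if j = q then D.incl ((D.alpha ^ ∑ t ∈ Finset.Ico 1 q, e t) c) * D.psiEntry e q (g q)
        else D.psiEntry e j (g j) := by
    intro q j
    by_cases h : j = q
    · rw [if_pos h, if_pos h, h, psiEntry_incl_mul]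
    · rw [if_neg h, if_neg h]
  simp only [e1, e2]
  by_cases hpr : p = r
  · subst hpr
    rw [if_pos rfl] at hq
    subst hq
    rw [ofFn_nat (fun j => if j = p then D.psiEntry e p (g p) *
        D.incl ((D.alpha ^ ∑ t ∈ Finset.Ico 1 (p + 1), e t) c) else D.psiEntry e j (g j)),
      ofFn_nat (fun j => if j = 0 then
        D.incl ((D.alpha ^ ∑ t ∈ Finset.Ico 1 0, e t) c) * D.psiEntry e 0 (g 0)
        else D.psiEntry e j (g j)),
      prod_last (fun j => D.psiEntry e j (g j)), prod_first (fun j => D.psiEntry e j (g j)),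
      psiVal_comm]
    simp
  · rw [if_neg hpr] at hq
    subst hq
    rw [ofFn_nat (fun j => if j = p then D.psiEntry e p (g p) *
        D.incl ((D.alpha ^ ∑ t ∈ Finset.Ico 1 (p + 1), e t) c) else D.psiEntry e j (g j)),
      ofFn_nat (fun j => if j = p + 1 then
        D.incl ((D.alpha ^ ∑ t ∈ Finset.Ico 1 (p + 1), e t) c) * D.psiEntry e (p + 1) (g (p + 1))
        else D.psiEntry e j (g j)),
      prod_move (fun j => D.psiEntry e j (g j)) _ _ _ (by omega)]

theorem psiMulti_deg (r : ℕ) (a : Fin (r + 1) → D.Ext) (p : Fin (r + 1)) (c : K) (hp : p ≠ 0)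
    (ha : a p = D.incl c) : D.psiMulti r a = 0 := by
  rw [psiMulti_apply]
  refine Finset.sum_eq_zero fun i _ => ?_
  have hp0 : (p : ℕ) ≠ 0 := fun h => hp (Fin.ext h)
  by_cases h0 : expo i p = 0
  · rw [D.psiVal_eq_zero r (expo i) (D.expo_lt i) p (by omega) (by omega) h0]; rfl
  · have h1 : D.psiEntry (expo i) p (a p) = 0 := by
      simp [psiEntry, hp0, ha, D.coord_incl _ h0]
    have h2 : (0 : D.Ext) ∈ List.ofFn fun j : Fin (r + 1) => D.psiEntry (expo i) j (a j) :=
      List.mem_ofFn.2 ⟨p, h1⟩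
    obtain ⟨s, t, hst⟩ := List.append_of_mem h2
    rw [hst]
    simp

/-- The map `ψ_r : A ⊗ (A/K)^{⊗ r} ⊗ → C^S_r(A)`, whose value on `[a ⊗ x^{i_1} ⊗ ⋯ ⊗ x^{i_r}]`
is given by `psiVal` (see `psi_cls_gen_pow`). -/
noncomputable def psi (r : ℕ) : HochX D.incl r →ₗ[k] D.CS r :=
  hochLift D.incl (D.psiMulti r) (D.psiMulti_bal r) (D.psiMulti_deg r)

/-- The defining formula of `ψ`: for `0 ≤ i_1, …, i_r < n`,
`ψ_{2m}[a ⊗ x^{i_1} ⊗ ⋯ ⊗ x^{i_{2m}}] = [a \overline{x^{i_1+i_2}} ⋯ \overline{x^{i_{2m-1}+i_{2m}}}]` and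
`ψ_{2m+1}[a ⊗ x^{i_1} ⊗ ⋯ ⊗ x^{i_{2m+1}}] = ∑_{l=0}^{i_{2m+1}-1}
[x^{i_{2m+1}-l-1} a \overline{x^{i_1+i_2}} ⋯ \overline{x^{i_{2m-1}+i_{2m}}} x^l]`. -/
theorem psi_cls_gen_pow (r : ℕ) (a : D.Ext) (e : ℕ → ℕ) (he : ∀ j, 1 ≤ j → j ≤ r → e j < D.n) :
    D.psi r (cls D.incl r fun j => if j = 0 then a else D.gen ^ e j) = D.psiVal r e a := by
  have hcongr : ∀ e' : ℕ → ℕ, (∀ j, 1 ≤ j → j ≤ r → e' j = e j) → D.psiVal r e' = D.psiVal r e := by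
    intro e' h
    have hP : ((List.range (r / 2)).map fun q => D.bar (e' (2 * q + 1) + e' (2 * q + 2))) =
        ((List.range (r / 2)).map fun q => D.bar (e (2 * q + 1) + e (2 * q + 2))) := by
      refine List.map_congr_left fun q hq => ?_
      rw [List.mem_range] at hq
      rw [h _ (by omega) (by omega), h _ (by omega) (by omega)]
    by_cases hr : r % 2 = 0
    · simp [psiVal, hr, hP]
    · have := h r (by omega) le_rfl
      simp [psiVal, hr, hP, this]
  let i0 : Fin r → Fin D.n := fun j => ⟨e (j + 1), he _ (by omega) (by omega)⟩
  have h0 : ∀ j, 1 ≤ j → j ≤ r → expo i0 j = e j := by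
    intro j h1 h2
    simp [expo, i0, h1, h2]
  rw [psi, hochLift_cls, psiMulti_apply, Finset.sum_eq_single i0]
  · rw [hcongr _ h0]
    congr 1
    rw [List.ofFn_succ, List.prod_cons]
    have : (List.ofFn fun j : Fin r => D.psiEntry (expo i0) (j.succ : Fin (r + 1))
        (if j.succ = 0 then a else D.gen ^ e (j.succ : Fin (r + 1)))).prod = 1 := by
      refine List.prod_eq_one fun y hy => ?_
      obtain ⟨j, rfl⟩ := List.mem_ofFn.1 hy
      rw [if_neg (Fin.succ_ne_zero j)]
      simp [psiEntry, h0 (j + 1) (by omega) (by omega),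
        D.coord_gen_pow _ _ (he (j + 1) (by omega) (by omega))]
    rw [this]
    simp [psiEntry]
  · intro i _ hi
    obtain ⟨j, hj⟩ : ∃ j, i j ≠ i0 j := by
      by_contra hcon
      push Not at hcon
      exact hi (funext hcon)
    have hne : e (j + 1) ≠ expo i (j + 1) := by
      intro h
      refine hj (Fin.ext ?_)
      rw [expo, dif_pos ⟨by omega, by omega⟩] at h
      exact h.symm
    have h2 : (0 : D.Ext) ∈ List.ofFn fun j : Fin (r + 1) => D.psiEntry (expo i) j
        (if j = 0 then a else D.gen ^ e j) := by
      refine List.mem_ofFn.2 ⟨j.succ, ?_⟩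
      rw [if_neg (Fin.succ_ne_zero j)]
      simp [psiEntry, D.coord_gen_pow _ _ (he (j + 1) (by omega) (by omega)), hne]
    obtain ⟨s, t, hst⟩ := List.append_of_mem h2
    rw [hst]
    simp
  · simp

/-- The Connes operator `D_r = ψ_{r+1} B_r φ_r : C^S_r(A) → C^S_{r+1}(A)`. -/
noncomputable def conD (r : ℕ) : D.CS r →ₗ[k] D.CS (r + 1) :=
  D.psi (r + 1) ∘ₗ connesB D.incl r ∘ₗ D.phi r

end MonogenicData
end MonogenicCyclic

/-!
The map `φ` is a homotopy equivalence of the small complex with the relative Hochschild complex of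
`A`, and homological perturbation transports the Connes operator `B` along it. Two points need
proof: an explicit contracting homotopy `ω` with `b ω + ω b = 1 - φ ψ`, and the fact that the
perturbed differential on the small complex is `d + ψ B φ`, without the higher terms
`ψ B ω B φ`, `ψ B ω B ω B φ`, ….

*The homotopy.* All chains are written as traces of elements of the relative bar algebra `A⟨ε⟩`,
in which `ε² = 0` and `ε` commutes with `K`: the chain `[a₀ ⊗ ⋯ ⊗ a_r]` is the trace of
`a₀ ε a₁ ε ⋯ ε a_r ε`, and the Hochschild boundary corresponds to the derivation with `ε ↦ 1`
(`BarAlg.trace_bar`, `BarAlg.trace_comm`). A `K`-bilinear cochain `δ : A → A⟨ε⟩` with boundary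
`a ε - ε a` (`BarAlg.IsConnection`) has a curvature `a δ(b) - δ(ab) + δ(a) b`, and products of values
of the curvature and of `δ` form a cochain `retr` which is homotopic, by an explicit homotopy, to
`ε a₁ ε ⋯ ε a_r ε` (`BarAlg.IsConnection.bar_homot_add_cob`). For the monogenic extension take for `δ`
the derivation of the Ore extension with `x ↦ ε x ε`, restricted to the remainders of division by
`f`. Its curvature at `(x^i, x^j)` is `\overline{x^{i+j}} κ`, where `κ` is the image of `f` under the
derivation (`MonogenicData.curv_gen_pow`). As `κ` commutes with `x`, twists `K` by `α^n` and is a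
cycle, `φ_{2m}[a]` and `φ_{2m+1}[a]` turn out to be the traces of `a κ^m ε` and `a κ^m ε x ε`
(`MonogenicData.phi_eq_trace`), and the map induced by `retr` is `φ ψ` (`MonogenicData.phi_psi`).
This gives `b φ = φ d`, `ψ φ = 1` and `b ω + ω b = 1 - φ ψ`.

*The higher terms.* Filter chains by the total degree in `x` of their entries. Both `B` and `ω`
preserve this filtration, `φ_r` takes values in degrees at most `mn + n - 1` for `r = 2m` and at most
`mn + n` for `r = 2m + 1`, and `ψ_r` vanishes in degrees less than `mn`, respectively `mn + 1`
(`MonogenicData.psi_eq_zero_of_mem`). Therefore `ψ B ω B ⋯ φ = 0` (`MonogenicData.isRetract`).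

*Perturbation.* Under these conditions `d` and `ψ B φ` form a mixed complex, and `∑ᵢ (-ω B)ⁱ φ` is a
chain map of total complexes compatible with the periodicity maps. Its mapping cone is acyclic, by
induction along the periodicity maps from the acyclicity of the cone of `φ`
(`IsRetract.exists_succ`), so that it induces isomorphisms on cyclic homology
(`IsRetract.exists_equiv`).
-/

namespace MonogenicCyclic

open scoped TensorProduct
open Function

/-! ### The relative bar algebra -/

/-- Words `g₀ ε g₁ ε ⋯ ε g_p` in the elements of a monoid and a letter `ε`. The entries with index
`> p` are set to `1`, so that a word is determined by its entries. -/
@[ext] structure BarWord (A : Type*) [Monoid A] where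
  /-- the number of letters `ε` -/
  len : ℕ
  /-- the entries -/
  entry : ℕ → A
  entry_of_lt : ∀ j, len < j → entry j = 1

namespace BarWord

section Monoid

variable {A : Type*} [Monoid A]

/-- Concatenation of words: the last entry of the left one is multiplied by the first entry of
the right one. -/
instance : Monoid (BarWord A) where
  mul u v :=
    { len := u.len + v.len
      entry := fun j => if j < u.len then u.entry j
        else if j = u.len then u.entry u.len * v.entry 0 else v.entry (j - u.len)
      entry_of_lt := fun j hj => by
        rw [if_neg (by omega), if_neg (by omega), v.entry_of_lt _ (by omega)] }
  one := { len := 0, entry := fun _ => 1, entry_of_lt := fun _ _ => rfl }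
  mul_assoc u v w := by
    refine BarWord.ext (add_assoc _ _ _) (funext fun j => ?_)
    change (if j < u.len + v.len then (if j < u.len then u.entry j
        else if j = u.len then u.entry u.len * v.entry 0 else v.entry (j - u.len))
      else if j = u.len + v.len then (if u.len + v.len < u.len then u.entry (u.len + v.len)
        else if u.len + v.len = u.len then u.entry u.len * v.entry 0
        else v.entry (u.len + v.len - u.len)) * w.entry 0
      else w.entry (j - (u.len + v.len))) =
      (if j < u.len then u.entry j else if j = u.len then u.entry u.len *
        (if 0 < v.len then v.entry 0 else if 0 = v.len then v.entry v.len * w.entry 0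
          else w.entry (0 - v.len))
        else (if j - u.len < v.len then v.entry (j - u.len)
          else if j - u.len = v.len then v.entry v.len * w.entry 0
          else w.entry (j - u.len - v.len)))
    split_ifs <;> first | omega | rfl | grind [mul_assoc]
  one_mul u := by
    refine BarWord.ext (zero_add _) (funext fun j => ?_)
    change (if j < 0 then 1 else if j = 0 then 1 * u.entry 0 else u.entry (j - 0)) = u.entry j
    split_ifs with h1 h2
    · omega
    · rw [one_mul, h2]
    · rfl
  mul_one u := by
    refine BarWord.ext (add_zero _) (funext fun j => ?_)
    change (if j < u.len then u.entry j else if j = u.len then u.entry u.len * 1 else 1) = u.entry j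
    split_ifs with h1 h2
    · rfl
    · rw [mul_one, h2]
    · rw [u.entry_of_lt _ (by omega)]

/-- The word `a` without letter `ε`. -/
def of (a : A) : BarWord A :=
  { len := 0
    entry := fun j => if j = 0 then a else 1
    entry_of_lt := fun j hj => if_neg (by omega) }

/-- The word `1 ε 1`. -/
def eps : BarWord A := { len := 1, entry := fun _ => 1, entry_of_lt := fun _ _ => rfl }

theorem len_mul (u v : BarWord A) : (u * v).len = u.len + v.len := rfl

theorem entry_mul (u v : BarWord A) (j : ℕ) : (u * v).entry j = if j < u.len then u.entry j
    else if j = u.len then u.entry u.len * v.entry 0 else v.entry (j - u.len) := rfl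

@[simp] theorem len_of (a : A) : (of a).len = 0 := rfl

theorem entry_of (a : A) (j : ℕ) : (of a).entry j = if j = 0 then a else 1 := rfl

@[simp] theorem len_eps : (eps : BarWord A).len = 1 := rfl

@[simp] theorem entry_eps (j : ℕ) : (eps : BarWord A).entry j = 1 := rfl

@[simp] theorem len_one : (1 : BarWord A).len = 0 := rfl

@[simp] theorem entry_one (j : ℕ) : (1 : BarWord A).entry j = 1 := rfl

theorem of_mul (a b : A) : of (a * b) = of a * of b := by
  refine BarWord.ext rfl (funext fun j => ?_)
  simp only [entry_mul, entry_of, len_of]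
  split_ifs <;> first | omega | simp

theorem of_one : of (1 : A) = 1 := by
  refine BarWord.ext rfl (funext fun j => ?_)
  simp [entry_of]

/-- The word obtained by deleting the letter `ε` between the entries `i` and `i + 1`. -/
def fuse (i : ℕ) (u : BarWord A) : BarWord A :=
  { len := u.len - 1
    entry := fun j => if u.len ≤ j then 1 else if j < i then u.entry j
      else if j = i then u.entry i * u.entry (i + 1) else u.entry (j + 1)
    entry_of_lt := fun j hj => if_pos (by omega) }

theorem entry_fuse (i : ℕ) (u : BarWord A) (j : ℕ) : (fuse i u).entry j =
    if u.len ≤ j then 1 else if j < i then u.entry j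
      else if j = i then u.entry i * u.entry (i + 1) else u.entry (j + 1) := rfl

theorem len_fuse (i : ℕ) (u : BarWord A) : (fuse i u).len = u.len - 1 := rfl

theorem fuse_mul_left (i : ℕ) (u v : BarWord A) (hi : i < u.len) :
    fuse i (u * v) = fuse i u * v := by
  refine BarWord.ext (by simp only [len_fuse, len_mul]; omega) (funext fun j => ?_)
  have h1 := v.entry_of_lt (j - (u.len - 1))
  simp only [entry_fuse, entry_mul, len_mul, len_fuse]
  split_ifs <;> first | omega | grind [mul_assoc]

theorem fuse_mul_right (i : ℕ) (u v : BarWord A) (hi : i < v.len) :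
    fuse (u.len + i) (u * v) = u * fuse i v := by
  refine BarWord.ext (by simp only [len_fuse, len_mul]; omega) (funext fun j => ?_)
  simp only [entry_fuse, entry_mul, len_mul]
  split_ifs <;> first | omega | grind [mul_assoc]

theorem eq_of (u : BarWord A) (h : u.len = 0) : u = of (u.entry 0) := by
  refine BarWord.ext h (funext fun j => ?_)
  rw [entry_of]
  split_ifs with h0
  · rw [h0]
  · exact u.entry_of_lt _ (by omega)

/-- Words are generated by the words `of a` and `ε`. -/
theorem induction_left {p : BarWord A → Prop} (one : p 1) (of : ∀ a u, p u → p (of a * u))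
    (eps : ∀ u, p u → p (eps * u)) (u : BarWord A) : p u := by
  obtain ⟨n, hn⟩ : ∃ n, u.len = n := ⟨_, rfl⟩
  induction n generalizing u with
  | zero =>
    rw [eq_of u hn, ← mul_one (BarWord.of _)]
    exact of _ _ one
  | succ n ih =>
    let v : BarWord A :=
      { len := n
        entry := fun j => u.entry (j + 1)
        entry_of_lt := fun j hj => u.entry_of_lt _ (by omega) }
    have : u = BarWord.of (u.entry 0) * (BarWord.eps * v) := by
      refine BarWord.ext (by simp [hn, len_mul, v, add_comm]) (funext fun j => ?_)
      simp only [entry_mul, entry_of, len_of, len_eps, entry_eps, v]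
      split_ifs <;> first | omega | grind
    rw [this]
    exact of _ _ (eps _ (ih v rfl))

end Monoid

end BarWord

section Free

variable {k A : Type*} [CommRing k] [Monoid A]

/-- The `k`-linear extension of a map defined on words. -/
noncomputable def wordLift {N : Type*} [AddCommGroup N] [Module k N] (F : BarWord A → N) :
    MonoidAlgebra k (BarWord A) →ₗ[k] N :=
  Finsupp.linearCombination k F ∘ₗ (MonoidAlgebra.coeffLinearEquiv k).toLinearMap

theorem wordLift_of {N : Type*} [AddCommGroup N] [Module k N] (F : BarWord A → N) (u : BarWord A) :
    wordLift (k := k) F (MonoidAlgebra.of k _ u) = F u := by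
  simp [wordLift, MonoidAlgebra.coeffLinearEquiv]

theorem word_induction {p : MonoidAlgebra k (BarWord A) → Prop} (y : MonoidAlgebra k (BarWord A))
    (of : ∀ u, p (MonoidAlgebra.of k _ u)) (add : ∀ y z, p y → p z → p (y + z))
    (smul : ∀ (c : k) y, p y → p (c • y)) : p y :=
  MonoidAlgebra.induction_on y of (fun y z => add y z) (fun c y => smul c y)

/-- The sign automorphism `ε ↦ -ε`. -/
noncomputable def freeSign : MonoidAlgebra k (BarWord A) →ₗ[k] MonoidAlgebra k (BarWord A) :=
  wordLift fun u => (-1 : k) ^ u.len • MonoidAlgebra.of k _ u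

theorem freeSign_of (u : BarWord A) : freeSign (MonoidAlgebra.of k _ u) =
    (-1 : k) ^ u.len • MonoidAlgebra.of k _ u := wordLift_of _ _

theorem freeSign_mul (y z : MonoidAlgebra k (BarWord A)) :
    freeSign (y * z) = freeSign y * freeSign z := by
  induction y using word_induction with
  | of u =>
    induction z using word_induction with
    | of v =>
      rw [← map_mul, freeSign_of, freeSign_of, freeSign_of, map_mul, BarWord.len_mul, pow_add,
        smul_mul_smul_comm]
    | add y z hy hz => rw [mul_add, map_add, map_add, mul_add, hy, hz]
    | smul c y hy => rw [mul_smul_comm, map_smul, map_smul, mul_smul_comm, hy]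
  | add y y' hy hy' => rw [add_mul, map_add, map_add, add_mul, hy, hy']
  | smul c y hy => rw [smul_mul_assoc, map_smul, map_smul, smul_mul_assoc, hy]

/-- The derivation deleting the letters `ε` in turn, with alternating signs. -/
noncomputable def freeBar : MonoidAlgebra k (BarWord A) →ₗ[k] MonoidAlgebra k (BarWord A) :=
  wordLift fun u => ∑ i ∈ Finset.range u.len, (-1 : k) ^ i • MonoidAlgebra.of k _ (u.fuse i)

theorem freeBar_of (u : BarWord A) : freeBar (MonoidAlgebra.of k _ u) =
    ∑ i ∈ Finset.range u.len, (-1 : k) ^ i • MonoidAlgebra.of k _ (u.fuse i) := wordLift_of _ _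

theorem freeBar_mul (y z : MonoidAlgebra k (BarWord A)) :
    freeBar (y * z) = freeBar y * z + freeSign y * freeBar z := by
  induction y using word_induction with
  | of u =>
    induction z using word_induction with
    | of v =>
      rw [← map_mul, freeBar_of, freeBar_of, freeBar_of, freeSign_of, BarWord.len_mul,
        Finset.sum_range_add, Finset.sum_mul, Finset.mul_sum]
      congr 1
      · refine Finset.sum_congr rfl fun i hi => ?_
        rw [BarWord.fuse_mul_left _ _ _ (Finset.mem_range.1 hi), map_mul, smul_mul_assoc]
      · refine Finset.sum_congr rfl fun i hi => ?_
        rw [BarWord.fuse_mul_right _ _ _ (Finset.mem_range.1 hi), map_mul, pow_add,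
          smul_mul_smul_comm]
    | add y z hy hz => rw [mul_add, map_add, map_add, mul_add, mul_add, hy, hz]; abel
    | smul c y hy => rw [mul_smul_comm, map_smul, map_smul, mul_smul_comm, mul_smul_comm, hy,
        smul_add]
  | add y y' hy hy' => rw [add_mul, map_add, map_add, map_add, add_mul, add_mul, hy, hy']; abel
  | smul c y hy => rw [smul_mul_assoc, map_smul, map_smul, map_smul, smul_mul_assoc,
      smul_mul_assoc, hy, smul_add]

end Free

section BarAlgebra

variable {k K A : Type*} [CommRing k] [Ring K] [Algebra k K] [Ring A] [Algebra k A]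

/-- `ℕ`-indexed form of the tuple `(a_{r+1} a₀, a₁, …, a_r)`. -/
def wrap (r : ℕ) (g : ℕ → A) (j : ℕ) : A := if j = 0 then g (r + 1) * g 0 else g j

/-- The map `a₀ ε a₁ ε ⋯ ε a_{r+1} ↦ [a_{r+1} a₀ ⊗ a₁ ⊗ ⋯ ⊗ a_r]`, zero on the words whose number
of letters `ε` is not `r + 1`. -/
noncomputable def freeTrace (ι : K →ₐ[k] A) (r : ℕ) :
    MonoidAlgebra k (BarWord A) →ₗ[k] HochX ι r :=
  wordLift fun u => if u.len = r + 1 then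
    cls ι r (fun j : Fin (r + 1) => wrap r u.entry j) else 0

theorem freeTrace_of (ι : K →ₐ[k] A) (r : ℕ) (u : BarWord A) :
    freeTrace ι r (MonoidAlgebra.of k _ u) = if u.len = r + 1 then
      cls ι r (fun j : Fin (r + 1) => wrap r u.entry j) else 0 := wordLift_of _ _

theorem freeTrace_sign (ι : K →ₐ[k] A) (r : ℕ) (y : MonoidAlgebra k (BarWord A)) :
    freeTrace ι r (freeSign y) = (-1 : k) ^ (r + 1) • freeTrace ι r y := by
  induction y using word_induction with
  | of u =>
    rw [freeSign_of, map_smul, freeTrace_of]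
    split_ifs with h
    · rw [h]
    · simp
  | add y z hy hz => rw [map_add, map_add, map_add, smul_add, hy, hz]
  | smul c y hy => rw [map_smul, map_smul, map_smul, hy, smul_comm]

theorem freeTrace_bar (ι : K →ₐ[k] A) (r : ℕ) (y : MonoidAlgebra k (BarWord A)) :
    freeTrace ι r (freeBar y) = hochB ι r (freeTrace ι (r + 1) y) := by
  induction y using word_induction with
  | of u =>
    rw [freeBar_of, map_sum, freeTrace_of]
    split_ifs with h
    · rw [hochB_cls, h, ← Fin.sum_univ_eq_sum_range
        (fun i => freeTrace ι r ((-1 : k) ^ i • MonoidAlgebra.of k _ (u.fuse i))) (r + 1 + 1)]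
      refine Finset.sum_congr rfl fun i _ => ?_
      rw [map_smul, freeTrace_of, if_pos (by rw [BarWord.len_fuse]; omega), face_nat]
      congr 2
      ext j
      simp only [wrap, faceN, BarWord.entry_fuse, h]
      have hi := i.2
      have hj := j.2
      split_ifs <;> first | omega | grind [mul_assoc]
    · rw [map_zero]
      refine Finset.sum_eq_zero fun i hi => ?_
      rw [map_smul, freeTrace_of, if_neg, smul_zero]
      rw [BarWord.len_fuse]
      rw [Finset.mem_range] at hi
      omega
  | add y z hy hz => rw [map_add, map_add, map_add, map_add, hy, hz]
  | smul c y hy => rw [map_smul, map_smul, map_smul, map_smul, hy]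

theorem freeTrace_comm (ι : K →ₐ[k] A) (r : ℕ) (y : MonoidAlgebra k (BarWord A)) (a : A) :
    freeTrace ι r (y * MonoidAlgebra.of k _ (BarWord.of a)) =
      freeTrace ι r (MonoidAlgebra.of k _ (BarWord.of a) * y) := by
  induction y using word_induction with
  | of u =>
    rw [← map_mul, ← map_mul, freeTrace_of, freeTrace_of]
    simp only [BarWord.len_mul, BarWord.len_of, add_zero, zero_add]
    split_ifs with h
    · congr 1
      ext j
      simp only [wrap, BarWord.entry_mul, BarWord.entry_of, h, BarWord.len_of]
      have hj := j.2
      split_ifs <;> first | omega | grind [mul_assoc]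
    · rfl
  | add y z hy hz => rw [add_mul, mul_add, map_add, map_add, hy, hz]
  | smul c y hy => rw [smul_mul_assoc, mul_smul_comm, map_smul, map_smul, hy]

/-- The largest ideal on which all the maps `freeTrace` vanish. -/
def barIdeal (ι : K →ₐ[k] A) : Ideal (MonoidAlgebra k (BarWord A)) where
  carrier := {y | ∀ r u v, freeTrace ι r (u * y * v) = 0}
  zero_mem' r u v := by simp
  add_mem' {y z} hy hz r u v := by rw [mul_add, add_mul, map_add, hy, hz, add_zero]
  smul_mem' c y hy r u v := by
    rw [smul_eq_mul, ← mul_assoc u]; exact hy r _ v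

instance (ι : K →ₐ[k] A) : (barIdeal ι).IsTwoSided where
  mul_mem_of_left {y} b hy := fun r u v => by
    rw [← mul_assoc, mul_assoc]; exact hy r u _

theorem mem_barIdeal_of_words {ι : K →ₐ[k] A} {y : MonoidAlgebra k (BarWord A)}
    (h : ∀ r u v, freeTrace ι r (MonoidAlgebra.of k _ u * y * MonoidAlgebra.of k _ v) = 0) :
    y ∈ barIdeal ι := by
  intro r u v
  induction u using word_induction with
  | of u =>
    induction v using word_induction with
    | of v => exact h r u v
    | add v w hv hw => rw [mul_add, map_add, hv, hw, add_zero]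
    | smul c v hv => rw [mul_smul_comm, map_smul, hv, smul_zero]
  | add u w hu hw => rw [add_mul, add_mul, map_add, hu, hw, add_zero]
  | smul c u hu => rw [smul_mul_assoc, smul_mul_assoc, map_smul, hu, smul_zero]

theorem freeSign_mem {ι : K →ₐ[k] A} {y : MonoidAlgebra k (BarWord A)} (hy : y ∈ barIdeal ι) :
    freeSign y ∈ barIdeal ι := by
  refine mem_barIdeal_of_words fun r u v => ?_
  have h := freeTrace_sign ι r (MonoidAlgebra.of k _ u * y * MonoidAlgebra.of k _ v)
  rw [hy, smul_zero, freeSign_mul, freeSign_mul, freeSign_of, freeSign_of, smul_mul_assoc,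
    smul_mul_assoc, mul_smul_comm, map_smul, map_smul] at h
  have hu : ∀ n : ℕ, IsUnit ((-1 : k) ^ n) := fun n => (isUnit_one.neg).pow n
  exact ((hu _).smul_eq_zero).1 (((hu _).smul_eq_zero).1 h)

theorem freeBar_mem {ι : K →ₐ[k] A} {y : MonoidAlgebra k (BarWord A)} (hy : y ∈ barIdeal ι) :
    freeBar y ∈ barIdeal ι := by
  refine mem_barIdeal_of_words fun r u v => ?_
  have h := freeTrace_bar ι r (MonoidAlgebra.of k _ u * y * MonoidAlgebra.of k _ v)
  rw [hy, map_zero, freeBar_mul, freeBar_mul, freeSign_mul, map_add, add_mul, map_add, hy, zero_add,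
    freeSign_mem hy, add_zero, freeSign_of, smul_mul_assoc, smul_mul_assoc, map_smul] at h
  have hu : ∀ n : ℕ, IsUnit ((-1 : k) ^ n) := fun n => (isUnit_one.neg).pow n
  exact ((hu _).smul_eq_zero).1 h

/-- The relative bar algebra `A⟨ε⟩` of `A` over `K`, a stand-in for the normalized bar resolution
`A ⊗ (A/K)^{⊗ r} ⊗ A` in which products of cochains can be formed: it is generated by `A` and an
element `ε`, with every relation imposed that cannot be detected in the relative Hochschild chains.
In particular `ε² = 0` and `ε` commutes with `K`. -/
abbrev BarAlg (ι : K →ₐ[k] A) : Type _ := MonoidAlgebra k (BarWord A) ⧸ barIdeal ι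

namespace BarAlg

variable (ι : K →ₐ[k] A)

/-- The class of a word. -/
noncomputable def word (u : BarWord A) : BarAlg ι :=
  Ideal.Quotient.mk (barIdeal ι) (MonoidAlgebra.of k _ u)

theorem word_mul (u v : BarWord A) : word ι (u * v) = word ι u * word ι v := by
  rw [word, map_mul, map_mul]; rfl

theorem word_one : word ι 1 = 1 := by
  rw [word, map_one, map_one]

theorem ext_words {N : Type*} [AddCommGroup N] [Module k N] {F G : BarAlg ι →ₗ[k] N}
    (h : ∀ u, F (word ι u) = G (word ι u)) : F = G := by
  refine LinearMap.ext fun y => ?_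
  obtain ⟨y, rfl⟩ := Ideal.Quotient.mk_surjective y
  induction y using word_induction with
  | of u => exact h u
  | add y z hy hz => rw [map_add, map_add, map_add, hy, hz]
  | smul c y hy =>
    have : Ideal.Quotient.mk (barIdeal ι) (c • y) = c • Ideal.Quotient.mk (barIdeal ι) y := rfl
    rw [this, map_smul, map_smul, hy]

/-- A linear endomorphism of the free algebra preserving `barIdeal` descends to `BarAlg`. -/
noncomputable def descend {N : Type*} [AddCommGroup N] [Module k N]
    (F : MonoidAlgebra k (BarWord A) →ₗ[k] N) (h : ∀ y ∈ barIdeal ι, F y = 0) :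
    BarAlg ι →ₗ[k] N :=
  ((barIdeal ι).restrictScalars k).liftQ F (fun y hy => h y hy) ∘ₗ
    (Submodule.Quotient.restrictScalarsEquiv k (barIdeal ι)).symm.toLinearMap

/-- The quotient map, as a `k`-linear map. -/
noncomputable def mkL : MonoidAlgebra k (BarWord A) →ₗ[k] BarAlg ι :=
  (Ideal.Quotient.mkₐ k (barIdeal ι)).toLinearMap

theorem mkL_eq_zero {y : MonoidAlgebra k (BarWord A)} (h : y ∈ barIdeal ι) : mkL ι y = 0 :=
  Ideal.Quotient.eq_zero_iff_mem.2 h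

/-- The map `[a_0 ε a_1 ε ⋯ a_r ε] ↦ [a_0 ⊗ ⋯ ⊗ a_r]` onto the relative Hochschild chains. -/
noncomputable def trace (r : ℕ) : BarAlg ι →ₗ[k] HochX ι r :=
  descend ι (freeTrace ι r) (fun y hy => by simpa using hy r 1 1)

/-- The sign automorphism `ε ↦ -ε`. -/
noncomputable def sign : BarAlg ι →ₗ[k] BarAlg ι :=
  descend ι (mkL ι ∘ₗ freeSign) (fun _ hy => mkL_eq_zero ι (freeSign_mem hy))

/-- The differential: the derivation (up to signs) which is zero on `A` and takes `ε` to `1`. -/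
noncomputable def bar : BarAlg ι →ₗ[k] BarAlg ι :=
  descend ι (mkL ι ∘ₗ freeBar) (fun _ hy => mkL_eq_zero ι (freeBar_mem hy))

/-- The generator `ε`. -/
noncomputable def eps : BarAlg ι := word ι BarWord.eps

theorem trace_word (r : ℕ) (u : BarWord A) : trace ι r (word ι u) = if u.len = r + 1 then
    cls ι r (fun j : Fin (r + 1) => wrap r u.entry j) else 0 :=
  freeTrace_of ι r u

theorem sign_word (u : BarWord A) : sign ι (word ι u) = (-1 : k) ^ u.len • word ι u := by
  change mkL ι (freeSign (MonoidAlgebra.of k _ u)) = _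
  rw [freeSign_of]; rfl

theorem bar_word (u : BarWord A) : bar ι (word ι u) =
    ∑ i ∈ Finset.range u.len, (-1 : k) ^ i • word ι (u.fuse i) := by
  change mkL ι (freeBar (MonoidAlgebra.of k _ u)) = _
  rw [freeBar_of, map_sum]; rfl

theorem sign_mul (y z : BarAlg ι) : sign ι (y * z) = sign ι y * sign ι z := by
  obtain ⟨y, rfl⟩ := Ideal.Quotient.mk_surjective y
  obtain ⟨z, rfl⟩ := Ideal.Quotient.mk_surjective z
  change mkL ι (freeSign (y * z)) = mkL ι (freeSign y) * mkL ι (freeSign z)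
  rw [freeSign_mul]; rfl

theorem bar_mul (y z : BarAlg ι) : bar ι (y * z) = bar ι y * z + sign ι y * bar ι z := by
  obtain ⟨y, rfl⟩ := Ideal.Quotient.mk_surjective y
  obtain ⟨z, rfl⟩ := Ideal.Quotient.mk_surjective z
  change mkL ι (freeBar (y * z)) = mkL ι (freeBar y) * mkL ι z + mkL ι (freeSign y) * mkL ι (freeBar z)
  rw [freeBar_mul]; rfl

theorem trace_bar (r : ℕ) (y : BarAlg ι) :
    trace ι r (bar ι y) = hochB ι r (trace ι (r + 1) y) := by
  obtain ⟨y, rfl⟩ := Ideal.Quotient.mk_surjective y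
  exact freeTrace_bar ι r y

theorem trace_comm_of (r : ℕ) (y : BarAlg ι) (a : A) :
    trace ι r (y * word ι (BarWord.of a)) = trace ι r (word ι (BarWord.of a) * y) := by
  obtain ⟨y, rfl⟩ := Ideal.Quotient.mk_surjective y
  exact freeTrace_comm ι r y a

set_option maxHeartbeats 1000000 in
theorem exists_slot (r : ℕ) (u v : BarWord A) (h : u.len + v.len = r + 1) :
    ∃ (t : Fin (r + 1) → A) (q : Fin (r + 1)) (L : A →ₗ[k] A), ∀ a,
      (fun j : Fin (r + 1) => wrap r (u * BarWord.of a * v).entry j) = update t q (L a) := by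
  by_cases h1 : u.len = 0
  · refine ⟨fun j => v.entry j, 0, LinearMap.mulLeft k (v.entry (r + 1) * u.entry 0) ∘ₗ
      LinearMap.mulRight k (v.entry 0), fun a => ?_⟩
    ext j
    simp only [wrap, BarWord.entry_mul, BarWord.entry_of, BarWord.len_mul, BarWord.len_of,
      update_apply, Fin.ext_iff, LinearMap.comp_apply, LinearMap.mulLeft_apply,
      LinearMap.mulRight_apply, Fin.val_zero]
    split_ifs <;> first | omega | grind [mul_assoc]
  · by_cases h2 : u.len = r + 1
    · refine ⟨fun j => u.entry j, 0, LinearMap.mulLeft k (u.entry (r + 1)) ∘ₗ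
        LinearMap.mulRight k (v.entry 0 * u.entry 0), fun a => ?_⟩
      ext j
      have hj := j.2
      simp only [wrap, BarWord.entry_mul, BarWord.entry_of, BarWord.len_mul, BarWord.len_of,
        update_apply, Fin.ext_iff, LinearMap.comp_apply, LinearMap.mulLeft_apply,
        LinearMap.mulRight_apply, Fin.val_zero]
      split_ifs <;> first | omega | grind [mul_assoc]
    · refine ⟨fun j => wrap r (u * v).entry j, ⟨u.len, by omega⟩,
        LinearMap.mulLeft k (u.entry u.len) ∘ₗ LinearMap.mulRight k (v.entry 0), fun a => ?_⟩
      ext j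
      have hj := j.2
      simp only [wrap, BarWord.entry_mul, BarWord.entry_of, BarWord.len_mul, BarWord.len_of,
        update_apply, Fin.ext_iff, LinearMap.comp_apply, LinearMap.mulLeft_apply,
        LinearMap.mulRight_apply]
      split_ifs <;> first | omega | grind [mul_assoc]

theorem exists_linear (r : ℕ) (u v : BarWord A) : ∃ F : A →ₗ[k] HochX ι r, ∀ a,
    freeTrace ι r (MonoidAlgebra.of k _ (u * BarWord.of a * v)) = F a := by
  by_cases h : u.len + v.len = r + 1
  · obtain ⟨t, q, L, hL⟩ := exists_slot (k := k) r u v h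
    refine ⟨(cls ι r).toLinearMap t q ∘ₗ L, fun a => ?_⟩
    rw [freeTrace_of, if_pos (by simpa [BarWord.len_mul] using h), hL]
    rfl
  · refine ⟨0, fun a => ?_⟩
    rw [freeTrace_of, if_neg (by simpa [BarWord.len_mul] using h)]
    rfl

/-- The structure map `A → A⟨ε⟩`. -/
noncomputable def emb : A →ₐ[k] BarAlg ι :=
  AlgHom.ofLinearMap
    { toFun := fun a => word ι (BarWord.of a)
      map_add' := fun a b => by
        rw [← sub_eq_zero]
        refine mkL_eq_zero ι (y := MonoidAlgebra.of k _ (BarWord.of (a + b)) -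
          (MonoidAlgebra.of k _ (BarWord.of a) + MonoidAlgebra.of k _ (BarWord.of b)))
          (mem_barIdeal_of_words fun r u v => ?_)
        obtain ⟨F, hF⟩ := exists_linear ι r u v
        rw [mul_sub, mul_add, sub_mul, add_mul, ← map_mul, ← map_mul, ← map_mul, ← map_mul,
          ← map_mul, ← map_mul, map_sub, map_add, hF, hF, hF, map_add, sub_self]
      map_smul' := fun c a => by
        rw [← sub_eq_zero]
        refine mkL_eq_zero ι (y := MonoidAlgebra.of k _ (BarWord.of (c • a)) -
          c • MonoidAlgebra.of k _ (BarWord.of a)) (mem_barIdeal_of_words fun r u v => ?_)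
        obtain ⟨F, hF⟩ := exists_linear ι r u v
        rw [mul_sub, sub_mul, mul_smul_comm, smul_mul_assoc, ← map_mul, ← map_mul, ← map_mul,
          ← map_mul, map_sub, map_smul, hF, hF, map_smul, sub_self] }
    (by simp [BarWord.of_one, word_one]) (by simp [BarWord.of_mul, word_mul])

theorem emb_apply (a : A) : emb ι a = word ι (BarWord.of a) := rfl

theorem trace_comm (r : ℕ) (y : BarAlg ι) (a : A) :
    trace ι r (y * emb ι a) = trace ι r (emb ι a * y) := trace_comm_of ι r y a

theorem eps_mul_eps : eps ι * eps ι = 0 := by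
  rw [eps, ← word_mul]
  refine mkL_eq_zero ι (mem_barIdeal_of_words fun r u v => ?_)
  rw [← map_mul, ← map_mul, freeTrace_of]
  split_ifs with h
  · simp only [BarWord.len_mul, BarWord.len_eps] at h
    refine cls_deg ι _ (⟨u.len + 1, by omega⟩ : Fin (r + 1)) 1 ?_ ?_
    · exact fun h => by simpa using congrArg Fin.val h
    · simp [wrap, BarWord.entry_mul, BarWord.len_mul]
  · rfl

theorem entry_of_eps (u v : BarWord A) (a : A) (j : ℕ) :
    (u * (BarWord.of a * BarWord.eps) * v).entry j =
      if j = u.len then (u * BarWord.eps * v).entry j * a else (u * BarWord.eps * v).entry j := by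
  simp only [BarWord.entry_mul, BarWord.entry_of, BarWord.len_mul, BarWord.len_of, BarWord.len_eps,
    BarWord.entry_eps]
  rcases lt_trichotomy j u.len with h | h | h
  · simp [h, h.ne, h.trans (Nat.lt_succ_self _)]
  · simp [h]
  · simp [h.not_ge, h.ne']

theorem entry_eps_of (u v : BarWord A) (a : A) (j : ℕ) :
    (u * (BarWord.eps * BarWord.of a) * v).entry j =
      if j = u.len + 1 then a * (u * BarWord.eps * v).entry j
        else (u * BarWord.eps * v).entry j := by
  simp only [BarWord.entry_mul, BarWord.entry_of, BarWord.len_mul, BarWord.len_of, BarWord.len_eps,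
    BarWord.entry_eps]
  rcases lt_trichotomy j (u.len + 1) with h | h | h
  · have h1 : j - u.len = 0 := by omega
    simp [h, h.ne, h1]
  · simp [h]
  · simp [h.not_gt, h.ne']

theorem eps_comm (c : K) : eps ι * emb ι (ι c) = emb ι (ι c) * eps ι := by
  rw [eps, emb_apply, ← word_mul, ← word_mul, ← sub_eq_zero]
  refine mkL_eq_zero ι (y := MonoidAlgebra.of k _ (BarWord.eps * BarWord.of (ι c)) -
    MonoidAlgebra.of k _ (BarWord.of (ι c) * BarWord.eps)) (mem_barIdeal_of_words fun r u v => ?_)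
  rw [mul_sub, sub_mul, ← map_mul, ← map_mul, ← map_mul, ← map_mul, map_sub, freeTrace_of,
    freeTrace_of, sub_eq_zero]
  by_cases h : u.len + 1 + v.len = r + 1
  · rw [if_pos (by simpa [BarWord.len_mul] using h), if_pos (by simpa [BarWord.len_mul] using h)]
    symm
    refine cls_bal_nat (r := r) ι
      (wrap r (u * (BarWord.of (ι c) * BarWord.eps) * v).entry)
      (wrap r (u * (BarWord.eps * BarWord.of (ι c)) * v).entry)
      (wrap r (u * BarWord.eps * v).entry) u.len (if u.len = r then 0 else u.len + 1) c
      (by omega) rfl (fun j hj => ?_) (fun j hj => ?_)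
    · simp only [wrap, entry_of_eps]
      generalize (u * BarWord.eps * v).entry = g
      by_cases h0 : j = 0
      · subst h0
        by_cases h1 : 0 = u.len
        · rw [← h1]; simp [mul_assoc]
        · rw [if_pos rfl, if_neg (by omega), if_neg h1, if_neg h1, if_pos rfl]
      · simp only [if_neg h0]
        by_cases h1 : j = u.len
        · rw [if_pos h1, if_pos h1, if_neg (by omega), h1]
        · rw [if_neg h1, if_neg h1]
    · simp only [wrap, entry_eps_of]
      generalize (u * BarWord.eps * v).entry = g
      by_cases h0 : j = 0
      · subst h0
        by_cases h1 : u.len = r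
        · simp [h1, mul_assoc]
        · simp [h1, Ne.symm h1]
      · by_cases h1 : u.len = r
        · have h2 : j ≠ r + 1 := by omega
          simp [h0, h1, h2]
        · by_cases h2 : j = u.len + 1
          · simp [h1, h2]
          · simp [h0, h1, h2]
  · rw [if_neg (by simpa [BarWord.len_mul] using h), if_neg (by simpa [BarWord.len_mul] using h)]

@[simp] theorem sign_emb (a : A) : sign ι (emb ι a) = emb ι a := by
  rw [emb_apply, sign_word]; simp

@[simp] theorem bar_emb (a : A) : bar ι (emb ι a) = 0 := by
  rw [emb_apply, bar_word]; simp

@[simp] theorem sign_eps : sign ι (eps ι) = -eps ι := by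
  rw [eps, sign_word]; simp

@[simp] theorem bar_eps : bar ι (eps ι) = 1 := by
  have h : (BarWord.eps : BarWord A).fuse 0 = 1 :=
    BarWord.ext rfl (funext fun j => by simp [BarWord.entry_fuse])
  rw [eps, bar_word]
  simp [h, word_one]

theorem bar_emb_mul (a : A) (y : BarAlg ι) : bar ι (emb ι a * y) = emb ι a * bar ι y := by
  rw [bar_mul]; simp

theorem bar_eps_mul (y : BarAlg ι) : bar ι (eps ι * y) = y - eps ι * bar ι y := by
  rw [bar_mul]; simp [sub_eq_add_neg]

theorem bar_bar (y : BarAlg ι) : bar ι (bar ι y) = 0 := by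
  have : bar ι ∘ₗ bar ι = 0 := by
    refine ext_words ι fun u => ?_
    rw [LinearMap.comp_apply, LinearMap.zero_apply]
    induction u using BarWord.induction_left with
    | one => rw [bar_word]; simp
    | of a u hu => rw [word_mul, ← emb_apply, bar_emb_mul, bar_emb_mul, hu, mul_zero]
    | eps u hu =>
      rw [word_mul, ← eps, bar_eps_mul, map_sub, bar_eps_mul, hu, mul_zero, sub_zero, sub_self]
  exact LinearMap.congr_fun this y

/-- The element `ε a₁ ε a₂ ε ⋯ ε a_r ε`. -/
noncomputable def chain : List A → BarAlg ι
  | [] => eps ι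
  | a :: l => eps ι * emb ι a * chain l

/-- The word `ε a₁ ε a₂ ε ⋯ ε a_r ε`. -/
def chainWord : List A → BarWord A
  | [] => BarWord.eps
  | a :: l => BarWord.eps * BarWord.of a * chainWord l

theorem chain_eq_word (l : List A) : chain ι l = word ι (chainWord l) := by
  induction l with
  | nil => rfl
  | cons a l ih => rw [chain, chainWord, word_mul, word_mul, ih]; rfl

theorem len_chainWord (l : List A) : (chainWord l).len = l.length + 1 := by
  induction l with
  | nil => rfl
  | cons a l ih =>
    rw [chainWord, BarWord.len_mul, BarWord.len_mul, ih, List.length_cons]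
    simp [add_comm]

theorem entry_chainWord (l : List A) (j : ℕ) : (chainWord l).entry j =
    if j = 0 then 1 else l.getD (j - 1) 1 := by
  induction l generalizing j with
  | nil => simp [chainWord]
  | cons a l ih =>
    simp only [chainWord, BarWord.entry_mul, BarWord.len_mul, BarWord.len_eps, BarWord.len_of,
      BarWord.entry_eps, BarWord.entry_of, ih]
    rcases j with _ | _ | j
    · simp
    · simp
    · simp

theorem trace_chain (r : ℕ) (a : A) (l : List A) (hl : l.length = r) :
    trace ι r (emb ι a * chain ι l) =
      cls ι r (fun j : Fin (r + 1) => if (j : ℕ) = 0 then a else l.getD (j - 1) 1) := by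
  rw [chain_eq_word, emb_apply, ← word_mul, trace_word, if_pos (by simp [BarWord.len_mul, len_chainWord, hl])]
  congr 1
  ext j
  simp only [wrap, BarWord.entry_mul, BarWord.len_of, entry_chainWord, BarWord.entry_of]
  have : l.getD r 1 = 1 := List.getD_eq_default _ _ (by omega)
  split_ifs <;> first | omega | simp_all

theorem cls_eq_trace (r : ℕ) (a : Fin (r + 1) → A) :
    cls ι r a = trace ι r (emb ι (a 0) * chain ι (List.ofFn fun j : Fin r => a j.succ)) := by
  rw [trace_chain ι r _ _ (List.length_ofFn)]
  congr 1
  ext j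
  refine Fin.cases ?_ (fun j => ?_) j
  · simp
  · simp

theorem hochX_ext {r : ℕ} {N : Type*} [AddCommGroup N] [Module k N] {F G : HochX ι r →ₗ[k] N}
    (h : ∀ a, F (cls ι r a) = G (cls ι r a)) : F = G := by
  refine Submodule.linearMap_qext _ (PiTensorProduct.ext (MultilinearMap.ext fun a => ?_))
  exact h a

theorem hochX_ext_trace {r : ℕ} {N : Type*} [AddCommGroup N] [Module k N]
    {F G : HochX ι r →ₗ[k] N} (h : ∀ a l, l.length = r →
      F (trace ι r (emb ι a * chain ι l)) = G (trace ι r (emb ι a * chain ι l))) : F = G :=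
  hochX_ext ι fun a => by rw [cls_eq_trace]; exact h _ _ (List.length_ofFn)

end BarAlg

theorem hochB_comp_hochB (ι : K →ₐ[k] A) (r : ℕ) : hochB ι r ∘ₗ hochB ι (r + 1) = 0 := by
  refine BarAlg.hochX_ext_trace ι fun a l _ => ?_
  rw [LinearMap.comp_apply, ← BarAlg.trace_bar, ← BarAlg.trace_bar, BarAlg.bar_bar, map_zero,
    LinearMap.zero_apply]

end BarAlgebra
end MonogenicCyclic

namespace MonogenicCyclic

open scoped TensorProduct
open Function

/-! ### Relative Hochschild chains form a mixed complex -/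

section MixedHochschild

variable {k K A : Type*} [CommRing k] [Ring K] [Algebra k K] [Ring A] [Algebra k A]

theorem exists_periodic {A : Type*} {r : ℕ} (a : Fin (r + 1) → A) :
    ∃ g : ℕ → A, (∀ j, g (j + (r + 1)) = g j) ∧ a = fun j : Fin (r + 1) => g j := by
  refine ⟨fun j => a (Fin.ofNat (r + 1) j), fun j => ?_, ?_⟩
  · refine congrArg a (Fin.ext ?_)
    simp [Fin.ofNat]
  · refine funext fun j => ?_
    refine congrArg a (Fin.ext ?_)
    simp [Fin.ofNat, Nat.mod_eq_of_lt j.2]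

/-- The tuple `(1, g_i, g_{i+1}, …)`. -/
def unitCons (g : ℕ → A) (i j : ℕ) : A := if j = 0 then 1 else g (i + j - 1)

theorem val_add_cyc {r : ℕ} (i j : Fin (r + 1)) :
    ((i + j : Fin (r + 1)) : ℕ) = if (i : ℕ) + j ≤ r then (i : ℕ) + j else i + j - (r + 1) := by
  rw [Fin.val_add]
  have := i.2
  have := j.2
  split_ifs
  · exact Nat.mod_eq_of_lt (by omega)
  · rw [Nat.mod_eq_sub_mod (by omega), Nat.mod_eq_of_lt (by omega)]

theorem rot_nat {r : ℕ} (i : Fin (r + 1)) (g : ℕ → A) : rot i (fun j : Fin (r + 1) => g j) =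
    fun j : Fin (r + 2) => if (j : ℕ) = 0 then 1 else
      g (if (i : ℕ) + (j - 1) ≤ r then i + (j - 1) else i + (j - 1) - (r + 1)) := by
  ext j
  refine Fin.cases ?_ (fun j => ?_) j
  · rfl
  · simp only [rot, Fin.cons_succ, val_add_cyc, Fin.val_succ, Nat.add_sub_cancel]
    rw [if_neg (Nat.succ_ne_zero _)]

theorem connesB_periodic (ι : K →ₐ[k] A) (r : ℕ) (g : ℕ → A) (hg : ∀ j, g (j + (r + 1)) = g j) :
    connesB ι r (cls ι r fun j => g j) = ∑ i ∈ Finset.range (r + 1),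
      (-1 : k) ^ (i * r) • cls ι (r + 1) (fun j => unitCons g i j) := by
  rw [connesB_cls, ← Fin.sum_univ_eq_sum_range
    (fun i => (-1 : k) ^ (i * r) • cls ι (r + 1) (fun j => unitCons g i j))]
  refine Finset.sum_congr rfl fun i _ => ?_
  rw [rot_nat]
  congr 2
  ext j
  simp only [unitCons]
  have := j.2
  split_ifs with h1 h2
  · rfl
  · congr 1; omega
  · rw [← hg]; congr 1; omega

theorem hochB_nat (ι : K →ₐ[k] A) (r : ℕ) (g : ℕ → A) :
    hochB ι r (cls ι (r + 1) fun j => g j) = ∑ i ∈ Finset.range (r + 2),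
      (-1 : k) ^ i • cls ι r (fun j => faceN r i g j) := by
  rw [hochB_cls, ← Fin.sum_univ_eq_sum_range
    (fun i => (-1 : k) ^ i • cls ι r (fun j => faceN r i g j))]
  exact Finset.sum_congr rfl fun i _ => by rw [face_nat]

theorem connesB_comp_connesB (ι : K →ₐ[k] A) (r : ℕ) :
    connesB ι (r + 1) ∘ₗ connesB ι r = 0 := by
  refine BarAlg.hochX_ext ι fun a => ?_
  rw [LinearMap.comp_apply, connesB_cls, map_sum, LinearMap.zero_apply]
  refine Finset.sum_eq_zero fun i _ => ?_
  rw [map_smul, connesB_cls, Finset.sum_eq_zero, smul_zero]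
  intro p _
  rw [cls_deg ι _ (0 - p).succ 1 (Fin.succ_ne_zero _) (by simp [rot]), smul_zero]

theorem hochB_comp_connesB_zero (ι : K →ₐ[k] A) : hochB ι 0 ∘ₗ connesB ι 0 = 0 := by
  refine BarAlg.hochX_ext ι fun a => ?_
  rw [LinearMap.comp_apply, connesB_cls, map_sum, LinearMap.zero_apply]
  refine Finset.sum_eq_zero fun i _ => ?_
  have h : cls ι 0 (face 0 (rot i a)) = cls ι 0 (face 1 (rot i a)) := by
    congr 1
    ext j
    obtain rfl : j = 0 := Fin.ext (by omega)
    simp [face, rot]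
  rw [map_smul, hochB_cls, Fin.sum_univ_two, h]
  simp

theorem neg_one_pow_congr {a b : ℕ} (h : a % 2 = b % 2) : (-1 : k) ^ a = (-1 : k) ^ b := by
  rw [neg_one_pow_eq_pow_mod_two, h, ← neg_one_pow_eq_pow_mod_two]

theorem neg_one_pow_eq_neg {a b : ℕ} (h : (a + b) % 2 = 1) : (-1 : k) ^ a = -(-1 : k) ^ b := by
  rw [neg_one_pow_congr (b := b + 1) (by omega), pow_succ, mul_neg_one]

set_option maxHeartbeats 1000000 in
theorem connesB_hochB_add (ι : K →ₐ[k] A) (r : ℕ) :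
    connesB ι r ∘ₗ hochB ι r + hochB ι (r + 1) ∘ₗ connesB ι (r + 1) = 0 := by
  refine BarAlg.hochX_ext ι fun a => ?_
  obtain ⟨g, hg, rfl⟩ := exists_periodic a
  have hper : ∀ a b, (a = b ∨ a = b + (r + 2) ∨ b = a + (r + 2)) → g a = g b := by
    rintro a b (h | h | h)
    · rw [h]
    · rw [h]; exact hg _
    · rw [h]; exact (hg _).symm
  simp only [LinearMap.add_apply, LinearMap.comp_apply, LinearMap.zero_apply]
  rw [connesB_periodic ι _ g hg, map_sum]
  -- the first and the last face of the terms of `B` cancel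
  have h1 : ∀ i, hochB ι (r + 1) ((-1 : k) ^ (i * (r + 1)) •
      cls ι (r + 1 + 1) (fun j => unitCons g i j)) =
      (-1 : k) ^ (i * (r + 1)) • cls ι (r + 1) (fun j => g (i + j)) +
      (-1 : k) ^ (i * (r + 1) + r) • cls ι (r + 1) (fun j => g (i + (r + 1) + j)) +
      ∑ q ∈ Finset.range (r + 1), (-1 : k) ^ (i * (r + 1) + q + 1) •
        cls ι (r + 1) (fun j => faceN (r + 1) (q + 1) (unitCons g i) j) := by
    intro i
    rw [map_smul, hochB_nat, Finset.sum_range_succ, Finset.sum_range_succ', smul_add, smul_add,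
      Finset.smul_sum]
    have e1 : cls ι (r + 1) (fun j => faceN (r + 1) 0 (unitCons g i) j) =
        cls ι (r + 1) (fun j => g (i + j)) := by
      congr 1
      ext j
      simp only [faceN, unitCons, if_neg (Nat.succ_ne_zero (r + 1)).symm]
      split_ifs <;> first | contradiction | omega | (rw [one_mul]; refine congrArg g ?_; omega) |
        (refine congrArg g ?_; omega)
    have e2 : cls ι (r + 1) (fun j => faceN (r + 1) (r + 1 + 1) (unitCons g i) j) =
        cls ι (r + 1) (fun j => g (i + (r + 1) + j)) := by
      congr 1
      ext j
      simp only [faceN, unitCons, if_true, if_neg (Nat.succ_ne_zero (r + 1))]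
      split_ifs <;> first | omega | (rw [mul_one]; refine hper _ _ ?_; omega) |
        (refine hper _ _ ?_; omega)
    rw [e1, e2, pow_zero, one_smul, smul_smul, ← pow_add]
    simp only [smul_smul, ← pow_add]
    rw [neg_one_pow_congr (a := i * (r + 1) + (r + 1 + 1)) (b := i * (r + 1) + r) (by omega),
      add_comm (Finset.sum _ _)]
    simp only [← add_assoc]
    abel
  simp only [h1, Finset.sum_add_distrib]
  have h2 : ∑ i ∈ Finset.range (r + 1 + 1),
        (-1 : k) ^ (i * (r + 1)) • cls ι (r + 1) (fun j => g (i + j)) +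
      ∑ i ∈ Finset.range (r + 1 + 1),
        (-1 : k) ^ (i * (r + 1) + r) • cls ι (r + 1) (fun j => g (i + (r + 1) + j)) = 0 := by
    rw [Finset.sum_range_succ, Finset.sum_range_succ' (n := r + 1), add_add_add_comm,
      ← Finset.sum_add_distrib, Finset.sum_eq_zero, zero_add]
    · have hs : (-1 : k) ^ ((r + 1) * (r + 1)) = -(-1 : k) ^ (0 * (r + 1) + r) := by
        refine neg_one_pow_eq_neg ?_
        have := Nat.even_mul_succ_self r
        have h3 : (r + 1) * (r + 1) + (0 * (r + 1) + r) = r * (r + 1) + 2 * r + 1 := by ring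
        rw [h3]
        have := Nat.even_iff.1 this
        omega
      rw [hs, neg_smul, zero_add, neg_add_cancel]
    · intro i _
      have hs : (-1 : k) ^ (i * (r + 1)) = -(-1 : k) ^ ((i + 1) * (r + 1) + r) := by
        refine neg_one_pow_eq_neg ?_
        have h3 : i * (r + 1) + ((i + 1) * (r + 1) + r) = 2 * (i * (r + 1) + r) + 1 := by ring
        omega
      have ht : cls ι (r + 1) (fun j => g (i + 1 + (r + 1) + j)) =
          cls ι (r + 1) (fun j => g (i + j)) := by
        congr 1
        ext j
        refine hper _ _ ?_
        omega
      rw [hs, ht, neg_smul, neg_add_cancel]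
  rw [h2, zero_add, hochB_nat, map_sum]
  -- the remaining terms correspond to the faces of `B b`
  have h3 : ∀ p, connesB ι r ((-1 : k) ^ p • cls ι r (fun j => faceN r p g j)) =
      ∑ i ∈ Finset.range (r + 1), (-1 : k) ^ (p + i * r) • cls ι (r + 1)
        (fun j => if (j : ℕ) = 0 then 1 else
          faceN r p g (if i + (j - 1) ≤ r then i + (j - 1) else i + (j - 1) - (r + 1))) := by
    intro p
    rw [map_smul, connesB_cls, Finset.smul_sum, ← Fin.sum_univ_eq_sum_range
      (fun i => (-1 : k) ^ (p + i * r) • cls ι (r + 1)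
        (fun j => if (j : ℕ) = 0 then 1 else
          faceN r p g (if i + (j - 1) ≤ r then i + (j - 1) else i + (j - 1) - (r + 1))))]
    refine Finset.sum_congr rfl fun i _ => ?_
    rw [rot_nat, smul_smul, ← pow_add]
  simp only [h3]
  rw [← Finset.sum_product', ← Finset.sum_product', ← eq_neg_iff_add_eq_zero,
    ← Finset.sum_neg_distrib]
  refine Finset.sum_nbij'
    (fun x => if x.1 = r + 1 then (if x.2 = 0 then (r + 1, 0) else (x.2, r + 1 - x.2))
      else if x.2 ≤ x.1 then (x.2, x.1 - x.2) else (x.2 + 1, x.1 + r + 1 - x.2))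
    (fun y => if y.1 + y.2 ≤ r then (y.1 + y.2, y.1)
      else if y.1 + y.2 = r + 1 then (r + 1, if y.2 = 0 then 0 else y.1)
      else (y.1 + y.2 - (r + 2), y.1 - 1)) ?_ ?_ ?_ ?_ ?_
  · rintro ⟨p, i⟩ h
    simp only [Finset.mem_product, Finset.mem_range] at h ⊢
    split_ifs <;> constructor <;> dsimp only <;> omega
  · rintro ⟨i, q⟩ h
    simp only [Finset.mem_product, Finset.mem_range] at h ⊢
    split_ifs <;> constructor <;> dsimp only <;> omega
  · rintro ⟨p, i⟩ h
    simp only [Finset.mem_product, Finset.mem_range] at h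
    by_cases h1 : p = r + 1
    · by_cases h2 : i = 0
      · simp [h1, h2]
      · have : r + 1 - i ≠ 0 := by omega
        have h3 : i + (r + 1 - i) = r + 1 := by omega
        simp [h1, h2, h3, this]
    · by_cases h2 : i ≤ p
      · have h3 : i + (p - i) = p := by omega
        have h4 : p ≤ r := by omega
        simp [h1, h2, h3, h4]
      · have h3 : i + 1 + (p + r + 1 - i) = p + (r + 2) := by omega
        have h4 : ¬ p + (r + 2) ≤ r := by omega
        have h5 : p + (r + 2) ≠ r + 1 := by omega
        simp [h1, h2, h3, h4, h5]
  · rintro ⟨i, q⟩ h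
    simp only [Finset.mem_product, Finset.mem_range] at h
    by_cases h1 : i + q ≤ r
    · have h2 : i + q ≠ r + 1 := by omega
      simp [h1, h2]
    · by_cases h2 : i + q = r + 1
      · by_cases h3 : q = 0
        · have : i = r + 1 := by omega
          simp [h3, this]
        · have h4 : i ≠ 0 := by omega
          have h5 : r + 1 - i = q := by omega
          simp [h2, h3, h4, h5]
      · have h3 : i + q - (r + 2) ≠ r + 1 := by omega
        have h4 : ¬ i - 1 ≤ i + q - (r + 2) := by omega
        have h5 : i - 1 + 1 = i := by omega
        have h6 : i + q - (r + 2) + r + 1 - (i - 1) = q := by omega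
        simp [h1, h2, h3, h4, h5, h6]
  · rintro ⟨p, i⟩ h
    simp only [Finset.mem_product, Finset.mem_range] at h
    dsimp only
    obtain ⟨i', q, hiq, h0, hs⟩ : ∃ i' q : ℕ, (if p = r + 1 then (if i = 0 then (r + 1, 0)
        else (i, r + 1 - i)) else if i ≤ p then (i, p - i) else (i + 1, p + r + 1 - i)) = (i', q) ∧
        ((p = r + 1 ∧ i = 0 ∧ i' = r + 1 ∧ q = 0) ∨ (p = r + 1 ∧ i ≠ 0 ∧ i' = i ∧ i + q = r + 1) ∨
          (p ≤ r ∧ i' = i ∧ i + q = p) ∨ (p < i ∧ i' = i + 1 ∧ i + q = p + r + 1)) ∧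
        (-1 : k) ^ (p + i * r) = -(-1 : k) ^ (i' * (r + 1) + q + 1) := by
      have e1 := Nat.even_iff.1 (Nat.even_mul_succ_self r)
      have e2 : (r + 1) * (r + 1) = r * (r + 1) + r + 1 := by ring
      have e3 : i * (r + 1) = i * r + i := by ring
      have e4 : (i + 1) * (r + 1) = i * r + i + r + 1 := by ring
      split_ifs with h1 h2 h2
      · refine ⟨_, _, rfl, by omega, neg_one_pow_eq_neg ?_⟩
        rw [h2, e2]; omega
      · refine ⟨_, _, rfl, by omega, neg_one_pow_eq_neg ?_⟩
        rw [e3]; omega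
      · refine ⟨_, _, rfl, by omega, neg_one_pow_eq_neg ?_⟩
        rw [e3]; omega
      · refine ⟨_, _, rfl, by omega, neg_one_pow_eq_neg ?_⟩
        rw [e4]; omega
    rw [hiq, hs, neg_smul]
    congr 3
    ext ⟨j, hj⟩
    dsimp only [faceN, unitCons]
    have hq : q + 1 ≠ r + 1 + 1 := by omega
    rcases j with _ | j
    · simp only [Nat.zero_add, if_neg hq, if_pos (Nat.succ_pos q), if_true]
    · simp only [Nat.add_sub_cancel, if_neg (Nat.succ_ne_zero _), if_neg hq]
      obtain ⟨J, hJ, hJ'⟩ : ∃ J, (if i + j ≤ r then i + j else i + j - (r + 1)) = J ∧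
          ((i + j ≤ r ∧ J = i + j) ∨ (r < i + j ∧ i + j = J + (r + 1))) := by
        split_ifs <;> exact ⟨_, rfl, by omega⟩
      rw [hJ]
      clear hJ h1 h2 h3 hiq hs
      rcases h0 with h0 | h0 | h0 | h0
      · obtain ⟨rfl, rfl, rfl, rfl⟩ := h0
        split_ifs <;> first | omega | (congr 1 <;> (refine hper _ _ ?_; omega)) |
          (refine hper _ _ ?_; omega)
      · obtain ⟨rfl, h0, rfl, h4⟩ := h0
        split_ifs <;> first | omega | (congr 1 <;> (refine hper _ _ ?_; omega)) |
          (refine hper _ _ ?_; omega)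
      · obtain ⟨h0, rfl, h4⟩ := h0
        split_ifs <;> first | omega | (congr 1 <;> (refine hper _ _ ?_; omega)) |
          (refine hper _ _ ?_; omega)
      · obtain ⟨h0, rfl, h4⟩ := h0
        split_ifs <;> first | omega | (congr 1 <;> (refine hper _ _ ?_; omega)) |
          (refine hper _ _ ?_; omega)

end MixedHochschild
end MonogenicCyclic

namespace MonogenicCyclic

open Function

/-! ### Perturbation of a homotopy equivalence onto a mixed complex -/

section TotLemmas

variable {k : Type*} [CommRing k] {X : ℕ → Type*} [∀ r, AddCommGroup (X r)] [∀ r, Module k (X r)]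

variable (b : ∀ r, X (r + 1) →ₗ[k] X r) (B : ∀ r, X r →ₗ[k] X (r + 1))

theorem totD_apply_zero (r j : ℕ) (h : 2 * j + 0 = r) (z : Tot X (r + 1)) :
    totD b B r z ⟨(j, 0), h⟩ = b 0 (z ⟨(j, 1), by simp only; omega⟩) := by
  simp [totD, totB]

theorem totD_apply_succ (r j s : ℕ) (h : 2 * j + (s + 1) = r) (z : Tot X (r + 1)) :
    totD b B r z ⟨(j, s + 1), h⟩ = b (s + 1) (z ⟨(j, s + 2), by simp only; omega⟩) +
      B s (z ⟨(j + 1, s), by simp only; omega⟩) := by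
  simp [totD, totB]

theorem periodicity_apply (r j s : ℕ) (h : 2 * j + s = r) (z : Tot X (r + 2)) :
    periodicity (k := k) r z ⟨(j, s), h⟩ = z ⟨(j + 1, s), by simp only; omega⟩ := rfl

theorem firstColumn_apply_zero (r : ℕ) (h : 2 * 0 + r = r) (x : X r) :
    firstColumn (k := k) r x ⟨(0, r), h⟩ = x := by
  simp [firstColumn]

theorem firstColumn_apply_succ (r j s : ℕ) (h : 2 * (j + 1) + s = r) (x : X r) :
    firstColumn (k := k) r x ⟨(j + 1, s), h⟩ = 0 := by
  rw [firstColumn, LinearMap.single_apply, Pi.single_eq_of_ne]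
  intro h
  have := congrArg (fun p => p.1.1) h
  simp at this

theorem tot_ext {X : ℕ → Type*} {r : ℕ} {y z : Tot X r}
    (h : ∀ j s (hp : 2 * j + s = r), y ⟨(j, s), hp⟩ = z ⟨(j, s), hp⟩) : y = z := funext fun ⟨⟨j, s⟩, hp⟩ => h j s hp

theorem periodicity_totD (r : ℕ) (z : Tot X (r + 2 + 1)) :
    periodicity (k := k) r (totD b B (r + 2) z) = totD b B r (periodicity (k := k) (r + 1) z) := by
  refine tot_ext fun j s h => ?_
  rcases s with _ | s
  · rw [periodicity_apply, totD_apply_zero, totD_apply_zero]; rfl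
  · rw [periodicity_apply, totD_apply_succ, totD_apply_succ]; rfl

theorem totD_firstColumn (r : ℕ) (x : X (r + 1)) :
    totD b B r (firstColumn (k := k) (r + 1) x) = firstColumn (k := k) r (b r x) := by
  refine tot_ext fun j s h => ?_
  rcases s with _ | s
  · rw [totD_apply_zero]
    rcases j with _ | j
    · obtain rfl : r = 0 := by omega
      rw [firstColumn_apply_zero, firstColumn_apply_zero]
    · rw [firstColumn_apply_succ, firstColumn_apply_succ, map_zero]
  · rw [totD_apply_succ, firstColumn_apply_succ, map_zero, add_zero]
    rcases j with _ | j
    · obtain rfl : r = s + 1 := by omega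
      rw [firstColumn_apply_zero, firstColumn_apply_zero]
    · rw [firstColumn_apply_succ, firstColumn_apply_succ, map_zero]

theorem firstColumn_injective (r : ℕ) : Injective (firstColumn (k := k) (X := X) r) := by
  intro x y h
  have := congrFun h ⟨(0, r), by simp⟩
  rwa [firstColumn_apply_zero, firstColumn_apply_zero] at this

theorem exists_periodicity_eq (r : ℕ) (w : Tot X r) :
    ∃ z : Tot X (r + 2), periodicity (k := k) r z = w := by
  let L : ∀ j s, 2 * j + s = r + 2 → X s := fun j s h => match j, h with
    | 0, _ => 0
    | j + 1, h => w ⟨(j, s), by simp only; omega⟩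
  exact ⟨fun p => L p.1.1 p.1.2 p.2, tot_ext fun j s h => rfl⟩

theorem exists_firstColumn_of_periodicity (r : ℕ) (z : Tot X (r + 2))
    (h : periodicity (k := k) r z = 0) : ∃ x, z = firstColumn (k := k) (r + 2) x := by
  refine ⟨z ⟨(0, r + 2), by simp⟩, tot_ext fun j s hp => ?_⟩
  rcases j with _ | j
  · obtain rfl : s = r + 2 := by omega
    rw [firstColumn_apply_zero]
  · rw [firstColumn_apply_succ]
    exact congrFun h ⟨(j, s), by simp only; omega⟩

theorem exists_firstColumn_of_lt_two (r : ℕ) (hr : r < 2) (z : Tot X r) :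
    ∃ x, z = firstColumn (k := k) r x := by
  refine ⟨z ⟨(0, r), by simp⟩, tot_ext fun j s hp => ?_⟩
  obtain rfl : j = 0 := by omega
  obtain rfl : s = r := by omega
  rw [firstColumn_apply_zero]

variable {b B}

theorem IsMixedComplex.totD_totD (h : IsMixedComplex b B) (r : ℕ) (z : Tot X (r + 2)) :
    totD b B r (totD b B (r + 1) z) = 0 := by
  have bb : ∀ r x, b r (b (r + 1) x) = 0 := fun r => LinearMap.congr_fun (h.b_b r)
  have BB : ∀ r x, B (r + 1) (B r x) = 0 := fun r => LinearMap.congr_fun (h.B_B r)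
  have b0 : ∀ x, b 0 (B 0 x) = 0 := LinearMap.congr_fun h.b_B_zero
  have bB : ∀ r x, B r (b r x) + b (r + 1) (B (r + 1) x) = 0 :=
    fun r => LinearMap.congr_fun (h.B_b_add_b_B r)
  refine tot_ext fun j s hp => ?_
  rcases s with _ | _ | s
  · rw [totD_apply_zero, totD_apply_succ, map_add, bb, b0, add_zero]; rfl
  · rw [totD_apply_succ, totD_apply_succ, totD_apply_zero, map_add, bb]
    exact (congrArg (· + _) (zero_add _)).trans ((add_comm _ _).trans (bB _ _))
  · rw [totD_apply_succ, totD_apply_succ, totD_apply_succ, map_add, map_add, bb, BB, zero_add,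
      add_zero]
    exact (add_comm _ _).trans (bB _ _)

end TotLemmas

section Perturbation

variable {k : Type*} [CommRing k] {X Y : ℕ → Type*}
  [∀ r, AddCommGroup (X r)] [∀ r, Module k (X r)] [∀ r, AddCommGroup (Y r)] [∀ r, Module k (Y r)]

/-- A homotopy retraction of the Hochschild part of a mixed complex `(X, b, B)` onto `(Y, d)`, with
submodules `V r ≤ X r` which contain the image of `φ`, are preserved by `ω B`, and on which
`ψ B ω B` vanishes. -/
structure IsRetract (b : ∀ r, X (r + 1) →ₗ[k] X r) (B : ∀ r, X r →ₗ[k] X (r + 1))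
    (d : ∀ r, Y (r + 1) →ₗ[k] Y r) (φ : ∀ r, Y r →ₗ[k] X r) (ψ : ∀ r, X r →ₗ[k] Y r)
    (ω : ∀ r, X r →ₗ[k] X (r + 1)) (V : ∀ r, Submodule k (X r)) : Prop where
  mixed : IsMixedComplex b B
  b_phi : ∀ r y, b r (φ (r + 1) y) = φ r (d r y)
  psi_phi : ∀ r y, ψ r (φ r y) = y
  homotopy_zero : ∀ x, b 0 (ω 0 x) = x - φ 0 (ψ 0 x)
  homotopy : ∀ r x, b (r + 1) (ω (r + 1) x) + ω r (b r x) = x - φ (r + 1) (ψ (r + 1) x)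
  phi_mem : ∀ r y, φ r y ∈ V r
  omega_B_mem : ∀ r, ∀ v ∈ V r, ω (r + 1) (B r v) ∈ V (r + 2)
  psi_B_omega_B : ∀ r, ∀ v ∈ V r, ψ (r + 3) (B (r + 2) (ω (r + 1) (B r v))) = 0

/-- The component with index `(j, s)` of the perturbed map `∑ᵢ (-ω B)ⁱ φ`. -/
def pertComp (B : ∀ r, X r →ₗ[k] X (r + 1)) (φ : ∀ r, Y r →ₗ[k] X r)
    (ω : ∀ r, X r →ₗ[k] X (r + 1)) (r : ℕ) : ∀ s j : ℕ, 2 * j + s = r → (Tot Y r →ₗ[k] X s)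
  | 0, j, h => φ 0 ∘ₗ LinearMap.proj (⟨(j, 0), h⟩ : {p : ℕ × ℕ // 2 * p.1 + p.2 = r})
  | 1, j, h => φ 1 ∘ₗ LinearMap.proj (⟨(j, 1), h⟩ : {p : ℕ × ℕ // 2 * p.1 + p.2 = r})
  | s + 2, j, h => φ (s + 2) ∘ₗ LinearMap.proj
        (⟨(j, s + 2), h⟩ : {p : ℕ × ℕ // 2 * p.1 + p.2 = r}) -
      ω (s + 1) ∘ₗ B s ∘ₗ pertComp B φ ω r s (j + 1) (by omega)

/-- The perturbed map `∑ᵢ (-ω B)ⁱ φ` between total complexes. -/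
def pert (B : ∀ r, X r →ₗ[k] X (r + 1)) (φ : ∀ r, Y r →ₗ[k] X r)
    (ω : ∀ r, X r →ₗ[k] X (r + 1)) (r : ℕ) : Tot Y r →ₗ[k] Tot X r :=
  LinearMap.pi fun p => pertComp B φ ω r p.1.2 p.1.1 p.2

/-- The operator `ψ B φ`. -/
def transfer (B : ∀ r, X r →ₗ[k] X (r + 1)) (φ : ∀ r, Y r →ₗ[k] X r) (ψ : ∀ r, X r →ₗ[k] Y r)
    (r : ℕ) : Y r →ₗ[k] Y (r + 1) := ψ (r + 1) ∘ₗ B r ∘ₗ φ r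

variable {b : ∀ r, X (r + 1) →ₗ[k] X r} {B : ∀ r, X r →ₗ[k] X (r + 1)}
    {d : ∀ r, Y (r + 1) →ₗ[k] Y r} {φ : ∀ r, Y r →ₗ[k] X r} {ψ : ∀ r, X r →ₗ[k] Y r}
    {ω : ∀ r, X r →ₗ[k] X (r + 1)} {V : ∀ r, Submodule k (X r)}

theorem pert_apply (r j s : ℕ) (h : 2 * j + s = r) (z : Tot Y r) :
    pert B φ ω r z ⟨(j, s), h⟩ = pertComp B φ ω r s j h z := rfl

theorem pertComp_zero (r j : ℕ) (h : 2 * j + 0 = r) (z : Tot Y r) :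
    pertComp B φ ω r 0 j h z = φ 0 (z ⟨(j, 0), h⟩) := rfl

theorem pertComp_one (r j : ℕ) (h : 2 * j + 1 = r) (z : Tot Y r) :
    pertComp B φ ω r 1 j h z = φ 1 (z ⟨(j, 1), h⟩) := rfl

theorem pertComp_add_two (r j s : ℕ) (h : 2 * j + (s + 2) = r) (z : Tot Y r) :
    pertComp B φ ω r (s + 2) j h z = φ (s + 2) (z ⟨(j, s + 2), h⟩) -
      ω (s + 1) (B s (pertComp B φ ω r s (j + 1) (by omega) z)) := rfl

theorem pert_periodicity (r : ℕ) (z : Tot Y (r + 2)) :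
    pert B φ ω r (periodicity (k := k) r z) = periodicity (k := k) r (pert B φ ω (r + 2) z) := by
  have key : ∀ s j (h : 2 * j + s = r), pertComp B φ ω r s j h (periodicity (k := k) r z) =
      pertComp B φ ω (r + 2) s (j + 1) (by omega) z := by
    intro s
    induction s using Nat.twoStepInduction with
    | zero => intro j h; rfl
    | one => intro j h; rfl
    | more s ih _ => intro j h; rw [pertComp_add_two, pertComp_add_two, ih]; rfl
  exact tot_ext fun j s h => key s j h

theorem pert_firstColumn (r : ℕ) (y : Y r) :
    pert B φ ω r (firstColumn (k := k) r y) = firstColumn (k := k) r (φ r y) := by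
  have key : ∀ s j (h : 2 * (j + 1) + s = r),
      pertComp B φ ω r s (j + 1) h (firstColumn (k := k) r y) = 0 := by
    intro s
    induction s using Nat.twoStepInduction with
    | zero => intro j h; rw [pertComp_zero, firstColumn_apply_succ, map_zero]
    | one => intro j h; rw [pertComp_one, firstColumn_apply_succ, map_zero]
    | more s ih _ =>
      intro j h
      rw [pertComp_add_two, firstColumn_apply_succ, ih, map_zero, map_zero, map_zero, sub_zero]
  refine tot_ext fun j s h => ?_
  rcases j with _ | j
  · obtain rfl : s = r := by omega
    rw [firstColumn_apply_zero, pert_apply]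
    rcases s with _ | _ | s
    · rw [pertComp_zero, firstColumn_apply_zero]
    · rw [pertComp_one, firstColumn_apply_zero]
    · rw [pertComp_add_two, firstColumn_apply_zero, key, map_zero, map_zero, sub_zero]
  · rw [firstColumn_apply_succ, pert_apply, key]

namespace IsRetract

variable (H : IsRetract b B d φ ψ ω V)

include H

theorem phi_injective (r : ℕ) : Injective (φ r) :=
  LeftInverse.injective (H.psi_phi r)

theorem psi_b (r : ℕ) (x : X (r + 1)) : ψ r (b r x) = d r (ψ (r + 1) x) := by
  have bb : ∀ r x, b r (b (r + 1) x) = 0 := fun r => LinearMap.congr_fun (H.mixed.b_b r)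
  refine H.phi_injective r ?_
  rw [← H.b_phi]
  have h1 := congrArg (b r) (H.homotopy r x)
  rw [map_add, bb, zero_add, map_sub] at h1
  rcases r with _ | r
  · rw [H.homotopy_zero] at h1
    exact sub_right_inj.1 h1
  · have h2 := H.homotopy r (b (r + 1) x)
    rw [bb, map_zero, add_zero, h1] at h2
    exact (sub_right_inj.1 h2).symm

theorem b_omega_B_zero (x : X 0) :
    b 1 (ω 1 (B 0 x)) = B 0 x - φ 1 (ψ 1 (B 0 x)) := by
  have h := H.homotopy 0 (B 0 x)
  rwa [show b 0 (B 0 x) = 0 from LinearMap.congr_fun H.mixed.b_B_zero x, map_zero, add_zero] at h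

theorem b_omega_B_succ (r : ℕ) (x : X (r + 1)) : b (r + 2) (ω (r + 2) (B (r + 1) x)) =
    B (r + 1) x - φ (r + 2) (ψ (r + 2) (B (r + 1) x)) + ω (r + 1) (B r (b r x)) := by
  have h := H.homotopy (r + 1) (B (r + 1) x)
  have h2 : B r (b r x) + b (r + 1) (B (r + 1) x) = 0 :=
    LinearMap.congr_fun (H.mixed.B_b_add_b_B r) x
  rw [eq_neg_of_add_eq_zero_right h2, map_neg] at h
  rw [← h]; abel

theorem mixed_transfer : IsMixedComplex d (transfer B φ ψ) := by
  have bb : ∀ r x, b r (b (r + 1) x) = 0 := fun r => LinearMap.congr_fun (H.mixed.b_b r)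
  have BB : ∀ r x, B (r + 1) (B r x) = 0 := fun r => LinearMap.congr_fun (H.mixed.B_B r)
  have b0 : ∀ x, b 0 (B 0 x) = 0 := LinearMap.congr_fun H.mixed.b_B_zero
  have bB : ∀ r x, B r (b r x) + b (r + 1) (B (r + 1) x) = 0 :=
    fun r => LinearMap.congr_fun (H.mixed.B_b_add_b_B r)
  refine ⟨fun r => LinearMap.ext fun y => ?_, fun r => LinearMap.ext fun y => ?_,
    LinearMap.ext fun y => ?_, fun r => LinearMap.ext fun y => ?_⟩
  · simp only [LinearMap.comp_apply, LinearMap.zero_apply]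
    refine H.phi_injective r ?_
    rw [← H.b_phi, ← H.b_phi, bb, map_zero]
  · simp only [transfer, LinearMap.comp_apply, LinearMap.zero_apply]
    have hv : ∀ r (y : Y r), ψ (r + 3) (B (r + 2) (ω (r + 1) (B r (φ r y)))) = 0 :=
      fun r y => H.psi_B_omega_B r _ (H.phi_mem r y)
    -- `φ ψ = 1 - b ω - ω b`, so that `ψ B φ ψ B φ` is a sum of terms `ψ B ω B φ`
    have key : φ (r + 1) (ψ (r + 1) (B r (φ r y))) + b (r + 1) (ω (r + 1) (B r (φ r y))) =
        B r (φ r y) + (match r, y with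
          | 0, _ => 0
          | s + 1, y => ω (s + 1) (B s (φ s (d s y)))) := by
      rcases r with _ | r
      · rw [H.b_omega_B_zero]; simp
      · rw [H.b_omega_B_succ, H.b_phi]; simp only; abel
    have h1 := congrArg (fun x => ψ (r + 2) (B (r + 1) x)) key
    simp only [map_add] at h1
    rw [BB, map_zero, zero_add] at h1
    have h2 : ψ (r + 2) (B (r + 1) (b (r + 1) (ω (r + 1) (B r (φ r y))))) = 0 := by
      rw [eq_neg_of_add_eq_zero_left (bB (r + 1) _), map_neg, H.psi_b, hv, map_zero, neg_zero]
    rw [h2, add_zero] at h1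
    rw [h1]
    rcases r with _ | r
    · simp
    · exact hv r _
  · simp only [transfer, LinearMap.comp_apply, LinearMap.zero_apply]
    rw [← H.psi_b, b0, map_zero]
  · simp only [transfer, LinearMap.comp_apply, LinearMap.zero_apply, LinearMap.add_apply]
    rw [← H.psi_b, ← H.b_phi, ← map_add, bB, map_zero]

theorem pertComp_mem (r s j : ℕ) (h : 2 * j + s = r) (z : Tot Y r) :
    pertComp B φ ω r s j h z ∈ V s := by
  induction s using Nat.twoStepInduction generalizing j with
  | zero => exact H.phi_mem _ _
  | one => exact H.phi_mem _ _
  | more s ih _ => exact (V _).sub_mem (H.phi_mem _ _) (H.omega_B_mem _ _ (ih _ _))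

theorem psi_B_pertComp (r s j : ℕ) (h : 2 * j + s = r) (z : Tot Y r) :
    ψ (s + 1) (B s (pertComp B φ ω r s j h z)) = transfer B φ ψ s (z ⟨(j, s), h⟩) := by
  rcases s with _ | _ | s
  · rfl
  · rfl
  · rw [pertComp_add_two, map_sub, map_sub, H.psi_B_omega_B _ _ (H.pertComp_mem _ _ _ _ _),
      sub_zero]
    rfl

theorem pert_totD (r : ℕ) (z : Tot Y (r + 1)) :
    pert B φ ω r (totD d (transfer B φ ψ) r z) = totD b B r (pert B φ ω (r + 1) z) := by
  have BB : ∀ r x, B (r + 1) (B r x) = 0 := fun r => LinearMap.congr_fun (H.mixed.B_B r)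
  refine tot_ext fun j s h => ?_
  induction s using Nat.twoStepInduction generalizing j with
  | zero =>
    rw [pert_apply, pertComp_zero, totD_apply_zero, totD_apply_zero, pert_apply, pertComp_one,
      H.b_phi]
  | one =>
    rw [pert_apply, pertComp_one, totD_apply_succ, totD_apply_succ, pert_apply, pert_apply,
      pertComp_add_two, map_sub, H.b_omega_B_zero, H.psi_B_pertComp, map_add, H.b_phi]
    abel
  | more s ih _ =>
    have ih := ih (j + 1) (by omega)
    have e : B s (pertComp B φ ω r s (j + 1) (by omega) (totD d (transfer B φ ψ) r z)) =
        B s (b s (pertComp B φ ω (r + 1) (s + 1) (j + 1) (by omega) z)) := by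
      rw [← pert_apply, ih]
      rcases s with _ | s
      · rw [totD_apply_zero]; rfl
      · rw [totD_apply_succ, map_add, BB, add_zero]; rfl
    rw [pert_apply, pertComp_add_two, totD_apply_succ, totD_apply_succ, pert_apply, pert_apply,
      pertComp_add_two, map_sub, H.b_omega_B_succ, H.psi_B_pertComp, map_add, H.b_phi, e]
    abel

/-- Acyclicity of the mapping cone of `φ`. The elements `ω φ y` are cycles; correcting `ψ x` and
`ω x` by them makes up for the missing side condition `ω φ = 0`. -/
theorem exists_of_b_eq (r : ℕ) (x : X (r + 1)) (y : Y r) (h0 : b r (ω r (φ r y)) = 0)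
    (h : b r x = φ r y) :
    ∃ (y' : Y (r + 1)) (x' : X (r + 2)), d r y' = y ∧ x - φ (r + 1) y' = b (r + 1) x' := by
  refine ⟨ψ (r + 1) x + ψ (r + 1) (ω r (φ r y)), ω (r + 1) x + ω (r + 1) (ω r (φ r y)), ?_, ?_⟩
  · rw [map_add, ← H.psi_b, ← H.psi_b, h0, map_zero, add_zero, h, H.psi_phi]
  · have h1 := H.homotopy r x
    have h2 := H.homotopy r (ω r (φ r y))
    rw [h0, map_zero, add_zero] at h2
    rw [h] at h1
    rw [map_add, map_add, h2, ← sub_sub, ← h1]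
    abel

theorem exists_of_b_eq_of_cycle (r : ℕ) (x : X (r + 1)) (y : Y r)
    (hy : firstColumn (k := k) r y ∈ totCycles d (transfer B φ ψ) r) (h : b r x = φ r y) :
    ∃ (y' : Y (r + 1)) (x' : X (r + 2)), d r y' = y ∧ x - φ (r + 1) y' = b (r + 1) x' := by
  have h0 : b r (ω r (φ r y)) = 0 := by
    rcases r with _ | r
    · rw [H.homotopy_zero, H.psi_phi, sub_self]
    · have h1 := H.homotopy r (φ (r + 1) y)
      have h2 : d r y = 0 := by
        refine firstColumn_injective (k := k) r ?_
        rw [← totD_firstColumn d (transfer B φ ψ), map_zero]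
        exact hy
      rwa [H.psi_phi, sub_self, H.b_phi, h2, map_zero, map_zero, add_zero] at h1
  exact H.exists_of_b_eq r x y h0 h

theorem totD_mem_totCycles (r : ℕ) (z : Tot Y (r + 1)) :
    totD d (transfer B φ ψ) r z ∈ totCycles d (transfer B φ ψ) r := by
  rcases r with _ | r
  · trivial
  · exact H.mixed_transfer.totD_totD r z

/-- If the cone of the perturbed map is acyclic at `(y, z)` modulo the first column, then it is
acyclic at `(y, z)`. -/
theorem exists_of_columns (r : ℕ) (y : Tot X (r + 1)) (z : Tot Y r)
    (hz : z ∈ totCycles d (transfer B φ ψ) r)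
    (hy : totD b B r y = pert B φ ω r z) (z₁ : Tot Y (r + 1)) (y₁ : Tot X (r + 2)) (z₀ : Y r)
    (y₀ : X (r + 1)) (h1 : z - totD d (transfer B φ ψ) r z₁ = firstColumn (k := k) r z₀)
    (h2 : y - pert B φ ω (r + 1) z₁ - totD b B (r + 1) y₁ = firstColumn (k := k) (r + 1) y₀) :
    ∃ (z' : Tot Y (r + 1)) (y' : Tot X (r + 2)), totD d (transfer B φ ψ) r z' = z ∧
      y - pert B φ ω (r + 1) z' = totD b B (r + 1) y' := by
  have h3 : b r y₀ = φ r z₀ := by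
    refine firstColumn_injective (k := k) r ?_
    rw [← totD_firstColumn b B, ← h2, map_sub, map_sub, H.mixed.totD_totD, hy, ← H.pert_totD,
      sub_zero, ← map_sub, h1, pert_firstColumn]
  obtain ⟨y', x', h4, h5⟩ := H.exists_of_b_eq_of_cycle r y₀ z₀ (by
    rw [← h1]
    exact (totCycles d (transfer B φ ψ) r).sub_mem hz (H.totD_mem_totCycles r z₁)) h3
  refine ⟨z₁ + firstColumn (k := k) (r + 1) y', y₁ + firstColumn (k := k) (r + 2) x', ?_, ?_⟩
  · rw [map_add, totD_firstColumn, h4, ← h1]; abel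
  · rw [map_add, map_add, totD_firstColumn, ← h5, map_sub, ← h2, pert_firstColumn]; abel

theorem exists_zero (y : Tot X 0) : ∃ (z' : Tot Y 0) (y' : Tot X 1),
    y - pert B φ ω 0 z' = totD b B 0 y' := by
  obtain ⟨x, rfl⟩ := exists_firstColumn_of_lt_two (k := k) 0 (by omega) y
  refine ⟨firstColumn (k := k) 0 (ψ 0 x), firstColumn (k := k) 1 (ω 0 x), ?_⟩
  rw [pert_firstColumn, totD_firstColumn, H.homotopy_zero, map_sub]

/-- The mapping cone of the perturbed map is acyclic: by induction along the periodicity maps, from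
the acyclicity of the cone of `φ`. -/
theorem exists_succ (r : ℕ) (y : Tot X (r + 1)) (z : Tot Y r)
    (hz : z ∈ totCycles d (transfer B φ ψ) r) (hy : totD b B r y = pert B φ ω r z) :
    ∃ (z' : Tot Y (r + 1)) (y' : Tot X (r + 2)), totD d (transfer B φ ψ) r z' = z ∧
      y - pert B φ ω (r + 1) z' = totD b B (r + 1) y' := by
  induction r using Nat.twoStepInduction with
  | zero =>
    obtain ⟨z₀, h0⟩ := exists_firstColumn_of_lt_two (k := k) 0 (by omega) z
    obtain ⟨y₀, h1⟩ := exists_firstColumn_of_lt_two (k := k) 1 (by omega) y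
    exact H.exists_of_columns 0 y z hz hy 0 0 z₀ y₀ (by rw [map_zero, sub_zero, h0])
      (by rw [map_zero, map_zero, sub_zero, sub_zero, h1])
  | one =>
    obtain ⟨z₂, y₂, h2⟩ := H.exists_zero (periodicity (k := k) 0 y)
    obtain ⟨z₁, rfl⟩ := exists_periodicity_eq (k := k) 0 z₂
    obtain ⟨y₁, rfl⟩ := exists_periodicity_eq (k := k) 1 y₂
    obtain ⟨z₀, h0⟩ := exists_firstColumn_of_lt_two (k := k) 1 (by omega)
      (z - totD d (transfer B φ ψ) 1 z₁)
    obtain ⟨y₀, h1⟩ := exists_firstColumn_of_periodicity (k := k) 0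
      (y - pert B φ ω 2 z₁ - totD b B 2 y₁) (by
        rw [map_sub, map_sub, periodicity_totD, ← pert_periodicity, h2, sub_self])
    exact H.exists_of_columns 1 y z hz hy z₁ y₁ z₀ y₀ h0 h1
  | more r ih _ =>
    obtain ⟨z₂, y₂, h2, h3⟩ := ih (periodicity (k := k) (r + 1) y) (periodicity (k := k) r z)
      (by
        rcases r with _ | r
        · trivial
        · change totD d (transfer B φ ψ) r _ = 0
          rw [← periodicity_totD, show totD d (transfer B φ ψ) (r + 2) z = 0 from hz, map_zero])
      (by rw [← periodicity_totD, hy, pert_periodicity])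
    obtain ⟨z₁, rfl⟩ := exists_periodicity_eq (k := k) (r + 1) z₂
    obtain ⟨y₁, rfl⟩ := exists_periodicity_eq (k := k) (r + 2) y₂
    obtain ⟨z₀, h0⟩ := exists_firstColumn_of_periodicity (k := k) r
      (z - totD d (transfer B φ ψ) (r + 2) z₁) (by
        rw [map_sub, periodicity_totD, h2, sub_self])
    obtain ⟨y₀, h1⟩ := exists_firstColumn_of_periodicity (k := k) (r + 1)
      (y - pert B φ ω (r + 3) z₁ - totD b B (r + 3) y₁) (by
        rw [map_sub, map_sub, periodicity_totD, ← pert_periodicity, h3, sub_self])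
    exact H.exists_of_columns (r + 2) y z hz hy z₁ y₁ z₀ y₀ h0 h1

theorem pert_mem_totCycles (r : ℕ) (z : Tot Y r) (hz : z ∈ totCycles d (transfer B φ ψ) r) :
    pert B φ ω r z ∈ totCycles b B r := by
  rcases r with _ | r
  · trivial
  · change totD b B r _ = 0
    rw [← H.pert_totD, show totD d (transfer B φ ψ) r z = 0 from hz, map_zero]

theorem exists_equiv (r : ℕ) : ∃ e : HC d (transfer B φ ψ) r ≃ₗ[k] HC b B r,
    ∀ z : totCycles d (transfer B φ ψ) r, ∃ h : pert B φ ω r z ∈ totCycles b B r,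
      e (Submodule.Quotient.mk z) = Submodule.Quotient.mk ⟨pert B φ ω r z, h⟩ := by
  let G : totCycles d (transfer B φ ψ) r →ₗ[k] totCycles b B r :=
    (pert B φ ω r).restrict (H.pert_mem_totCycles r)
  have hG : (LinearMap.range (totD d (transfer B φ ψ) r)).submoduleOf
      (totCycles d (transfer B φ ψ) r) ≤
      ((LinearMap.range (totD b B r)).submoduleOf (totCycles b B r)).comap G := by
    rintro ⟨z, hz⟩ ⟨w, hw⟩
    exact ⟨pert B φ ω (r + 1) w, by rw [← H.pert_totD, hw]; rfl⟩
  have hbij : Bijective (Submodule.mapQ _ _ G hG) := by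
    constructor
    · rw [← LinearMap.ker_eq_bot, LinearMap.ker_eq_bot']
      intro q hq
      obtain ⟨⟨z, hz⟩, rfl⟩ := Submodule.Quotient.mk_surjective _ q
      obtain ⟨y, hy⟩ := (Submodule.Quotient.mk_eq_zero _).1 hq
      obtain ⟨z', _, h, _⟩ := H.exists_succ r y z hz hy
      exact (Submodule.Quotient.mk_eq_zero _).2 ⟨z', h⟩
    · intro q
      obtain ⟨⟨y, hy⟩, rfl⟩ := Submodule.Quotient.mk_surjective _ q
      obtain ⟨z, hz, y', h⟩ : ∃ z ∈ totCycles d (transfer B φ ψ) r, ∃ y',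
          y - pert B φ ω r z = totD b B r y' := by
        rcases r with _ | r
        · obtain ⟨z, y', h⟩ := H.exists_zero y
          exact ⟨z, trivial, y', h⟩
        · obtain ⟨z, y', h1, h2⟩ := H.exists_succ r y 0 (Submodule.zero_mem _) (by
            rw [map_zero]; exact hy)
          exact ⟨z, h1, y', h2⟩
      refine ⟨Submodule.Quotient.mk ⟨z, hz⟩, ((Submodule.Quotient.eq _).2 ?_).symm⟩
      exact ⟨y', h.symm⟩
  exact ⟨LinearEquiv.ofBijective _ hbij, fun z => ⟨H.pert_mem_totCycles r z z.2, rfl⟩⟩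

end IsRetract

end Perturbation
end MonogenicCyclic

namespace MonogenicCyclic

open scoped TensorProduct
open Function

/-! ### The contracting homotopy attached to a connection -/

section Connection

variable {k K A : Type*} [CommRing k] [Ring K] [Algebra k K] [Ring A] [Algebra k A]

/-- A multilinear map from a function which is linear in each variable. -/
def multilinearOfSlots {n : ℕ} {N : Type*} [AddCommGroup N] [Module k N] (F : (Fin n → A) → N)
    (h : ∀ a p, ∃ L : A →ₗ[k] N, ∀ v, F (update a p v) = L v) :
    MultilinearMap k (fun _ : Fin n => A) N where
  toFun := F
  map_update_add' := by
    intro inst a p x y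
    obtain rfl : inst = instDecidableEqFin n := Subsingleton.elim _ _
    obtain ⟨L, h⟩ := h a p
    simp only [h, map_add]
  map_update_smul' := by
    intro inst a p c x
    obtain rfl : inst = instDecidableEqFin n := Subsingleton.elim _ _
    obtain ⟨L, h⟩ := h a p
    simp only [h, map_smul]

namespace BarAlg

variable {ι : K →ₐ[k] A}

/-- A cochain `δ` of degree one on `A` with values in the part of degree two of the bar algebra,
which is `K`-bilinear, zero on `K`, and a primitive of the cochain `a ↦ a ε - ε a`. -/
structure IsConnection (δ : A →ₗ[k] BarAlg ι) : Prop where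
  sign_apply : ∀ a, sign ι (δ a) = δ a
  bar_apply : ∀ a, bar ι (δ a) = emb ι a * eps ι - eps ι * emb ι a
  apply_left : ∀ c a, δ (ι c * a) = emb ι (ι c) * δ a
  apply_right : ∀ a c, δ (a * ι c) = δ a * emb ι (ι c)
  apply_base : ∀ c, δ (ι c) = 0

/-- The coboundary of a cochain of degree one, i.e. its deviation from being a derivation. -/
noncomputable def curv (δ : A →ₗ[k] BarAlg ι) : A →ₗ[k] A →ₗ[k] BarAlg ι :=
  LinearMap.mk₂ k (fun a b => emb ι a * δ b - δ (a * b) + δ a * emb ι b)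
    (fun a a' b => by simp only [map_add, add_mul]; abel)
    (fun c a b => by simp only [map_smul, smul_mul_assoc, smul_add, smul_sub])
    (fun a b b' => by simp only [map_add, mul_add]; abel)
    (fun c a b => by simp only [map_smul, mul_smul_comm, smul_add, smul_sub])

theorem curv_apply (δ : A →ₗ[k] BarAlg ι) (a b : A) :
    curv δ a b = emb ι a * δ b - δ (a * b) + δ a * emb ι b := rfl

/-- The cochain `κ^m ε` in degree `2m` and `κ^m δ` in degree `2m + 1`, with `κ` the coboundary
of `δ`. -/
noncomputable def retr (δ : A →ₗ[k] BarAlg ι) : List A → BarAlg ι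
  | [] => eps ι
  | [a] => δ a
  | a :: b :: l => curv δ a b * retr δ l

/-- The cochain `-∑ retr(a₁, …, a_q) ε a_{q+1} ε ⋯ ε a_r ε`, the sum being over the odd `q ≤ r`. -/
noncomputable def homot (δ : A →ₗ[k] BarAlg ι) : List A → BarAlg ι
  | [] => 0
  | [a] => -(δ a * eps ι)
  | a :: b :: l => -(δ a * chain ι (b :: l)) + curv δ a b * homot δ l

/-- The part `∑_{j ≥ 1} (-1)^{j-1} F(…, a_j a_{j+1}, …) + (-1)^{r-1} F(a₁, …, a_{r-1}) a_r` of the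
bar coboundary, with `a₁` separated from the other entries. -/
noncomputable def tailCob (F : List A → BarAlg ι) : A → List A → BarAlg ι
  | a, [] => F [] * emb ι a
  | a, b :: l => F (a * b :: l) - tailCob (fun m => F (a :: m)) b l

/-- The bar coboundary
`a₁ F(a₂, …) + ∑_j (-1)^j F(…, a_j a_{j+1}, …) + (-1)^r F(a₁, …, a_{r-1}) a_r`. -/
noncomputable def cob (F : List A → BarAlg ι) : List A → BarAlg ι
  | [] => 0
  | a :: l => emb ι a * F l - tailCob F a l

theorem tailCob_mul_left (y : BarAlg ι) (F : List A → BarAlg ι) (a : A) (l : List A) :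
    tailCob (fun m => y * F m) a l = y * tailCob F a l := by
  induction l generalizing F a with
  | nil => rw [tailCob, tailCob, mul_assoc]
  | cons b l ih => rw [tailCob, tailCob, ih (fun m => F (a :: m)), mul_sub]

theorem tailCob_add (F G : List A → BarAlg ι) (a : A) (l : List A) :
    tailCob (fun m => F m + G m) a l = tailCob F a l + tailCob G a l := by
  induction l generalizing F G a with
  | nil => rw [tailCob, tailCob, tailCob, add_mul]
  | cons b l ih =>
    rw [tailCob, tailCob, tailCob, ih (fun m => F (a :: m)) (fun m => G (a :: m))]; abel

theorem bar_chain (a : A) (l : List A) :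
    bar ι (chain ι (a :: l)) = cob (chain ι) (a :: l) := by
  have key : ∀ (l : List A) (a : A), tailCob (chain ι) a l =
      eps ι * emb ι a * (if l = [] then 1 else bar ι (chain ι l)) := by
    intro l
    induction l with
    | nil => intro a; simp [tailCob, chain]
    | cons b l ih =>
      intro a
      have h : (fun m => chain ι (a :: m)) = fun m => eps ι * emb ι a * chain ι m := rfl
      rw [tailCob, h, tailCob_mul_left, ih, if_neg (List.cons_ne_nil _ _)]
      have h2 : bar ι (chain ι (b :: l)) = emb ι b * chain ι l -
          eps ι * emb ι b * (if l = [] then 1 else bar ι (chain ι l)) := by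
        rw [chain, mul_assoc, bar_eps_mul, bar_emb_mul, ← mul_assoc]
        split_ifs with h3
        · subst h3; simp [chain]
        · rfl
      rw [h2, mul_sub, chain, map_mul]
      simp only [mul_assoc]
  rw [cob, key, chain, mul_assoc, bar_eps_mul, bar_emb_mul, ← mul_assoc]
  congr 2
  split_ifs with h3
  · subst h3; simp [chain]
  · rfl

namespace IsConnection

variable {δ : A →ₗ[k] BarAlg ι} (hδ : IsConnection δ)

include hδ

theorem sign_curv (a b : A) : sign ι (curv δ a b) = curv δ a b := by
  simp only [curv_apply, map_add, map_sub, sign_mul, sign_emb, hδ.sign_apply]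

theorem bar_curv (a b : A) : bar ι (curv δ a b) = 0 := by
  simp only [curv_apply, map_add, map_sub, bar_mul, sign_emb, bar_emb, hδ.bar_apply,
    hδ.sign_apply, map_mul]
  noncomm_ring

omit hδ in
/-- `curv δ` is a coboundary, hence a cocycle. -/
theorem curv_cocycle (a b c : A) : emb ι a * curv δ b c - curv δ (a * b) c + curv δ a (b * c) =
    curv δ a b * emb ι c := by
  simp only [curv_apply, map_mul, mul_assoc]
  noncomm_ring

omit hδ in
theorem eps_mul_chain (l : List A) : eps ι * chain ι l = 0 := by
  rcases l with _ | ⟨a, l⟩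
  · exact eps_mul_eps ι
  · rw [chain, mul_assoc, ← mul_assoc, eps_mul_eps, zero_mul]

omit hδ in
theorem cob_homot (a b c : A) (l : List A) : cob (homot δ) (a :: b :: c :: l) =
    δ a * cob (chain ι) (b :: c :: l) - curv δ a b * chain ι (c :: l) +
      curv δ a b * cob (homot δ) (c :: l) := by
  have h : (fun m => homot δ (a :: b :: m)) =
      fun m => -δ a * chain ι (b :: m) + curv δ a b * homot δ m := by
    funext m; rw [homot, neg_mul]
  have h2 := curv_cocycle (δ := δ) a b c
  rw [sub_add, sub_eq_iff_eq_add] at h2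
  rw [cob, cob, cob, tailCob, tailCob, h, tailCob_add,
    tailCob_mul_left _ (fun m => chain ι (b :: m)), tailCob_mul_left, tailCob]
  generalize tailCob (fun m => chain ι (b :: m)) c l = y
  simp only [homot, mul_add, mul_sub, ← mul_assoc, h2, mul_neg, neg_mul, chain, map_mul]
  rw [curv_apply δ a b]
  noncomm_ring

/-- `homot` is a homotopy between the cochains `chain` and `retr`. -/
theorem bar_homot_add_cob (l : List A) :
    bar ι (homot δ l) + cob (homot δ) l = chain ι l - retr δ l := by
  have he : ∀ y : BarAlg ι, eps ι * (eps ι * y) = 0 := fun y => by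
    rw [← mul_assoc, eps_mul_eps, zero_mul]
  obtain ⟨n, hn⟩ : ∃ n, l.length = n := ⟨_, rfl⟩
  induction n using Nat.strong_induction_on generalizing l with
  | _ n ih =>
  match l, hn with
  | [], _ => simp [homot, cob, chain, retr]
  | [a], _ =>
    simp only [homot, cob, tailCob, chain, retr, map_neg, bar_mul, hδ.bar_apply, hδ.sign_apply,
      bar_eps, sub_mul, mul_assoc, eps_mul_eps]
    noncomm_ring
  | [a, b], _ =>
    have h := bar_chain (ι := ι) b []
    simp only [cob, tailCob, chain, mul_assoc] at h
    simp only [homot, cob, tailCob, chain, retr, map_neg, bar_mul (ι := ι) (δ a), hδ.bar_apply,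
      hδ.sign_apply, h, mul_zero, add_zero, curv_apply, sub_mul, mul_assoc, he]
    noncomm_ring
  | a :: b :: c :: l, hn =>
    have h := ih _ (by rw [← hn]; simp) (c :: l) rfl
    have h2 : eps ι * chain ι (b :: c :: l) = 0 := eps_mul_chain _
    have h3 : chain ι (a :: b :: c :: l) = eps ι * emb ι a * chain ι (b :: c :: l) := rfl
    rw [cob_homot, homot, map_add, map_neg, bar_mul, bar_mul, hδ.bar_apply, hδ.sign_apply,
      bar_chain, hδ.bar_curv, hδ.sign_curv, zero_mul, zero_add, sub_mul, mul_assoc (emb ι a), h2,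
      eq_sub_of_add_eq h, retr, h3]
    noncomm_ring

/-! #### The homotopy on Hochschild chains -/

omit hδ in
theorem exists_chain_set (l : List A) (p : ℕ) (hp : p < l.length) :
    ∃ L : A →ₗ[k] BarAlg ι, ∀ v, chain ι (l.set p v) = L v := by
  induction l generalizing p with
  | nil => simp at hp
  | cons a l ih =>
    rcases p with _ | p
    · refine ⟨LinearMap.mulLeft k (eps ι) ∘ₗ LinearMap.mulRight k (chain ι l) ∘ₗ
        (emb ι).toLinearMap, fun v => ?_⟩
      simp [chain, mul_assoc]
    · obtain ⟨L, hL⟩ := ih p (by simpa using hp)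
      refine ⟨LinearMap.mulLeft k (eps ι * emb ι a) ∘ₗ L, fun v => ?_⟩
      simp [chain, hL, mul_assoc]

omit hδ in
theorem exists_homot_set (l : List A) (p : ℕ) (hp : p < l.length) :
    ∃ L : A →ₗ[k] BarAlg ι, ∀ v, homot δ (l.set p v) = L v := by
  obtain ⟨n, hn⟩ : ∃ n, l.length = n := ⟨_, rfl⟩
  induction n using Nat.strong_induction_on generalizing l p with
  | _ n ih =>
  match l, hn with
  | [], _ => simp at hp
  | [a], _ =>
    obtain rfl : p = 0 := by simpa using hp
    refine ⟨-(LinearMap.mulRight k (eps ι) ∘ₗ δ), fun v => ?_⟩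
    simp [homot]
  | a :: b :: l, hn =>
    rcases p with _ | _ | p
    · refine ⟨-(LinearMap.mulRight k (chain ι (b :: l)) ∘ₗ δ) +
        LinearMap.mulRight k (homot δ l) ∘ₗ (curv δ).flip b, fun v => ?_⟩
      simp [homot]
    · obtain ⟨L, hL⟩ := exists_chain_set (ι := ι) (b :: l) 0 (by simp)
      refine ⟨-(LinearMap.mulLeft k (δ a) ∘ₗ L) +
        LinearMap.mulRight k (homot δ l) ∘ₗ curv δ a, fun v => ?_⟩
      have := hL v
      rw [List.set_cons_zero] at this
      simp [homot, this]
    · obtain ⟨L, hL⟩ := exists_chain_set (ι := ι) (b :: l) (p + 1) (by simpa using hp)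
      obtain ⟨L', hL'⟩ := ih _ (by rw [← hn]; simp) l p (by simpa using hp) rfl
      refine ⟨-(LinearMap.mulLeft k (δ a) ∘ₗ L) + LinearMap.mulLeft k (curv δ a b) ∘ₗ L',
        fun v => ?_⟩
      have := hL v
      rw [List.set_cons_succ] at this
      simp [homot, this, hL']

theorem curv_left (c : K) (a b : A) : curv δ (ι c * a) b = emb ι (ι c) * curv δ a b := by
  simp only [curv_apply, mul_assoc, hδ.apply_left, map_mul]
  noncomm_ring

theorem curv_right (c : K) (a b : A) : curv δ a (b * ι c) = curv δ a b * emb ι (ι c) := by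
  rw [curv_apply, curv_apply, ← mul_assoc a, hδ.apply_right, hδ.apply_right, map_mul (emb ι)]
  noncomm_ring

theorem curv_balanced (c : K) (a b : A) : curv δ (a * ι c) b = curv δ a (ι c * b) := by
  rw [curv_apply, curv_apply, hδ.apply_right, hδ.apply_left, map_mul (emb ι), map_mul (emb ι),
    mul_assoc a]
  noncomm_ring

theorem curv_base_left (c : K) (b : A) : curv δ (ι c) b = 0 := by
  rw [curv_apply, hδ.apply_left, hδ.apply_base]; simp

theorem curv_base_right (c : K) (a : A) : curv δ a (ι c) = 0 := by
  rw [curv_apply, hδ.apply_right, hδ.apply_base]; simp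

omit hδ in
theorem chain_left (c : K) (a : A) (l : List A) :
    chain ι (ι c * a :: l) = emb ι (ι c) * chain ι (a :: l) := by
  rw [chain, chain, map_mul, ← mul_assoc, eps_comm]
  simp only [mul_assoc]

theorem homot_left (c : K) (a : A) (l : List A) :
    homot δ (ι c * a :: l) = emb ι (ι c) * homot δ (a :: l) := by
  rcases l with _ | ⟨b, l⟩
  · rw [homot, homot, hδ.apply_left]; noncomm_ring
  · rw [homot, homot, hδ.apply_left, hδ.curv_left]; noncomm_ring

omit hδ in
theorem chain_balanced (l : List A) (p : ℕ) (hp : p < l.length) (c : K) :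
    chain ι (l.set p (l.getD p 0 * ι c)) = if p + 1 < l.length then
      chain ι (l.set (p + 1) (ι c * l.getD (p + 1) 0)) else chain ι l * emb ι (ι c) := by
  induction l generalizing p with
  | nil => simp at hp
  | cons a l ih =>
    rcases p with _ | p
    · rcases l with _ | ⟨b, l⟩
      · simp [chain, mul_assoc, eps_comm]
      · simp only [List.set_cons_zero, List.set_cons_succ, List.getD_cons_zero,
          List.getD_cons_succ, List.length_cons]
        rw [if_pos (by omega), chain, chain.eq_2 ι a, chain_left, map_mul]
        simp only [mul_assoc]
    · simp only [List.set_cons_succ, List.getD_cons_succ, List.length_cons,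
        Nat.add_lt_add_iff_right, chain]
      rw [ih p (by simpa using hp)]
      split_ifs <;> simp only [mul_assoc]

theorem homot_balanced (l : List A) (p : ℕ) (hp : p < l.length) (c : K) :
    homot δ (l.set p (l.getD p 0 * ι c)) = if p + 1 < l.length then
      homot δ (l.set (p + 1) (ι c * l.getD (p + 1) 0)) else homot δ l * emb ι (ι c) := by
  obtain ⟨n, hn⟩ : ∃ n, l.length = n := ⟨_, rfl⟩
  induction n using Nat.strong_induction_on generalizing l p with
  | _ n ih =>
  match l, hn with
  | [], _ => simp at hp
  | [a], _ =>
    obtain rfl : p = 0 := by simpa using hp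
    simp [homot, hδ.apply_right, mul_assoc, eps_comm]
  | a :: b :: l, hn =>
    rcases p with _ | _ | p
    · simp only [List.set_cons_zero, List.set_cons_succ, List.getD_cons_zero,
        List.getD_cons_succ, List.length_cons]
      rw [if_pos (by omega), homot, homot, hδ.apply_right, hδ.curv_balanced, chain_left]
      simp only [mul_assoc]
    · have h := chain_balanced (ι := ι) (b :: l) 0 (by simp) c
      simp only [List.set_cons_zero, List.set_cons_succ, List.getD_cons_zero,
        List.getD_cons_succ, List.length_cons] at h ⊢
      rw [homot, h, hδ.curv_right]
      rcases l with _ | ⟨d, l⟩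
      · simp [homot, mul_assoc]
      · rw [if_pos (by simp), if_pos (by simp)]
        simp only [List.set_cons_zero, List.getD_cons_zero, homot.eq_3]
        rw [hδ.homot_left]
        simp only [mul_assoc]
    · have h := chain_balanced (ι := ι) (b :: l) (p + 1) (by simpa using hp) c
      have h' := ih _ (by rw [← hn]; simp) l p (by simpa using hp) rfl
      simp only [List.set_cons_succ, List.getD_cons_succ, List.length_cons,
        Nat.add_lt_add_iff_right, homot] at h h' ⊢
      rw [h, h']
      split_ifs <;> noncomm_ring

omit hδ in
theorem chain_eq_zero (l : List A) (c : K) (hc : ι c ∈ l) : chain ι l = 0 := by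
  induction l with
  | nil => simp at hc
  | cons a l ih =>
    rcases List.mem_cons.1 hc with rfl | h
    · rw [chain, eps_comm, mul_assoc, eps_mul_chain, mul_zero]
    · rw [chain, ih h, mul_zero]

theorem homot_eq_zero (l : List A) (c : K) (hc : ι c ∈ l) : homot δ l = 0 := by
  obtain ⟨n, hn⟩ : ∃ n, l.length = n := ⟨_, rfl⟩
  induction n using Nat.strong_induction_on generalizing l with
  | _ n ih =>
  match l, hn with
  | [], _ => simp at hc
  | [a], _ =>
    obtain rfl : ι c = a := by simpa using hc
    simp [homot, hδ.apply_base]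
  | a :: b :: l, hn =>
    rcases List.mem_cons.1 hc with rfl | h
    · simp [homot, hδ.apply_base, hδ.curv_base_left]
    · rw [homot, chain_eq_zero _ c h]
      rcases List.mem_cons.1 h with rfl | h
      · simp [hδ.curv_base_right]
      · rw [ih _ (by rw [← hn]; simp) l h rfl]; simp

omit hδ in
theorem ofFn_update_succ {A : Type*} {r : ℕ} (a : Fin (r + 1) → A) (p : Fin r) (v : A) :
    (List.ofFn fun j : Fin r => update a p.succ v j.succ) =
      (List.ofFn fun j : Fin r => a j.succ).set p v := by
  refine List.ext_getElem (by simp) fun j h1 h2 => ?_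
  rw [List.getElem_set, List.getElem_ofFn, List.getElem_ofFn]
  simp [update_apply, Fin.ext_iff, eq_comm]

omit hδ in
theorem ofFn_update_zero {A : Type*} {r : ℕ} (a : Fin (r + 1) → A) (v : A) :
    (List.ofFn fun j : Fin r => update a 0 v j.succ) = List.ofFn fun j : Fin r => a j.succ := by
  simp

omit hδ in
theorem getD_ofFn {r : ℕ} (a : Fin (r + 1) → A) (p : Fin r) :
    (List.ofFn fun j : Fin r => a j.succ).getD p 0 = a p.succ := by
  rw [List.getD_eq_getElem _ _ (by simp), List.getElem_ofFn]

variable (δ) in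
omit hδ in
/-- The value of the homotopy on a tensor. -/
noncomputable def homotMulti (r : ℕ) :
    MultilinearMap k (fun _ : Fin (r + 1) => A) (HochX ι (r + 1)) :=
  multilinearOfSlots (fun a => trace ι (r + 1)
      (emb ι (a 0) * homot δ (List.ofFn fun j : Fin r => a j.succ))) (fun a p => by
    refine Fin.cases ?_ (fun p => ?_) p
    · refine ⟨trace ι (r + 1) ∘ₗ LinearMap.mulRight k
        (homot δ (List.ofFn fun j : Fin r => a j.succ)) ∘ₗ (emb ι).toLinearMap, fun v => ?_⟩
      rw [ofFn_update_zero]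
      simp
    · obtain ⟨L, hL⟩ := exists_homot_set (δ := δ) (List.ofFn fun j : Fin r => a j.succ) p (by simp)
      refine ⟨trace ι (r + 1) ∘ₗ LinearMap.mulLeft k (emb ι (a 0)) ∘ₗ L, fun v => ?_⟩
      rw [ofFn_update_succ, hL]
      simp [(Fin.succ_ne_zero _).symm])

omit hδ in
theorem homotMulti_apply (r : ℕ) (a : Fin (r + 1) → A) : homotMulti δ r a = trace ι (r + 1)
    (emb ι (a 0) * homot δ (List.ofFn fun j : Fin r => a j.succ)) := rfl

theorem homotMulti_balanced (r : ℕ) (a : Fin (r + 1) → A) (i : Fin (r + 1)) (c : K) :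
    homotMulti δ r (update a i (a i * ι c)) =
      homotMulti δ r (update a (i + 1) (ι c * a (i + 1))) := by
  rw [homotMulti_apply, homotMulti_apply]
  refine Fin.cases ?_ (fun p => ?_) i
  · rcases r with _ | r
    · simp [homot]
    · have h1 : (0 : Fin (r + 2)) + 1 = (0 : Fin (r + 1)).succ := by simp
      rw [h1, ofFn_update_zero, ofFn_update_succ]
      simp only [List.ofFn_succ, Fin.val_zero, List.set_cons_zero, hδ.homot_left]
      simp [mul_assoc]
  · rw [ofFn_update_succ]
    have h := hδ.homot_balanced (List.ofFn fun j : Fin r => a j.succ) p (by simp) c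
    rw [getD_ofFn] at h
    rw [h]
    have h0 : ∀ (q : Fin r) v, update a q.succ v 0 = a 0 := fun q v =>
      update_of_ne (Fin.succ_ne_zero q).symm _ _
    rw [h0]
    by_cases hp : (p : ℕ) + 1 < r
    · have h1 : p.succ + 1 = (⟨p + 1, hp⟩ : Fin r).succ := by
        ext
        rw [val_succ_cyc, Fin.val_succ, Fin.val_succ, if_neg (by omega)]
      rw [h1, ofFn_update_succ, h0, if_pos (by simpa using hp)]
      have h2 := getD_ofFn a (⟨p + 1, hp⟩ : Fin r)
      dsimp only at h2
      rw [h2]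
    · have h1 : p.succ + 1 = (0 : Fin (r + 1)) := by
        ext
        rw [val_succ_cyc, Fin.val_succ, if_pos (by omega), Fin.val_zero]
      rw [h1, ofFn_update_zero, if_neg (by simpa using hp), ← mul_assoc, trace_comm, update_self,
        map_mul (emb ι), mul_assoc]

/-- The contracting homotopy `[a₀ ⊗ ⋯ ⊗ a_r] ↦ [a₀ homot(a₁, …, a_r)]` on Hochschild chains. -/
noncomputable def omega (r : ℕ) : HochX ι r →ₗ[k] HochX ι (r + 1) :=
  hochLift ι (homotMulti δ r) (hδ.homotMulti_balanced r) (fun a i c hi ha => by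
    obtain ⟨p, rfl⟩ := Fin.exists_succ_eq.2 hi
    rw [homotMulti_apply, hδ.homot_eq_zero _ c, mul_zero, map_zero]
    exact List.mem_ofFn.2 ⟨p, ha⟩)

theorem omega_trace (r : ℕ) (a : A) (l : List A) (hl : l.length = r) :
    hδ.omega r (trace ι r (emb ι a * chain ι l)) = trace ι (r + 1) (emb ι a * homot δ l) := by
  subst hl
  rw [trace_chain _ _ _ _ rfl, omega, hochLift_cls, homotMulti_apply]
  congr 3
  refine List.ext_getElem (by simp) fun j h1 h2 => ?_
  rw [List.getElem_ofFn]
  simp [List.getElem?_eq_getElem h2]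

theorem omega_tailCob (r : ℕ) (a x : A) (p l : List A) (hl : p.length + l.length = r) :
    hδ.omega r (trace ι r (emb ι a * tailCob (fun m => chain ι (p ++ m)) x l)) =
      trace ι (r + 1) (emb ι a * tailCob (fun m => homot δ (p ++ m)) x l) := by
  induction l generalizing p x with
  | nil =>
    rw [tailCob, tailCob, ← mul_assoc, ← mul_assoc, trace_comm, trace_comm, ← mul_assoc,
      ← mul_assoc, ← map_mul, hδ.omega_trace _ _ _ (by simpa using hl)]
  | cons b l ih =>
    have h := ih b (p ++ [x]) (by rw [← hl]; simp; omega)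
    simp only [List.append_assoc, List.singleton_append] at h
    rw [tailCob, tailCob, mul_sub, mul_sub, map_sub, map_sub, map_sub, h,
      hδ.omega_trace _ _ _ (by simpa using hl)]

theorem omega_cob (r : ℕ) (a : A) (l : List A) (hl : l.length = r + 1) :
    hδ.omega r (trace ι r (emb ι a * cob (chain ι) l)) =
      trace ι (r + 1) (emb ι a * cob (homot δ) l) := by
  rcases l with _ | ⟨x, l⟩
  · simp at hl
  · have hl : l.length = r := by simpa using hl
    have h := hδ.omega_tailCob r a x [] l (by simpa using hl)
    simp only [List.nil_append] at h
    rw [cob, cob, mul_sub, mul_sub, map_sub, map_sub, map_sub, h, ← mul_assoc, ← mul_assoc,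
      ← map_mul, hδ.omega_trace _ _ _ hl]

/-- If `P` is the map of Hochschild chains induced by `retr`, then `b ω + ω b = 1 - P`. -/
theorem homotopy_succ (r : ℕ) (P : HochX ι (r + 1) →ₗ[k] HochX ι (r + 1)) (a : A) (l : List A)
    (hl : l.length = r + 1)
    (hP : P (trace ι (r + 1) (emb ι a * chain ι l)) = trace ι (r + 1) (emb ι a * retr δ l)) :
    hochB ι (r + 1) (hδ.omega (r + 1) (trace ι (r + 1) (emb ι a * chain ι l))) +
      hδ.omega r (hochB ι r (trace ι (r + 1) (emb ι a * chain ι l))) =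
    trace ι (r + 1) (emb ι a * chain ι l) - P (trace ι (r + 1) (emb ι a * chain ι l)) := by
  have h : bar ι (chain ι l) = cob (chain ι) l := by
    rcases l with _ | ⟨x, l⟩
    · simp at hl
    · exact bar_chain x l
  rw [hδ.omega_trace _ _ _ hl, ← trace_bar, ← trace_bar, bar_emb_mul, bar_emb_mul, h,
    hδ.omega_cob _ _ _ hl, ← map_add, ← mul_add, hδ.bar_homot_add_cob, hP, mul_sub, map_sub]

theorem omega_zero : hδ.omega 0 = 0 := by
  refine hochX_ext_trace ι fun a l hl => ?_
  obtain rfl := List.eq_nil_of_length_eq_zero hl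
  rw [hδ.omega_trace 0 a [] rfl]
  simp [homot]

end IsConnection
end BarAlg
end Connection
end MonogenicCyclic

namespace MonogenicCyclic

open scoped TensorProduct
open Function

/-! ### The connection of a monogenic extension -/

namespace MonogenicData

open BarAlg

variable {k K : Type*} [CommRing k] [Ring K] [Algebra k K] (D : MonogenicData k K)

/-- The inclusion of `K` in the bar algebra of `A`. -/
noncomputable def cst : K →ₐ[k] BarAlg D.incl := (emb D.incl).comp D.incl

/-- The class of `x` in the bar algebra. -/
noncomputable def barGen : BarAlg D.incl := emb D.incl D.gen

/-- The element `ε x ε` of the bar algebra. -/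
noncomputable def epsGen : BarAlg D.incl := eps D.incl * D.barGen * eps D.incl

/-- `∑_{l < i} x^{i-l-1} (ε x ε) x^l`, the value at `x^i` of the derivation with `x ↦ ε x ε`. -/
noncomputable def powDer : ℕ → BarAlg D.incl
  | 0 => 0
  | i + 1 => D.barGen ^ i * D.epsGen + powDer i * D.barGen

theorem emb_incl (c : K) : emb D.incl (D.incl c) = D.cst c := rfl

theorem emb_gen : emb D.incl D.gen = D.barGen := rfl

theorem eps_cst (c : K) : eps D.incl * D.cst c = D.cst c * eps D.incl := eps_comm D.incl c

theorem barGen_pow_cst (i : ℕ) (c : K) :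
    D.barGen ^ i * D.cst c = D.cst ((D.alpha ^ i) c) * D.barGen ^ i := by
  rw [← emb_gen, ← map_pow, ← emb_incl, ← emb_incl, ← map_mul, ← map_mul, gen_pow_mul_incl]

theorem barGen_cst (c : K) : D.barGen * D.cst c = D.cst (D.alpha c) * D.barGen := by
  simpa using D.barGen_pow_cst 1 c

theorem epsGen_cst (c : K) : D.epsGen * D.cst c = D.cst (D.alpha c) * D.epsGen := by
  rw [epsGen, mul_assoc, eps_cst, mul_assoc, ← mul_assoc D.barGen, barGen_cst, ← mul_assoc,
    ← mul_assoc, eps_cst]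
  simp only [mul_assoc]

theorem powDer_cst (i : ℕ) (c : K) :
    D.powDer i * D.cst c = D.cst ((D.alpha ^ i) c) * D.powDer i := by
  induction i generalizing c with
  | zero => simp [powDer]
  | succ i ih =>
    have h : (D.alpha ^ (i + 1)) c = (D.alpha ^ i) (D.alpha c) := by
      rw [pow_succ, AlgHom.mul_apply]
    rw [powDer, add_mul, mul_assoc, mul_assoc, epsGen_cst, barGen_cst, ← mul_assoc, ← mul_assoc,
      barGen_pow_cst, ih, h, mul_add, mul_assoc, mul_assoc]

theorem powDer_add (i j : ℕ) :
    D.powDer (i + j) = D.barGen ^ i * D.powDer j + D.powDer i * D.barGen ^ j := by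
  induction j with
  | zero => simp [powDer]
  | succ j ih =>
    rw [← add_assoc, powDer, ih, powDer, pow_succ, pow_add]
    noncomm_ring

theorem powDer_eq_sum (i : ℕ) :
    D.powDer i = ∑ l ∈ Finset.range i, D.barGen ^ (i - l - 1) * D.epsGen * D.barGen ^ l := by
  induction i with
  | zero => simp [powDer]
  | succ i ih =>
    rw [powDer, ih, Finset.sum_range_succ', add_comm, Finset.sum_mul]
    congr 1
    · refine Finset.sum_congr rfl fun l _ => ?_
      rw [show i + 1 - (l + 1) - 1 = i - l - 1 by omega, pow_succ]
      simp only [mul_assoc]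
    · simp

theorem powDer_eq_sum' (i : ℕ) :
    D.powDer i = ∑ l ∈ Finset.range i, D.barGen ^ l * D.epsGen * D.barGen ^ (i - l - 1) := by
  rw [powDer_eq_sum, ← Finset.sum_range_reflect]
  refine Finset.sum_congr rfl fun l hl => ?_
  rw [Finset.mem_range] at hl
  rw [show i - (i - 1 - l) - 1 = l by omega, show i - 1 - l = i - l - 1 by omega]

theorem sign_epsGen : sign D.incl D.epsGen = D.epsGen := by
  simp [epsGen, barGen, BarAlg.sign_mul]

theorem bar_epsGen : BarAlg.bar D.incl D.epsGen = D.barGen * eps D.incl - eps D.incl * D.barGen := by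
  simp [epsGen, barGen, bar_mul, BarAlg.sign_mul]
  noncomm_ring

theorem sign_barGen_pow (i : ℕ) : sign D.incl (D.barGen ^ i) = D.barGen ^ i := by
  rw [barGen, ← map_pow, sign_emb]

theorem bar_barGen_pow (i : ℕ) : BarAlg.bar D.incl (D.barGen ^ i) = 0 := by
  rw [barGen, ← map_pow, bar_emb]

theorem sign_powDer (i : ℕ) : sign D.incl (D.powDer i) = D.powDer i := by
  rw [powDer_eq_sum, map_sum]
  simp only [BarAlg.sign_mul, sign_epsGen, sign_barGen_pow]

theorem bar_powDer (i : ℕ) : BarAlg.bar D.incl (D.powDer i) =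
    D.barGen ^ i * eps D.incl - eps D.incl * D.barGen ^ i := by
  induction i with
  | zero => simp [powDer]
  | succ i ih =>
    have h1 : BarAlg.bar D.incl D.barGen = 0 := by simpa using D.bar_barGen_pow 1
    rw [powDer, map_add, bar_mul, bar_mul, ih, bar_epsGen, bar_barGen_pow, sign_barGen_pow, h1,
      pow_succ]
    noncomm_ring

/-- The derivation of the Ore extension `B`, with values in the bar algebra of `A`, which is zero on
`K` and maps `x` to `ε x ε`. -/
noncomputable def oreDer : D.Ore →+ BarAlg D.incl :=
  SkewMonoidAlgebra.liftNC (k := K) (G := Multiplicative ℕ) (D.cst : K →+ BarAlg D.incl)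
    (fun i => D.powDer i.toAdd)

theorem oreDer_mon (i : ℕ) (c : K) : D.oreDer (D.mon i c) = D.cst c * D.powDer i :=
  SkewMonoidAlgebra.liftNC_single _ _ _ _

theorem emb_mon (i : ℕ) (c : K) : emb D.incl (D.proj (D.mon i c)) = D.cst c * D.barGen ^ i := by
  have h : D.mon i c = D.mon 0 c * D.mon i 1 := by rw [mon_mul_mon]; simp
  rw [h, map_mul, map_mul, ← gen_pow, map_pow]
  rfl

theorem oreDer_mul (P Q : D.Ore) : D.oreDer (P * Q) =
    emb D.incl (D.proj P) * D.oreDer Q + D.oreDer P * emb D.incl (D.proj Q) := by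
  refine D.ore_induction (p := fun P => D.oreDer (P * Q) =
    emb D.incl (D.proj P) * D.oreDer Q + D.oreDer P * emb D.incl (D.proj Q)) P (by simp)
    (fun i a => ?_) (fun P P' h h' => ?_)
  · refine D.ore_induction (p := fun Q => D.oreDer (D.mon i a * Q) =
      emb D.incl (D.proj (D.mon i a)) * D.oreDer Q +
        D.oreDer (D.mon i a) * emb D.incl (D.proj Q)) Q (by simp) (fun j c => ?_)
        (fun Q Q' h h' => ?_)
    · rw [mon_mul_mon, oreDer_mon, oreDer_mon, oreDer_mon, emb_mon, emb_mon, powDer_add, map_mul,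
        mul_assoc (D.cst a), mul_assoc (D.cst a), ← mul_assoc (D.barGen ^ i), barGen_pow_cst,
        mul_assoc (D.cst a), ← mul_assoc (D.powDer i), powDer_cst]
      noncomm_ring
    · rw [mul_add, map_add, h, h', map_add, map_add, map_add]
      noncomm_ring
  · rw [add_mul, map_add, h, h', map_add, map_add, map_add]
    noncomm_ring

theorem bar_oreDer (P : D.Ore) : BarAlg.bar D.incl (D.oreDer P) =
    emb D.incl (D.proj P) * eps D.incl - eps D.incl * emb D.incl (D.proj P) := by
  refine D.ore_induction (p := fun P => BarAlg.bar D.incl (D.oreDer P) =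
    emb D.incl (D.proj P) * eps D.incl - eps D.incl * emb D.incl (D.proj P)) P (by simp)
    (fun i a => ?_) (fun P P' h h' => ?_)
  · rw [oreDer_mon, emb_mon, ← emb_incl, bar_emb_mul, bar_powDer, emb_incl, ← mul_assoc (eps _),
      eps_cst, mul_sub, mul_assoc, mul_assoc]
  · rw [map_add, map_add, h, h', map_add, map_add]
    noncomm_ring

theorem sign_oreDer (P : D.Ore) : sign D.incl (D.oreDer P) = D.oreDer P := by
  refine D.ore_induction (p := fun P => sign D.incl (D.oreDer P) = D.oreDer P) P (by simp)
    (fun i a => ?_) (fun P P' h h' => ?_)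
  · rw [oreDer_mon, ← emb_incl, BarAlg.sign_mul, sign_emb, sign_powDer]
  · rw [map_add, map_add, h, h']

theorem eq_sum_mon (P : D.Ore) (N : ℕ) (h : ∀ i, N ≤ i → D.coeff i P = 0) :
    P = ∑ i ∈ Finset.range N, D.mon i (D.coeff i P) := by
  refine D.ore_ext fun j => ?_
  rw [map_sum]
  simp only [coeff_mon]
  rw [Finset.sum_ite_eq']
  split_ifs with hj
  · rfl
  · exact h j (by simpa using hj)

/-- The connection on `A` whose value at `x^i`, for `i < n`, is `∑_{l < i} x^{i-l-1} (ε x ε) x^l`. -/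
noncomputable def conn : D.Ext →ₗ[k] BarAlg D.incl :=
  ∑ i ∈ Finset.range D.n, LinearMap.mulRight k (D.powDer i) ∘ₗ D.cst.toLinearMap ∘ₗ D.coord i

theorem conn_apply (a : D.Ext) :
    D.conn a = ∑ i ∈ Finset.range D.n, D.cst (D.coord i a) * D.powDer i := by
  simp [conn]

theorem conn_proj (P : D.Ore) : D.conn (D.proj P) = D.oreDer (D.rem P) := by
  rw [conn_apply, D.eq_sum_mon (D.rem P) D.n (D.coeff_rem P), map_sum]
  refine Finset.sum_congr rfl fun i hi => ?_
  rw [oreDer_mon, coord_proj]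

theorem eq_sum_coord (a : D.Ext) :
    a = ∑ i ∈ Finset.range D.n, D.incl (D.coord i a) * D.gen ^ i := by
  obtain ⟨P, rfl⟩ := D.proj_surjective a
  conv_lhs => rw [← D.proj_rem, D.eq_sum_mon (D.rem P) D.n (D.coeff_rem P), map_sum]
  refine Finset.sum_congr rfl fun i hi => ?_
  rw [coord_proj, gen_pow, incl_eq, ← map_mul, mon_mul_mon]
  simp

theorem conn_isConnection : IsConnection D.conn where
  sign_apply a := by
    obtain ⟨P, rfl⟩ := D.proj_surjective a
    rw [conn_proj, sign_oreDer]
  bar_apply a := by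
    obtain ⟨P, rfl⟩ := D.proj_surjective a
    rw [conn_proj, bar_oreDer, proj_rem]
  apply_left c a := by
    simp only [conn_apply, coord_incl_mul, map_mul, Finset.mul_sum, emb_incl, mul_assoc]
  apply_right a c := by
    simp only [conn_apply, coord_mul_incl, map_mul, Finset.sum_mul, emb_incl, mul_assoc,
      powDer_cst]
  apply_base c := by
    rw [conn_apply]
    refine Finset.sum_eq_zero fun i _ => ?_
    rcases i with _ | i
    · simp [powDer]
    · rw [coord_incl _ _ (by omega), map_zero, zero_mul]

theorem conn_gen_pow (i : ℕ) (hi : i < D.n) : D.conn (D.gen ^ i) = D.powDer i := by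
  rw [conn_apply, Finset.sum_eq_single i]
  · rw [coord_gen_pow _ _ _ hi, if_pos rfl, map_one, one_mul]
  · intro j _ hj
    rw [coord_gen_pow _ _ _ hi, if_neg hj.symm, map_zero, zero_mul]
  · intro h
    exact absurd (Finset.mem_range.2 hi) h

/-- The image of `f` under the derivation, `∑_{i=1}^n ∑_{l < i} λ_{n-i} x^{i-l-1} (ε x ε) x^l`. -/
noncomputable def kappa : BarAlg D.incl := D.oreDer D.f

theorem proj_f : D.proj D.f = 0 :=
  Ideal.Quotient.eq_zero_iff_mem.2 (TwoSidedIdeal.mem_asIdeal.2 (TwoSidedIdeal.subset_span rfl))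

theorem sign_kappa : sign D.incl D.kappa = D.kappa := D.sign_oreDer _

theorem bar_kappa : BarAlg.bar D.incl D.kappa = 0 := by
  rw [kappa, bar_oreDer, proj_f, map_zero, zero_mul, mul_zero, sub_zero]

theorem kappa_comm {P Q : D.Ore} (h : D.f * P = Q * D.f) :
    D.kappa * emb D.incl (D.proj P) = emb D.incl (D.proj Q) * D.kappa := by
  have h := congrArg D.oreDer h
  rwa [oreDer_mul, oreDer_mul, proj_f, map_zero, zero_mul, zero_add, mul_zero, add_zero] at h

theorem kappa_barGen : D.kappa * D.barGen = D.barGen * D.kappa :=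
  D.kappa_comm (P := D.mon 1 1) (Q := D.mon 1 1) (by rw [f_mul_mon, map_one])

theorem kappa_cst (c : K) : D.kappa * D.cst c = D.cst ((D.alpha ^ D.n) c) * D.kappa :=
  D.kappa_comm (P := D.mon 0 c) (Q := D.mon 0 _) (D.f_mul_mon 0 c)

theorem kappa_eq_sum : D.kappa = ∑ i ∈ Finset.Icc 1 D.n, D.cst (D.lam (D.n - i)) * D.powDer i := by
  rw [kappa, f, map_sum]
  simp only [oreDer_mon]
  rw [Finset.sum_range_succ, Nat.sub_self, powDer, mul_zero, add_zero,
    ← Finset.sum_range_reflect, ← Finset.Ico_add_one_right_eq_Icc, Finset.sum_Ico_eq_sum_range]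
  refine Finset.sum_congr (by simp) fun i hi => ?_
  rw [Finset.mem_range] at hi
  rw [show D.n - (D.n - 1 - i) = 1 + i by omega, show D.n - 1 - i = D.n - (1 + i) by omega]

/-- The curvature of the connection measures the failure of the remainder modulo `f` to be
multiplicative, since `conn` is the restriction of a derivation to the remainders. -/
theorem curv_conn {P Q : D.Ore} (hP : D.rem P = P) (hQ : D.rem Q = Q) :
    curv D.conn (D.proj P) (D.proj Q) = emb D.incl (D.proj (D.quot (P * Q))) * D.kappa := by
  have h : D.quot (P * Q) * D.f = P * Q - D.rem (P * Q) := by rw [rem]; abel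
  have h2 := D.oreDer_mul (D.quot (P * Q)) D.f
  rw [proj_f, map_zero, mul_zero, add_zero] at h2
  rw [kappa, ← h2, h, map_sub, oreDer_mul, curv_apply, ← map_mul D.proj, conn_proj, conn_proj,
    conn_proj, hP, hQ]
  abel

theorem rem_mon_one (i : ℕ) (hi : i < D.n) : D.rem (D.mon i 1) = D.mon i 1 := by
  refine D.rem_small _ fun t ht => ?_
  rw [coeff_mon, if_neg (by omega)]

theorem curv_gen_pow (i j : ℕ) (hi : i < D.n) (hj : j < D.n) :
    curv D.conn (D.gen ^ i) (D.gen ^ j) = emb D.incl (D.bar (i + j)) * D.kappa := by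
  rw [gen_pow, gen_pow, D.curv_conn (D.rem_mon_one i hi) (D.rem_mon_one j hj), mon_mul_mon, bar]
  simp

/-- The endomorphism `∑ cᵢ xⁱ ↦ ∑ α(cᵢ) xⁱ` of the additive group of `B`. -/
noncomputable def oreAlpha : D.Ore →+ D.Ore :=
  SkewMonoidAlgebra.liftNC (k := K) (G := Multiplicative ℕ) (R := D.Ore)
    { toFun := fun c => D.mon 0 (D.alpha c)
      map_zero' := by rw [map_zero, mon_zero]
      map_add' := fun a c => by rw [map_add, mon_add] }
    (fun i => D.mon i.toAdd 1)

theorem oreAlpha_mon (i : ℕ) (c : K) : D.oreAlpha (D.mon i c) = D.mon i (D.alpha c) := by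
  have h : D.oreAlpha (D.mon i c) = D.mon 0 (D.alpha c) * D.mon i 1 :=
    SkewMonoidAlgebra.liftNC_single _ _ _ _
  rw [h, mon_mul_mon]
  simp

theorem coeff_oreAlpha (i : ℕ) (P : D.Ore) : D.coeff i (D.oreAlpha P) = D.alpha (D.coeff i P) := by
  refine D.ore_induction (p := fun P => D.coeff i (D.oreAlpha P) = D.alpha (D.coeff i P)) P
    (by simp) (fun j a => ?_) (fun P Q hP hQ => by rw [map_add, map_add, hP, hQ, map_add, map_add])
  rw [oreAlpha_mon, coeff_mon, coeff_mon]
  split_ifs <;> simp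

theorem oreAlpha_mul (P Q : D.Ore) : D.oreAlpha (P * Q) = D.oreAlpha P * D.oreAlpha Q := by
  refine D.ore_induction (p := fun P => D.oreAlpha (P * Q) = D.oreAlpha P * D.oreAlpha Q) P
    (by simp) (fun i a => ?_) (fun P P' h h' => by rw [add_mul, map_add, h, h', map_add, add_mul])
  refine D.ore_induction
    (p := fun Q => D.oreAlpha (D.mon i a * Q) = D.oreAlpha (D.mon i a) * D.oreAlpha Q) Q
    (by simp) (fun j c => ?_) (fun Q Q' h h' => by rw [mul_add, map_add, h, h', map_add, mul_add])
  have h : D.alpha ((D.alpha ^ i) c) = (D.alpha ^ i) (D.alpha c) := by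
    rw [← AlgHom.mul_apply, ← AlgHom.mul_apply, ← pow_succ, ← pow_succ']
  rw [mon_mul_mon, oreAlpha_mon, oreAlpha_mon, oreAlpha_mon, mon_mul_mon, map_mul, h]

theorem oreAlpha_f : D.oreAlpha D.f = D.f := by
  rw [f, map_sum]
  refine Finset.sum_congr rfl fun i hi => ?_
  rw [oreAlpha_mon]
  congr 1
  simpa using D.pow_alpha_lam 1 i (by simpa [Nat.lt_succ_iff] using hi)

theorem oreAlpha_quot (P : D.Ore) : D.oreAlpha (D.quot P) = D.quot (D.oreAlpha P) := by
  refine (D.quot_eq _ _ fun i hi => ?_).symm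
  have h : D.oreAlpha (D.quot P) * D.f = D.oreAlpha (D.quot P * D.f) := by
    rw [oreAlpha_mul, oreAlpha_f]
  rw [h, ← map_sub, coeff_oreAlpha]
  exact (congrArg _ (D.coeff_rem P i hi)).trans (map_zero _)

theorem f_mul_eq (P : D.Ore) : D.f * P = D.oreAlpha^[D.n] P * D.f := by
  have h : ∀ (m i : ℕ) (c : K), D.oreAlpha^[m] (D.mon i c) = D.mon i ((D.alpha ^ m) c) := by
    intro m
    induction m with
    | zero => simp
    | succ m ih => intro i c; rw [iterate_succ_apply, oreAlpha_mon, ih, pow_succ, AlgHom.mul_apply]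
  refine D.ore_induction (p := fun P => D.f * P = D.oreAlpha^[D.n] P * D.f) P (by simp)
    (fun i a => ?_) (fun P Q hP hQ => ?_)
  · rw [h, f_mul_mon]
  · rw [iterate_map_add, mul_add, hP, hQ, add_mul]

/-- `κ` commutes with the quotients of the powers of `x` by `f`, as these have coefficients fixed
by `α`. -/
theorem kappa_bar (s : ℕ) :
    D.kappa * emb D.incl (D.bar s) = emb D.incl (D.bar s) * D.kappa := by
  refine D.kappa_comm ?_
  rw [f_mul_eq]
  have h : D.oreAlpha (D.quot (D.mon s 1)) = D.quot (D.mon s 1) := by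
    rw [oreAlpha_quot, oreAlpha_mon, map_one]
  rw [iterate_fixed h]

/-! ### The comparison maps in terms of the bar algebra -/

/-- The last factor of the cochain of degree `r` defining `φ_r`: `ε` for `r` even and `ε x ε` for `r`
odd. -/
noncomputable def tail (r : ℕ) : BarAlg D.incl := if r % 2 = 0 then eps D.incl else D.epsGen

/-- The product `(ε x ε) x^{l_m} ⋯ (ε x ε) x^{l_1}`. -/
noncomputable def block (l : List ℕ) : BarAlg D.incl :=
  (l.reverse.map fun j => D.epsGen * D.barGen ^ j).prod

theorem alpha_pow_lam_prod (j m : ℕ) (i : Fin m → ℕ) :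
    (D.alpha ^ j) (List.ofFn fun t => D.lam (D.n - i t)).prod =
      (List.ofFn fun t => D.lam (D.n - i t)).prod := by
  induction m with
  | zero => simp
  | succ m ih => rw [List.ofFn_succ, List.prod_cons, map_mul, ih, D.pow_alpha_lam _ _ (Nat.sub_le _ _)]

theorem kappa_pow_barGen_pow (m i : ℕ) :
    D.kappa ^ m * D.barGen ^ i = D.barGen ^ i * D.kappa ^ m :=
  Commute.pow_pow D.kappa_barGen m i

theorem kappa_pow_cst (m : ℕ) (c : K) (h : (D.alpha ^ D.n) c = c) :
    D.kappa ^ m * D.cst c = D.cst c * D.kappa ^ m :=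
  Commute.pow_left (by rw [commute_iff_eq, kappa_cst, h]) m

theorem sum_piFinset_succ {N : Type*} [AddCommMonoid N] {m : ℕ} (s : Fin (m + 1) → Finset ℕ)
    (g : (Fin (m + 1) → ℕ) → N) : ∑ i ∈ Fintype.piFinset s, g i =
      ∑ a ∈ s 0, ∑ i ∈ Fintype.piFinset fun t : Fin m => s t.succ,
        g (Fin.cons (α := fun _ => ℕ) a i) := by
  rw [← Finset.sum_product']
  refine Finset.sum_nbij' (fun i => (i 0, fun t => i t.succ))
    (fun p => Fin.cons (α := fun _ => ℕ) p.1 p.2) ?_ ?_ ?_ ?_ ?_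
  · intro i hi
    rw [Fintype.mem_piFinset] at hi
    simp [hi]
  · rintro ⟨a, i⟩ hi
    rw [Finset.mem_product, Fintype.mem_piFinset] at hi
    rw [Fintype.mem_piFinset]
    exact Fin.cases hi.1 hi.2
  · intro i _
    exact Fin.cons_self_tail i
  · rintro ⟨a, i⟩ _
    rfl
  · intro i _
    exact congrArg g (Fin.cons_self_tail i).symm

/-- Expansion of `κ^m T` for `ε T = 0`. The exponents `l_t = 0` do not contribute, since `ε x ε` is
then followed by a factor `ε`. -/
theorem kappa_pow_mul (m : ℕ) (T : BarAlg D.incl) (hT : eps D.incl * T = 0) :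
    D.kappa ^ m * T = ∑ i ∈ D.idxI m, ∑ l ∈ idxJ i,
      D.cst (List.ofFn fun t => D.lam (D.n - i t)).prod *
        D.barGen ^ (∑ t, (i t - l t - 1)) * D.block (List.ofFn l) * T := by
  induction m generalizing T with
  | zero =>
    simp only [idxI, idxJ]
    rw [Fintype.piFinset_of_isEmpty, Finset.univ_unique, Finset.sum_singleton,
      Fintype.piFinset_of_isEmpty, Finset.univ_unique, Finset.sum_singleton]
    simp [block]
  | succ m ih =>
    have hU : ∀ l, eps D.incl * (D.epsGen * D.barGen ^ l * T) = 0 := fun l => by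
      rw [epsGen, ← mul_assoc, ← mul_assoc, ← mul_assoc, ← mul_assoc, eps_mul_eps]
      simp
    have h0 : D.epsGen * T = 0 := by rw [epsGen, mul_assoc, hT, mul_zero]
    have hk : D.kappa * T = ∑ i ∈ Finset.Icc 1 D.n, D.cst (D.lam (D.n - i)) * D.powDer i * T := by
      rw [kappa_eq_sum, Finset.sum_mul]
    rw [pow_succ, mul_assoc, hk, Finset.mul_sum, idxI, sum_piFinset_succ]
    refine Finset.sum_congr rfl fun i0 hi0 => ?_
    rw [Finset.mem_Icc] at hi0
    rw [powDer_eq_sum, Finset.mul_sum, Finset.sum_mul, Finset.mul_sum]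
    have hl : ∀ i : Fin m → ℕ, idxJ (Fin.cons (α := fun _ => ℕ) i0 i) =
        Fintype.piFinset fun t => Finset.Ico 1 (Fin.cons (α := fun _ => ℕ) i0 i t) := fun _ => rfl
    simp only [hl, sum_piFinset_succ, Fin.cons_zero, Fin.cons_succ]
    rw [Finset.sum_comm, Finset.range_eq_Ico, Finset.sum_eq_sum_Ico_succ_bot (by omega : 0 < i0)]
    rw [pow_zero, mul_one, mul_assoc (D.cst _), mul_assoc (_ ^ _), h0, mul_zero, mul_zero, mul_zero,
      zero_add]
    refine Finset.sum_congr rfl fun l0 hl0 => ?_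
    have e1 : D.kappa ^ m * (D.cst (D.lam (D.n - i0)) * (D.barGen ^ (i0 - l0 - 1) * D.epsGen *
        D.barGen ^ l0) * T) = D.cst (D.lam (D.n - i0)) * D.barGen ^ (i0 - l0 - 1) *
          (D.kappa ^ m * (D.epsGen * D.barGen ^ l0 * T)) := by
      have c1 := D.kappa_pow_cst m (D.lam (D.n - i0)) (D.pow_alpha_lam _ _ (Nat.sub_le _ _))
      have c2 := D.kappa_pow_barGen_pow m (i0 - l0 - 1)
      simp only [mul_assoc]
      rw [← mul_assoc (D.kappa ^ m) (D.cst _), c1, mul_assoc, ← mul_assoc (D.kappa ^ m), c2]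
      simp only [mul_assoc]
    rw [e1, ih _ (hU l0), Finset.mul_sum]
    refine Finset.sum_congr rfl fun i hi => ?_
    rw [Finset.mul_sum]
    refine Finset.sum_congr rfl fun l hl => ?_
    rw [List.ofFn_succ, List.ofFn_succ, Fin.sum_univ_succ]
    simp only [Fin.cons_zero, Fin.cons_succ, List.prod_cons, map_mul, block, List.reverse_cons,
      List.map_append, List.prod_append, List.map_cons, List.map_nil, List.prod_nil, mul_one]
    have e2 := D.barGen_pow_cst (i0 - l0 - 1) (List.ofFn fun t => D.lam (D.n - i t)).prod
    rw [alpha_pow_lam_prod] at e2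
    rw [pow_add]
    simp only [mul_assoc]
    rw [← mul_assoc (D.barGen ^ (i0 - l0 - 1)) (D.cst _), e2]
    simp only [mul_assoc]

theorem chain_phiTuple (r : ℕ) (l : Fin (r / 2) → ℕ) :
    chain D.incl (List.ofFn fun p : Fin r => D.gen ^ phiExp r l p.succ) =
      D.block (List.ofFn l) * D.tail r := by
  obtain ⟨L, hL⟩ : ∃ L : ℕ → ℕ, ∀ t : Fin (r / 2), l t = L t :=
    ⟨fun j => if h : j < r / 2 then l ⟨j, h⟩ else 0, fun t => by simp⟩
  have h1 : ∀ p : Fin r, phiExp r l p.succ =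
      if (p : ℕ) % 2 = 0 then 1 else L (r / 2 - (p + 1) / 2) := by
    intro p
    simp only [phiExp, Fin.val_succ, hL]
    by_cases h : (p : ℕ) % 2 = 0
    · rw [dif_pos (by omega), if_pos h]
    · rw [dif_neg (by omega), if_neg h]
  obtain rfl : l = fun t : Fin (r / 2) => L t := funext hL
  simp only [h1]
  rw [ofFn_nat (fun p => D.gen ^ (if p % 2 = 0 then 1 else L (r / 2 - (p + 1) / 2))), ofFn_nat L]
  clear h1 hL
  induction r using Nat.twoStepInduction with
  | zero => simp [chain, block, tail]
  | one => simp [chain, block, tail, epsGen, barGen]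
  | more r ih _ =>
    have h2 : (r + 2) / 2 = r / 2 + 1 := by omega
    have h3 : D.tail (r + 2) = D.tail r := by rw [tail, tail, Nat.add_mod_right]
    rw [h2, h3, List.range_succ_eq_map, List.range_succ_eq_map, List.range_succ (n := r / 2)]
    simp only [List.map_cons, List.map_map, chain, block, List.reverse_append, List.map_append,
      List.prod_append, List.reverse_cons, List.reverse_nil, List.nil_append, List.map_nil,
      List.prod_cons, List.prod_nil, mul_one]
    rw [block] at ih
    rw [mul_assoc _ _ (D.tail r), ← ih]
    have h4 : (fun p => D.gen ^ (if p % 2 = 0 then 1 else L (r / 2 + 1 - (p + 1) / 2))) ∘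
        Nat.succ ∘ Nat.succ = fun p => D.gen ^ (if p % 2 = 0 then 1 else L (r / 2 - (p + 1) / 2)) := by
      funext p
      simp only [comp_apply, Nat.succ_eq_add_one]
      rw [show (p + 1 + 1) % 2 = p % 2 by omega,
        show r / 2 + 1 - (p + 1 + 1 + 1) / 2 = r / 2 - (p + 1) / 2 by omega]
    rw [h4]
    simp [epsGen, barGen, mul_assoc]

theorem eps_mul_tail (r : ℕ) : eps D.incl * D.tail r = 0 := by
  rw [tail]
  split_ifs
  · exact eps_mul_eps _
  · rw [epsGen, ← mul_assoc, ← mul_assoc, eps_mul_eps, zero_mul, zero_mul]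

theorem tail_cst (r : ℕ) (c : K) (h : D.alpha c = c) : D.tail r * D.cst c = D.cst c * D.tail r := by
  rw [tail]
  split_ifs
  · exact D.eps_cst c
  · rw [epsGen_cst, h]

theorem block_cst (l : List ℕ) (c : K) (h : D.alpha c = c) :
    D.block l * D.cst c = D.cst c * D.block l := by
  have h' : ∀ i : ℕ, (D.alpha ^ i) c = c := fun i => by
    induction i with
    | zero => simp
    | succ i ih => rw [pow_succ, AlgHom.mul_apply, h, ih]
  rw [block]
  refine (Commute.list_prod_left _ (D.cst c) fun y hy => ?_).eq
  obtain ⟨j, _, rfl⟩ := List.mem_map.1 hy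
  rw [commute_iff_eq, mul_assoc, barGen_pow_cst, h', ← mul_assoc, epsGen_cst, h, mul_assoc]

/-- `φ_{2m}[a]` is the trace of `a κ^m ε`, and `φ_{2m+1}[a]` is the trace of `a κ^m ε x ε`. -/
theorem phi_eq_trace (r : ℕ) (a : D.Ext) : D.phi r (D.csMk r a) =
    trace D.incl r (emb D.incl a * (D.kappa ^ (r / 2) * D.tail r)) := by
  rw [phi_mk, kappa_pow_mul _ _ _ (D.eps_mul_tail r), Finset.mul_sum, map_sum]
  refine Finset.sum_congr rfl fun i hi => ?_
  rw [Finset.mul_sum, map_sum]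
  refine Finset.sum_congr rfl fun l hl => ?_
  have hl : ∀ t, 1 ≤ l t ∧ l t < i t := fun t => by simpa using Fintype.mem_piFinset.1 hl t
  have hN : ∑ t, (i t - l t) - r / 2 = ∑ t, (i t - l t - 1) := by
    have : ∑ t, (i t - l t) = ∑ t, (i t - l t - 1) + r / 2 := by
      have h1 : ∑ _t : Fin (r / 2), 1 = r / 2 := by simp
      refine Eq.trans ?_ (congrArg (_ + ·) h1)
      rw [← Finset.sum_add_distrib]
      refine Finset.sum_congr rfl fun t _ => ?_
      have := hl t; omega
    omega
  rw [hN, cls_eq_trace]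
  have h1 : (List.ofFn fun j : Fin r => D.phiTuple r l (D.incl (List.ofFn fun t =>
      D.lam (D.n - i t)).prod * a * D.gen ^ (∑ t, (i t - l t - 1))) j.succ) =
      List.ofFn fun p : Fin r => D.gen ^ phiExp r l p.succ := by
    congr 1
  rw [h1, chain_phiTuple]
  have h2 : D.alpha (List.ofFn fun t => D.lam (D.n - i t)).prod =
      (List.ofFn fun t => D.lam (D.n - i t)).prod := by
    simpa using D.alpha_pow_lam_prod 1 _ i
  generalize (List.ofFn fun t => D.lam (D.n - i t)).prod = c at h2
  generalize ∑ t, (i t - l t - 1) = N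
  have h3 := D.barGen_pow_cst N c
  have h4 : (D.alpha ^ N) c = c := by
    induction N with
    | zero => simp
    | succ i ih => rw [pow_succ, AlgHom.mul_apply, h2, ih (D.barGen_pow_cst i c)]
  rw [h4] at h3
  simp only [phiTuple, if_true, map_mul, map_pow, emb_gen, emb_incl, mul_assoc]
  rw [← emb_incl, ← trace_comm, emb_incl]
  simp only [mul_assoc]
  rw [tail_cst _ _ _ h2, ← mul_assoc (D.block _), block_cst _ _ _ h2, ← mul_assoc (_ ^ _),
    ← mul_assoc (_ ^ _), h3]
  simp only [mul_assoc]

end MonogenicData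
end MonogenicCyclic

namespace MonogenicCyclic

open scoped TensorProduct
open Function

/-! ### The retract onto the small complex -/

namespace MonogenicData

open BarAlg

variable {k K : Type*} [CommRing k] [Ring K] [Algebra k K] (D : MonogenicData k K)

theorem csMk_surjective (r : ℕ) : Surjective (D.csMk r) := Submodule.mkQ_surjective _

theorem tail_of_even (r : ℕ) (h : r % 2 = 0) : D.tail r = eps D.incl := if_pos h

theorem tail_of_odd (r : ℕ) (h : r % 2 = 1) : D.tail r = D.epsGen := if_neg (by omega)

theorem bar_kappa_pow_mul (m : ℕ) (y : BarAlg D.incl) :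
    BarAlg.bar D.incl (D.kappa ^ m * y) = D.kappa ^ m * BarAlg.bar D.incl y := by
  induction m with
  | zero => simp
  | succ m ih =>
    rw [pow_succ', mul_assoc, bar_mul, bar_kappa, sign_kappa, ih, zero_mul, zero_add, mul_assoc]

theorem phi_d_even (m : ℕ) (a : D.Ext) :
    trace D.incl (2 * m) (emb D.incl (D.dOdd a) * (D.kappa ^ m * eps D.incl)) =
      trace D.incl (2 * m) (emb D.incl a *
        (D.kappa ^ m * (D.barGen * eps D.incl - eps D.incl * D.barGen))) := by
  have h : trace D.incl (2 * m) (emb D.incl (D.gen * a) * (D.kappa ^ m * eps D.incl)) =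
      trace D.incl (2 * m) (emb D.incl a * (D.kappa ^ m * (eps D.incl * D.barGen))) := by
    rw [map_mul (emb D.incl), mul_assoc, ← trace_comm, emb_gen]
    simp only [mul_assoc]
  have h2 := D.kappa_pow_barGen_pow m 1
  rw [pow_one] at h2
  rw [dOdd_apply, map_sub, sub_mul, map_sub, h, mul_sub, mul_sub, map_sub, map_mul (emb D.incl), emb_gen,
    ← mul_assoc (D.kappa ^ m) D.barGen, h2]
  simp only [mul_assoc]

theorem phi_d_odd (m : ℕ) (a : D.Ext) :
    trace D.incl (2 * m + 1) (emb D.incl (D.dEven a) * (D.kappa ^ m * D.epsGen)) =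
      trace D.incl (2 * m + 1) (emb D.incl a * D.kappa ^ (m + 1)) := by
  have hk : D.kappa ^ (m + 1) =
      ∑ i ∈ Finset.Icc 1 D.n, D.kappa ^ m * (D.cst (D.lam (D.n - i)) * D.powDer i) := by
    rw [pow_succ, ← Finset.mul_sum, ← kappa_eq_sum]
  rw [hk, dEven_apply, map_sum, Finset.sum_mul, Finset.mul_sum, map_sum, map_sum]
  refine Finset.sum_congr rfl fun i hi => ?_
  rw [powDer_eq_sum', map_sum, Finset.sum_mul, Finset.mul_sum, Finset.mul_sum, Finset.mul_sum,
    map_sum, map_sum]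
  refine Finset.sum_congr rfl fun l hl => ?_
  have hl' : ∀ j, (D.alpha ^ j) (D.lam (D.n - i)) = D.lam (D.n - i) := fun j =>
    D.pow_alpha_lam _ _ (Nat.sub_le _ _)
  have hl1 : D.alpha (D.lam (D.n - i)) = D.lam (D.n - i) := by simpa using hl' 1
  generalize D.lam (D.n - i) = c at hl' hl1
  generalize i - l - 1 = N
  have c1 : ∀ j, D.barGen ^ j * D.cst c = D.cst c * D.barGen ^ j := fun j => by
    rw [barGen_pow_cst, hl']
  have c2 : D.epsGen * D.cst c = D.cst c * D.epsGen := by rw [epsGen_cst, hl1]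
  have c4 := D.kappa_pow_barGen_pow m l
  have h1 : emb D.incl (D.incl c * D.gen ^ N * a * D.gen ^ l) * (D.kappa ^ m * D.epsGen) =
      emb D.incl (D.incl c * D.gen ^ N) *
        (emb D.incl a * (D.kappa ^ m * (D.barGen ^ l * D.epsGen))) := by
    rw [mul_assoc (D.incl c * _), map_mul, map_mul (emb D.incl) a, map_pow, emb_gen,
      ← mul_assoc (D.kappa ^ m), c4]
    simp only [mul_assoc]
  have h2 : D.cst c * (D.barGen ^ l * D.epsGen * D.barGen ^ N) =
      D.barGen ^ l * D.epsGen * D.cst c * D.barGen ^ N := by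
    rw [mul_assoc _ D.epsGen (D.cst c), c2, ← mul_assoc (_ ^ l) (D.cst c), c1]
    simp only [mul_assoc]
  rw [h1, ← trace_comm, h2, map_mul (emb D.incl), map_pow, emb_incl, emb_gen]
  simp only [mul_assoc]

theorem b_phi (r : ℕ) (y : D.CS (r + 1)) :
    hochB D.incl r (D.phi (r + 1) y) = D.phi r (D.d r y) := by
  obtain ⟨a, rfl⟩ := D.csMk_surjective _ y
  have hd : D.d r (D.csMk (r + 1) a) = D.csMk r ((if r % 2 = 0 then D.dOdd else D.dEven) a) := rfl
  rw [hd, phi_eq_trace, phi_eq_trace, ← trace_bar, bar_emb_mul, bar_kappa_pow_mul]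
  rcases Nat.even_or_odd' r with ⟨m, rfl | rfl⟩
  · rw [if_pos (by omega), D.tail_of_even (2 * m) (by omega), D.tail_of_odd (2 * m + 1) (by omega),
      show (2 * m + 1) / 2 = m by omega, show 2 * m / 2 = m by omega, phi_d_even, bar_epsGen]
  · rw [if_neg (by omega), D.tail_of_odd (2 * m + 1) (by omega),
      D.tail_of_even (2 * m + 1 + 1) (by omega),
      show (2 * m + 1 + 1) / 2 = m + 1 by omega, show (2 * m + 1) / 2 = m by omega, phi_d_odd,
      bar_eps, mul_one]

/-- `f` is monic of degree `n`. -/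
theorem bar_self : D.bar D.n = 1 := by
  have h : D.quot (D.mon D.n 1) = 1 := by
    refine D.quot_eq _ _ fun i hi => ?_
    rw [one_mul, f, Finset.sum_range_succ', Nat.sub_zero, D.lam_zero, sub_add_cancel_right, map_neg,
      map_sum, Finset.sum_eq_zero, neg_zero]
    intro j hj
    have := D.two_le
    rw [coeff_mon, if_neg (by omega)]
  rw [bar, h, map_one]

theorem psi_phi (r : ℕ) (y : D.CS r) : D.psi r (D.phi r y) = y := by
  obtain ⟨a, rfl⟩ := D.csMk_surjective _ y
  have hn := D.two_le
  -- a summand of `φ` whose exponents `l` are not all equal to `n - 1` is annihilated by `ψ`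
  have key : ∀ (l : Fin (r / 2) → ℕ) (b : D.Ext), (∀ t, l t < D.n) →
      D.psi r (cls D.incl r (D.phiTuple r l b)) =
        if ∀ t, l t = D.n - 1 then D.csMk r b else 0 := by
    intro l b hl
    obtain ⟨E, hE, hE'⟩ : ∃ E : ℕ → ℕ, (∀ p : Fin (r + 1), phiExp r l p = E p) ∧
        (∀ j, E j < D.n) := by
      refine ⟨fun j => if h : j < r + 1 then phiExp r l ⟨j, h⟩ else 0,
        fun p => by dsimp only; rw [dif_pos p.2],
        fun j => ?_⟩
      dsimp only
      split_ifs with h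
      · rw [phiExp]
        split_ifs
        · omega
        · exact hl _
      · omega
    have hT : D.phiTuple r l b =
        fun j : Fin (r + 1) => if j = 0 then b else D.gen ^ E j := by
      funext j
      simp [phiTuple, hE]
    have hodd : ∀ j, j ≤ r → j % 2 = 1 → E j = 1 := by
      intro j hj h
      have := hE ⟨j, by omega⟩
      rw [← this, phiExp, dif_pos (Or.inl h)]
    have heven : ∀ q (h : q < r / 2), E (2 * q + 2) = l ⟨r / 2 - (q + 1), by omega⟩ := by
      intro q h
      have := hE ⟨2 * q + 2, by omega⟩
      dsimp only at this
      rw [← this, phiExp, dif_neg (by simp)]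
      congr 2
      dsimp only
      omega
    rw [hT, D.psi_cls_gen_pow r b E fun j _ _ => hE' j]
    have hP : ((List.range (r / 2)).map fun q => D.bar (E (2 * q + 1) + E (2 * q + 2))).prod =
        if ∀ t, l t = D.n - 1 then 1 else 0 := by
      split_ifs with h
      · refine List.prod_eq_one fun y hy => ?_
        obtain ⟨q, hq, rfl⟩ := List.mem_map.1 hy
        rw [List.mem_range] at hq
        rw [hodd _ (by omega) (by omega), heven q hq, h, show 1 + (D.n - 1) = D.n by omega, bar_self]
      · push Not at h
        obtain ⟨t, ht⟩ := h
        have h0 : (0 : D.Ext) ∈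
            (List.range (r / 2)).map fun q => D.bar (E (2 * q + 1) + E (2 * q + 2)) := by
          refine List.mem_map.2 ⟨r / 2 - 1 - t, List.mem_range.2 (by omega), ?_⟩
          have h1 : (⟨r / 2 - (r / 2 - 1 - t + 1), by omega⟩ : Fin (r / 2)) = t := by
            ext; dsimp only; omega
          rw [hodd _ (by omega) (by omega), heven _ (by omega), h1]
          refine D.bar_of_lt _ ?_
          have := hl t
          omega
        obtain ⟨s, t, hst⟩ := List.append_of_mem h0
        rw [hst]
        simp
    rcases Nat.mod_two_eq_zero_or_one r with hr | hr
    · rw [psiVal, if_pos hr, hP]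
      split_ifs <;> simp
    · rw [psiVal, if_neg (by omega), hP, hodd r le_rfl hr]
      split_ifs <;> simp
  rw [phi_mk, map_sum]
  simp only [map_sum]
  rw [Finset.sum_eq_single (fun _ => D.n), Finset.sum_eq_single (fun _ => D.n - 1)]
  · rw [key _ _ (fun _ => by omega), if_pos fun _ => rfl]
    have h1 : (List.ofFn fun _ : Fin (r / 2) => D.lam (D.n - D.n)).prod = 1 := by
      simp [D.lam_zero]
    have h2 : ∑ _t : Fin (r / 2), (D.n - (D.n - 1)) - r / 2 = 0 := by
      rw [show D.n - (D.n - 1) = 1 by omega]; simp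
    rw [h1, h2, map_one, one_mul, pow_zero, mul_one]
  · intro l hl hne
    have hl : ∀ t, 1 ≤ l t ∧ l t < D.n := fun t => by simpa using Fintype.mem_piFinset.1 hl t
    rw [key _ _ (fun t => (hl t).2), if_neg fun h => hne (funext h)]
  · intro h
    refine absurd (Fintype.mem_piFinset.2 fun t => ?_) h
    rw [Finset.mem_Ico]; dsimp only; omega
  · intro i hi hne
    have hi : ∀ t, 1 ≤ i t ∧ i t ≤ D.n := fun t => by simpa using Fintype.mem_piFinset.1 hi t
    refine Finset.sum_eq_zero fun l hl => ?_
    have hl : ∀ t, 1 ≤ l t ∧ l t < i t := fun t => by simpa using Fintype.mem_piFinset.1 hl t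
    rw [key _ _ (fun t => by have := hl t; have := hi t; omega), if_neg]
    intro h
    refine hne (funext fun t => ?_)
    have := h t
    have := hl t
    have := hi t
    omega
  · intro h
    refine absurd (Fintype.mem_piFinset.2 fun t => ?_) h
    rw [Finset.mem_Icc]; omega

theorem retr_gen_pow (r : ℕ) (e : ℕ → ℕ) (he : ∀ j, e j < D.n) :
    retr D.conn ((List.range r).map fun j => D.gen ^ e j) =
      emb D.incl ((List.range (r / 2)).map fun q => D.bar (e (2 * q) + e (2 * q + 1))).prod *
        (D.kappa ^ (r / 2) * if r % 2 = 0 then eps D.incl else D.powDer (e (r - 1))) := by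
  induction r using Nat.twoStepInduction generalizing e with
  | zero => simp [retr]
  | one => simp [retr, D.conn_gen_pow _ (he 0)]
  | more r ih _ =>
    have h1 : (r + 2) / 2 = r / 2 + 1 := by omega
    have h2 : (r + 2) % 2 = r % 2 := by omega
    have h3 : (if r % 2 = 0 then eps D.incl else D.powDer (e (r + 2 - 1))) =
        if r % 2 = 0 then eps D.incl else D.powDer (e (r - 1 + 2)) := by
      split_ifs
      · rfl
      · rw [show r + 2 - 1 = r - 1 + 2 by omega]
    have h4 : ((List.range (r / 2)).map
          ((fun q => D.bar (e (2 * q) + e (2 * q + 1))) ∘ Nat.succ)).prod =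
        ((List.range (r / 2)).map
          (fun q => D.bar (e (2 * q + 2) + e (2 * q + 1 + 2)))).prod := rfl
    have c := D.kappa_bar
    have hc : ∀ L : List ℕ, D.kappa * emb D.incl (L.map fun q =>
          D.bar (e (2 * q + 2) + e (2 * q + 1 + 2))).prod =
        emb D.incl (L.map fun q => D.bar (e (2 * q + 2) + e (2 * q + 1 + 2))).prod * D.kappa := by
      intro L
      induction L with
      | nil => simp
      | cons q L ih =>
        rw [List.map_cons, List.prod_cons, map_mul, ← mul_assoc, c, mul_assoc, ih, mul_assoc]
    rw [h1, h2, h3, List.range_succ_eq_map, List.range_succ_eq_map,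
      List.range_succ_eq_map (n := r / 2)]
    simp only [List.map_cons, List.map_map, retr, List.prod_cons]
    rw [h4]
    have h5 := ih (fun j => e (j + 2)) fun j => he _
    have h6 : ((fun j => D.gen ^ e j) ∘ Nat.succ ∘ Nat.succ) = fun j => D.gen ^ e (j + 2) := rfl
    rw [h6, h5, curv_gen_pow _ _ _ (he _) (he _), pow_succ', map_mul]
    simp only [mul_assoc]
    rw [← mul_assoc D.kappa (emb D.incl _), hc]
    simp only [mul_assoc]

/-- `φ ψ` is the map of Hochschild chains induced by `retr`: commuting `κ` with the quotients
`\overline{x^{i+j}}` and the powers of `x` collects the values of `curv` into `κ^m`. -/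
theorem phi_psiVal (r : ℕ) (e : ℕ → ℕ) (he : ∀ j, e j < D.n) (a : D.Ext) :
    D.phi r (D.psiVal r e a) = trace D.incl r
      (emb D.incl a * retr D.conn ((List.range r).map fun j => D.gen ^ e (j + 1))) := by
  rw [D.retr_gen_pow r (fun j => e (j + 1)) fun j => he _, psiVal]
  generalize ((List.range (r / 2)).map fun q => D.bar (e (2 * q + 1) + e (2 * q + 1 + 1))).prod = P
  rcases Nat.mod_two_eq_zero_or_one r with hr | hr
  · simp only [hr, if_true, LinearMap.comp_apply, LinearMap.mulRight_apply, phi_eq_trace,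
      tail_of_even _ _ hr, map_mul, mul_assoc]
  · have hr' : ¬ r % 2 = 0 := by omega
    rw [if_neg hr', if_neg hr', show r - 1 + 1 = r by omega, powDer_eq_sum']
    simp only [LinearMap.sum_apply, map_sum, LinearMap.comp_apply, LinearMap.mulRight_apply,
      LinearMap.mulLeft_apply, phi_eq_trace, tail_of_odd _ _ hr, Finset.mul_sum]
    refine Finset.sum_congr rfl fun l _ => ?_
    rw [map_mul (emb D.incl), mul_assoc, ← trace_comm]
    have h := D.kappa_pow_barGen_pow (r / 2) l
    simp only [map_mul (emb D.incl), map_pow (emb D.incl), emb_gen, mul_assoc]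
    rw [← mul_assoc (D.kappa ^ _) (D.barGen ^ l), h]
    simp only [mul_assoc]

/-- The elements `ε a_1 ε ⋯ ε a_r ε` are left `K`-linear combinations of those whose entries are
powers `x^e` with `e < n`. -/
theorem chain_mem_span (l : List D.Ext) : chain D.incl l ∈ Submodule.span k
    {y | ∃ (c : K) (e : ℕ → ℕ), (∀ j, e j < D.n) ∧
      y = D.cst c * chain D.incl ((List.range l.length).map fun j => D.gen ^ e j)} := by
  induction l with
  | nil =>
    refine Submodule.subset_span ⟨1, fun _ => 0, fun _ => by have := D.two_le; dsimp only; omega, ?_⟩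
    simp
  | cons a l ih =>
    rw [chain, D.eq_sum_coord a, map_sum, Finset.mul_sum, Finset.sum_mul]
    refine Submodule.sum_mem _ fun i hi => ?_
    refine Submodule.span_induction (p := fun y _ => eps D.incl * emb D.incl
      (D.incl (D.coord i a) * D.gen ^ i) * y ∈ Submodule.span k {y | ∃ (c : K) (e : ℕ → ℕ),
        (∀ j, e j < D.n) ∧ y = D.cst c * chain D.incl
          ((List.range (l.length + 1)).map fun j => D.gen ^ e j)}) ?_ (by simp) ?_ ?_ ih
    · rintro _ ⟨c, e, he, rfl⟩
      refine Submodule.subset_span ⟨D.coord i a * (D.alpha ^ i) c,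
        fun j => Nat.casesOn j i e, ?_, ?_⟩
      · rintro (_ | j)
        · exact Finset.mem_range.1 hi
        · exact he j
      · rw [List.range_succ_eq_map, List.map_cons, List.map_map, chain]
        change _ = _ * (_ * emb D.incl (D.gen ^ i) *
          chain D.incl ((List.range l.length).map fun j => D.gen ^ e j))
        have c1 := D.eps_cst (D.coord i a)
        have c2 := D.eps_cst ((D.alpha ^ i) c)
        simp only [map_mul, map_pow, emb_incl, emb_gen, mul_assoc]
        rw [← mul_assoc (_ ^ i) (D.cst c), barGen_pow_cst, ← mul_assoc (eps _), c1]
        simp only [mul_assoc]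
        rw [← mul_assoc (eps _) (D.cst _), c2]
        simp only [mul_assoc]
    · intro y z _ _ hy hz
      rw [mul_add]
      exact Submodule.add_mem _ hy hz
    · intro c y _ hy
      rw [mul_smul_comm]
      exact Submodule.smul_mem _ c hy

theorem hochX_ext_pow {r : ℕ} {N : Type*} [AddCommGroup N] [Module k N]
    {F G : HochX D.incl r →ₗ[k] N}
    (h : ∀ (a : D.Ext) (e : ℕ → ℕ), (∀ j, e j < D.n) →
      F (trace D.incl r (emb D.incl a * chain D.incl ((List.range r).map fun j => D.gen ^ e j))) =
      G (trace D.incl r (emb D.incl a * chain D.incl ((List.range r).map fun j => D.gen ^ e j)))) :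
    F = G := by
  refine hochX_ext_trace D.incl fun a l hl => ?_
  refine Submodule.span_induction (p := fun y _ => F (trace D.incl r (emb D.incl a * y)) =
    G (trace D.incl r (emb D.incl a * y))) ?_ (by simp) ?_ ?_ (D.chain_mem_span l)
  · rintro _ ⟨c, e, he, rfl⟩
    rw [← mul_assoc, ← emb_incl, ← map_mul, hl]
    exact h _ e he
  · intro y z _ _ hy hz
    rw [mul_add, map_add, map_add, map_add, hy, hz]
  · intro c y _ hy
    rw [mul_smul_comm, map_smul, map_smul, map_smul, hy]

theorem phi_psi (r : ℕ) (a : D.Ext) (e : ℕ → ℕ) (he : ∀ j, e j < D.n) :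
    D.phi r (D.psi r (trace D.incl r
      (emb D.incl a * chain D.incl ((List.range r).map fun j => D.gen ^ e j)))) =
    trace D.incl r (emb D.incl a * retr D.conn ((List.range r).map fun j => D.gen ^ e j)) := by
  have h1 := D.psi_cls_gen_pow r a (fun j => e (j - 1)) fun j _ _ => he _
  have h2 := D.phi_psiVal r (fun j => e (j - 1)) (fun j => he _) a
  rw [cls_eq_trace] at h1
  simp only [if_true, Fin.succ_ne_zero, if_false, Fin.val_succ, Nat.add_sub_cancel] at h1 h2
  rw [ofFn_nat (fun j => D.gen ^ e j)] at h1
  rw [h1, h2]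

/-- In degree `0` the homotopy vanishes and `φ ψ = 1`. -/
theorem homotopy_zero (x : HochX D.incl 0) :
    hochB D.incl 0 (D.conn_isConnection.omega 0 x) = x - D.phi 0 (D.psi 0 x) := by
  have h : LinearMap.id = D.phi 0 ∘ₗ D.psi 0 := by
    refine D.hochX_ext_pow fun a e he => ?_
    rw [LinearMap.comp_apply, D.phi_psi 0 a e he]
    rfl
  have h2 := LinearMap.congr_fun h x
  rw [LinearMap.id_apply, LinearMap.comp_apply] at h2
  rw [D.conn_isConnection.omega_zero, ← h2]
  simp

theorem homotopy (r : ℕ) (x : HochX D.incl (r + 1)) :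
    hochB D.incl (r + 1) (D.conn_isConnection.omega (r + 1) x) +
      D.conn_isConnection.omega r (hochB D.incl r x) = x - D.phi (r + 1) (D.psi (r + 1) x) := by
  have h : hochB D.incl (r + 1) ∘ₗ D.conn_isConnection.omega (r + 1) +
      D.conn_isConnection.omega r ∘ₗ hochB D.incl r =
      LinearMap.id - D.phi (r + 1) ∘ₗ D.psi (r + 1) := by
    refine D.hochX_ext_pow fun a e he => ?_
    exact D.conn_isConnection.homotopy_succ r (D.phi (r + 1) ∘ₗ D.psi (r + 1)) a _ (by simp)
      (D.phi_psi (r + 1) a e he)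
  exact LinearMap.congr_fun h x

end MonogenicData
end MonogenicCyclic

namespace MonogenicCyclic

open scoped TensorProduct
open Function

/-! ### Filtrations of Hochschild chains -/

section Filtration

variable {k K A : Type*} [CommRing k] [Ring K] [Algebra k K] [Ring A] [Algebra k A]

/-- An increasing multiplicative filtration of an algebra by submodules. -/
structure IsFiltration (F : ℕ → Submodule k A) : Prop where
  one_mem : (1 : A) ∈ F 0
  mono : Monotone F
  mul_mem : ∀ {i j a b}, a ∈ F i → b ∈ F j → a * b ∈ F (i + j)

/-- The filtration of relative Hochschild chains induced by a filtration of `A`: a tensor has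
filtration at most the sum of those of its entries. -/
def hochFil (ι : K →ₐ[k] A) (F : ℕ → Submodule k A) (r w : ℕ) : Submodule k (HochX ι r) :=
  Submodule.span k {y | ∃ (a : Fin (r + 1) → A) (e : Fin (r + 1) → ℕ),
    (∀ j, a j ∈ F (e j)) ∧ ∑ j, e j ≤ w ∧ y = cls ι r a}

theorem hochFil_mono (ι : K →ₐ[k] A) (F : ℕ → Submodule k A) (r : ℕ) {v w : ℕ} (h : v ≤ w) :
    hochFil ι F r v ≤ hochFil ι F r w :=
  Submodule.span_mono fun _ ⟨a, e, ha, he, hy⟩ => ⟨a, e, ha, he.trans h, hy⟩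

theorem connesB_mem_hochFil {ι : K →ₐ[k] A} {F : ℕ → Submodule k A} (hF : IsFiltration F)
    {r w : ℕ} {y : HochX ι r} (hy : y ∈ hochFil ι F r w) :
    connesB ι r y ∈ hochFil ι F (r + 1) w := by
  refine Submodule.span_induction (p := fun y _ => connesB ι r y ∈ hochFil ι F (r + 1) w)
    ?_ (by simp) ?_ ?_ hy
  · rintro _ ⟨a, e, ha, he, rfl⟩
    rw [connesB_cls]
    refine Submodule.sum_mem _ fun i _ => Submodule.smul_mem _ _ (Submodule.subset_span
      ⟨rot i a, Fin.cons 0 fun j => e (i + j), fun j => ?_, ?_, rfl⟩)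
    · exact Fin.cases (motive := fun j => rot i a j ∈
        F ((Fin.cons 0 fun j => e (i + j) : Fin (r + 2) → ℕ) j)) hF.one_mem (fun j => ha _) j
    · rw [Fin.sum_univ_succ]
      simp only [Fin.cons_zero, Fin.cons_succ, zero_add]
      exact (Equiv.sum_comp (Equiv.addLeft i) e).le.trans he
  · intro x y _ _ hx hy
    rw [map_add]
    exact Submodule.add_mem _ hx hy
  · intro c x _ hx
    rw [map_smul]
    exact Submodule.smul_mem _ _ hx

namespace BarAlg

/-- The filtration of the bar algebra induced by a filtration of `A`, for which `ε` has
filtration zero. -/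
noncomputable def fil (ι : K →ₐ[k] A) (F : ℕ → Submodule k A) (w : ℕ) : Submodule k (BarAlg ι) :=
  Submodule.span k {y | ∃ (u : BarWord A) (e : ℕ → ℕ),
    (∀ j ≤ u.len, u.entry j ∈ F (e j)) ∧ ∑ j ∈ Finset.range (u.len + 1), e j ≤ w ∧ y = word ι u}

variable {ι : K →ₐ[k] A} {F : ℕ → Submodule k A}

theorem fil_mono {v w : ℕ} (h : v ≤ w) : fil ι F v ≤ fil ι F w :=
  Submodule.span_mono fun _ ⟨u, e, hu, he, hy⟩ => ⟨u, e, hu, he.trans h, hy⟩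

theorem fil_mul (hF : IsFiltration F) {v w : ℕ} {y z : BarAlg ι} (hy : y ∈ fil ι F v)
    (hz : z ∈ fil ι F w) : y * z ∈ fil ι F (v + w) := by
  have h := Submodule.mul_mem_mul hy hz
  rw [fil, fil, Submodule.span_mul_span] at h
  refine Submodule.span_le.2 ?_ h
  rintro _ ⟨_, ⟨u, d, hu, hd, rfl⟩, _, ⟨u', e, hu', he, rfl⟩, rfl⟩
  refine Submodule.subset_span ⟨u * u', fun j => (if j ≤ u.len then d j else 0) +
    (if u.len ≤ j then e (j - u.len) else 0), fun j hj => ?_, ?_, (word_mul ι u u').symm⟩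
  · rw [BarWord.len_mul] at hj
    rw [BarWord.entry_mul]
    dsimp only
    rcases lt_trichotomy j u.len with h1 | h1 | h1
    · rw [if_pos h1, if_pos h1.le, if_neg (by omega), add_zero]
      exact hu _ h1.le
    · subst h1
      simp only [lt_irrefl, if_false, if_true, le_refl, Nat.sub_self]
      exact hF.mul_mem (hu _ le_rfl) (hu' _ (Nat.zero_le _))
    · rw [if_neg h1.le.not_gt, if_neg h1.ne', if_neg h1.not_ge, if_pos h1.le, zero_add]
      exact hu' _ (by omega)
  · rw [Finset.sum_add_distrib, BarWord.len_mul]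
    refine add_le_add ?_ ?_
    · rw [add_right_comm, Finset.sum_range_add, Finset.sum_eq_zero (s := Finset.range u'.len),
        add_zero]
      · refine le_trans (le_of_eq (Finset.sum_congr rfl fun j hj => ?_)) hd
        rw [Finset.mem_range] at hj
        rw [if_pos (by omega)]
      · intro j _
        rw [if_neg (by omega)]
    · rw [add_assoc, Finset.sum_range_add, Finset.sum_eq_zero (s := Finset.range u.len), zero_add]
      · refine le_trans (le_of_eq (Finset.sum_congr rfl fun j hj => ?_)) he
        rw [if_pos (by omega), Nat.add_sub_cancel_left]
      · intro j hj
        rw [Finset.mem_range] at hj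
        rw [if_neg (by omega)]

theorem emb_mem_fil {w : ℕ} {a : A} (ha : a ∈ F w) : emb ι a ∈ fil ι F w := by
  refine Submodule.subset_span ⟨BarWord.of a, fun _ => w, fun j hj => ?_, ?_, rfl⟩
  · rw [BarWord.len_of, Nat.le_zero] at hj
    rwa [BarWord.entry_of, if_pos hj]
  · simp

theorem eps_mem_fil (hF : IsFiltration F) : eps ι ∈ fil ι F 0 := by
  refine Submodule.subset_span ⟨BarWord.eps, fun _ => 0, fun j _ => ?_, by simp, rfl⟩
  rw [BarWord.entry_eps]
  exact hF.one_mem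

theorem trace_mem_hochFil (hF : IsFiltration F) {r w : ℕ} {y : BarAlg ι} (hy : y ∈ fil ι F w) :
    trace ι r y ∈ hochFil ι F r w := by
  refine Submodule.span_induction (p := fun y _ => trace ι r y ∈ hochFil ι F r w)
    ?_ (by simp) ?_ ?_ hy
  · rintro _ ⟨u, e, hu, he, rfl⟩
    rw [trace_word]
    split_ifs with h
    · refine Submodule.subset_span ⟨_, fun j => if (j : ℕ) = 0 then e (r + 1) + e 0 else e j,
        fun j => ?_, ?_, rfl⟩
      · dsimp only [wrap]
        split_ifs with h0
        · exact hF.mul_mem (hu _ h.ge) (hu _ (Nat.zero_le _))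
        · exact hu _ (by omega)
      · rw [h, Finset.sum_range_succ, Finset.sum_range_succ'] at he
        rw [Fin.sum_univ_succ]
        simp only [Fin.val_zero, Fin.val_succ, if_true, Nat.add_eq_zero_iff, one_ne_zero, and_false,
          if_false]
        rw [Fin.sum_univ_eq_sum_range (fun j => e (j + 1)) r]
        omega
    · exact Submodule.zero_mem _
  · intro x y _ _ hx hy
    rw [map_add]
    exact Submodule.add_mem _ hx hy
  · intro c x _ hx
    rw [map_smul]
    exact Submodule.smul_mem _ _ hx

theorem chain_mem_fil (hF : IsFiltration F) {l : List A} {e : List ℕ}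
    (h : List.Forall₂ (fun a i => a ∈ F i) l e) : chain ι l ∈ fil ι F e.sum := by
  induction h with
  | nil => exact eps_mem_fil hF
  | @cons a i l e ha _ ih =>
    have := fil_mul hF (fil_mul hF (eps_mem_fil (ι := ι) hF) (emb_mem_fil ha)) ih
    rwa [zero_add] at this

variable {δ : A →ₗ[k] BarAlg ι}

theorem curv_mem_fil (hF : IsFiltration F) (hδ : ∀ i, ∀ a ∈ F i, δ a ∈ fil ι F i) {i j : ℕ} {a b : A}
    (ha : a ∈ F i) (hb : b ∈ F j) : curv δ a b ∈ fil ι F (i + j) :=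
  Submodule.add_mem _ (Submodule.sub_mem _ (fil_mul hF (emb_mem_fil ha) (hδ _ _ hb))
    (hδ _ _ (hF.mul_mem ha hb))) (fil_mul hF (hδ _ _ ha) (emb_mem_fil hb))

theorem homot_mem_fil (hF : IsFiltration F) (hδ : ∀ i, ∀ a ∈ F i, δ a ∈ fil ι F i) {l : List A}
    {e : List ℕ} (h : List.Forall₂ (fun a i => a ∈ F i) l e) : homot δ l ∈ fil ι F e.sum := by
  obtain ⟨n, hn⟩ : ∃ n, l.length = n := ⟨_, rfl⟩
  induction n using Nat.strong_induction_on generalizing l e with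
  | _ n ih =>
  match h with
  | .nil => exact Submodule.zero_mem _
  | @List.Forall₂.cons _ _ _ a i _ _ ha .nil =>
    rw [homot]
    exact Submodule.neg_mem _ (fil_mul hF (hδ _ _ ha) (eps_mem_fil hF))
  | @List.Forall₂.cons _ _ _ a i _ _ ha (@List.Forall₂.cons _ _ _ b j l e hb hl) =>
    rw [homot, List.sum_cons]
    refine Submodule.add_mem _ (Submodule.neg_mem _
      (fil_mul hF (hδ _ _ ha) (chain_mem_fil hF (.cons hb hl)))) ?_
    rw [List.sum_cons, ← add_assoc]
    exact fil_mul hF (curv_mem_fil hF hδ ha hb) (ih _ (by rw [← hn]; simp) hl rfl)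

theorem IsConnection.omega_mem_hochFil (h : IsConnection δ) (hF : IsFiltration F)
    (hδ : ∀ i, ∀ a ∈ F i, δ a ∈ fil ι F i) {r w : ℕ} {y : HochX ι r} (hy : y ∈ hochFil ι F r w) :
    h.omega r y ∈ hochFil ι F (r + 1) w := by
  refine Submodule.span_induction (p := fun y _ => h.omega r y ∈ hochFil ι F (r + 1) w)
    ?_ (by simp) ?_ ?_ hy
  · rintro _ ⟨a, e, ha, he, rfl⟩
    rw [cls_eq_trace, h.omega_trace _ _ _ (by simp)]
    refine hochFil_mono _ _ _ he (trace_mem_hochFil hF ?_)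
    rw [Fin.sum_univ_succ, ← List.sum_ofFn]
    refine fil_mul hF (emb_mem_fil (ha 0)) (homot_mem_fil hF hδ ?_)
    rw [List.forall₂_iff_get]
    refine ⟨by simp, fun i h1 h2 => ?_⟩
    simp only [List.get_eq_getElem, List.getElem_ofFn]
    exact ha _
  · intro x y _ _ hx hy
    rw [map_add]
    exact Submodule.add_mem _ hx hy
  · intro c x _ hx
    rw [map_smul]
    exact Submodule.smul_mem _ _ hx

end BarAlg
end Filtration

/-! ### The filtration by the degree in `x` -/

namespace MonogenicData

open BarAlg

variable {k K : Type*} [CommRing k] [Ring K] [Algebra k K] (D : MonogenicData k K)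

/-- The filtration of `A` by the degree in `x`. -/
noncomputable def degFil (e : ℕ) : Submodule k D.Ext :=
  Submodule.span k {a | ∃ (c : K) (i : ℕ), i ≤ e ∧ a = D.incl c * D.gen ^ i}

theorem incl_mul_gen_pow_mem (c : K) {i e : ℕ} (h : i ≤ e) : D.incl c * D.gen ^ i ∈ D.degFil e :=
  Submodule.subset_span ⟨c, i, h, rfl⟩

theorem incl_mem (c : K) : D.incl c ∈ D.degFil 0 := by
  simpa using D.incl_mul_gen_pow_mem c (le_refl 0)

theorem gen_mem : D.gen ∈ D.degFil 1 := by
  simpa using D.incl_mul_gen_pow_mem 1 (le_refl 1)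

theorem isFiltration_degFil : IsFiltration D.degFil where
  one_mem := by simpa using D.incl_mem 1
  mono := fun i j h => Submodule.span_mono fun _ ⟨c, t, ht, ha⟩ => ⟨c, t, ht.trans h, ha⟩
  mul_mem := by
    intro i j a b ha hb
    have h := Submodule.mul_mem_mul ha hb
    rw [degFil, degFil, Submodule.span_mul_span] at h
    refine Submodule.span_le.2 ?_ h
    rintro _ ⟨_, ⟨c, s, hs, rfl⟩, _, ⟨d, t, ht, rfl⟩, rfl⟩
    refine Submodule.subset_span ⟨c * (D.alpha ^ s) d, s + t, by omega, ?_⟩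
    dsimp only
    rw [mul_assoc, ← mul_assoc (_ ^ s), gen_pow_mul_incl, map_mul, pow_add]
    simp only [mul_assoc]

theorem mem_degFil (a : D.Ext) : a ∈ D.degFil (D.n - 1) := by
  rw [D.eq_sum_coord a]
  refine Submodule.sum_mem _ fun i hi => D.incl_mul_gen_pow_mem _ ?_
  rw [Finset.mem_range] at hi
  omega

theorem coord_eq_zero_of_mem {e j : ℕ} {a : D.Ext} (ha : a ∈ D.degFil e) (hj : e < j) :
    D.coord j a = 0 := by
  refine Submodule.span_induction (p := fun a _ => D.coord j a = 0) ?_ (by simp)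
    (fun x y _ _ hx hy => by rw [map_add, hx, hy, add_zero])
    (fun c x _ hx => by rw [map_smul, hx, smul_zero]) ha
  rintro _ ⟨c, i, hi, rfl⟩
  rw [coord_incl_mul]
  by_cases h : i < D.n
  · rw [coord_gen_pow _ _ _ h, if_neg (by omega), mul_zero]
  · rw [gen_pow, coord_proj, coeff_rem _ _ _ (by omega), mul_zero]

theorem cst_mem_fil (c : K) : D.cst c ∈ fil D.incl D.degFil 0 := by
  rw [← emb_incl]
  exact emb_mem_fil (D.incl_mem c)

theorem barGen_pow_mem_fil (i : ℕ) : D.barGen ^ i ∈ fil D.incl D.degFil i := by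
  rw [barGen, ← map_pow]
  refine emb_mem_fil ?_
  simpa using D.incl_mul_gen_pow_mem 1 (le_refl i)

theorem epsGen_mem_fil : D.epsGen ∈ fil D.incl D.degFil 1 := by
  have h := D.isFiltration_degFil
  have := fil_mul h (fil_mul h (eps_mem_fil (ι := D.incl) h) (emb_mem_fil D.gen_mem))
    (eps_mem_fil h)
  rwa [emb_gen, zero_add, add_zero] at this

theorem powDer_mem_fil (i : ℕ) : D.powDer i ∈ fil D.incl D.degFil i := by
  have h := D.isFiltration_degFil
  rw [powDer_eq_sum]
  refine Submodule.sum_mem _ fun l hl => ?_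
  rw [Finset.mem_range] at hl
  have := fil_mul h (fil_mul h (D.barGen_pow_mem_fil (i - l - 1)) D.epsGen_mem_fil)
    (D.barGen_pow_mem_fil l)
  rwa [show i - l - 1 + 1 + l = i by omega] at this

theorem conn_mem_fil (e : ℕ) (a : D.Ext) (ha : a ∈ D.degFil e) :
    D.conn a ∈ fil D.incl D.degFil e := by
  rw [conn_apply]
  refine Submodule.sum_mem _ fun i _ => ?_
  by_cases h : e < i
  · rw [D.coord_eq_zero_of_mem ha h, map_zero, zero_mul]
    exact Submodule.zero_mem _
  · have := fil_mul D.isFiltration_degFil (D.cst_mem_fil (D.coord i a)) (D.powDer_mem_fil i)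
    rw [zero_add] at this
    exact fil_mono (by omega) this

theorem kappa_mem_fil : D.kappa ∈ fil D.incl D.degFil D.n := by
  rw [kappa_eq_sum]
  refine Submodule.sum_mem _ fun i hi => ?_
  rw [Finset.mem_Icc] at hi
  have := fil_mul D.isFiltration_degFil (D.cst_mem_fil (D.lam (D.n - i))) (D.powDer_mem_fil i)
  rw [zero_add] at this
  exact fil_mono hi.2 this

theorem kappa_pow_mem_fil (m : ℕ) : D.kappa ^ m ∈ fil D.incl D.degFil (m * D.n) := by
  induction m with
  | zero => simpa using D.cst_mem_fil 1
  | succ m ih =>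
    rw [pow_succ, Nat.succ_mul]
    exact fil_mul D.isFiltration_degFil ih D.kappa_mem_fil

theorem phi_mem_hochFil (r : ℕ) (y : D.CS r) :
    D.phi r y ∈ hochFil D.incl D.degFil r (D.tw r + (D.n - 1)) := by
  obtain ⟨a, rfl⟩ := D.csMk_surjective _ y
  have h := D.isFiltration_degFil
  rw [phi_eq_trace, add_comm (D.tw r)]
  refine trace_mem_hochFil h (fil_mul h (emb_mem_fil (D.mem_degFil a))
    (fil_mul h (D.kappa_pow_mem_fil _) ?_))
  rcases Nat.mod_two_eq_zero_or_one r with hr | hr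
  · rw [D.tail_of_even _ hr, hr]
    exact eps_mem_fil h
  · rw [D.tail_of_odd _ hr, hr]
    exact D.epsGen_mem_fil

/-- `ψ` vanishes on tensors of powers of `x` with small total degree, as the quotient of `x^s` by
`f` is zero for `s < n`. -/
theorem psiVal_eq_zero_of_sum_lt (r : ℕ) (e : ℕ → ℕ)
    (h : ∑ j ∈ Finset.range r, e (j + 1) < D.tw r) : D.psiVal r e = 0 := by
  have key : ∀ m, (∀ q < m, D.n ≤ e (2 * q + 1) + e (2 * q + 2)) →
      m * D.n ≤ ∑ j ∈ Finset.range (2 * m), e (j + 1) := by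
    intro m
    induction m with
    | zero => simp
    | succ m ih =>
      intro hm
      rw [show 2 * (m + 1) = 2 * m + 1 + 1 by ring, Finset.sum_range_succ, Finset.sum_range_succ,
        Nat.succ_mul, add_assoc]
      exact add_le_add (ih fun q hq => hm q (by omega)) (hm m (by omega))
  by_cases hq : ∀ q < r / 2, D.n ≤ e (2 * q + 1) + e (2 * q + 2)
  · have h1 := key _ hq
    rw [tw] at h
    rcases Nat.even_or_odd' r with ⟨m, rfl | rfl⟩
    · rw [show 2 * m / 2 = m by omega] at h h1
      omega
    · have h2 : (2 * m + 1) / 2 = m := by omega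
      rw [h2] at h h1
      rw [Finset.sum_range_succ] at h
      have h3 : e (2 * m + 1) = 0 := by omega
      rw [psiVal, if_neg (by omega), h3]
      simp
  · push Not at hq
    obtain ⟨q, hq, hlt⟩ := hq
    have h0 : ((List.range (r / 2)).map fun q => D.bar (e (2 * q + 1) + e (2 * q + 2))).prod = 0 := by
      obtain ⟨s, t, hst⟩ := List.append_of_mem (List.mem_range.2 hq)
      rw [hst]
      simp [D.bar_of_lt _ hlt]
    refine LinearMap.ext fun a => ?_
    rw [psiVal, h0]
    split_ifs <;> simp

theorem psi_eq_zero_of_mem (r w : ℕ) (hw : w < D.tw r) (y : HochX D.incl r)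
    (hy : y ∈ hochFil D.incl D.degFil r w) : D.psi r y = 0 := by
  refine Submodule.span_induction (p := fun y _ => D.psi r y = 0) ?_ (by simp)
    (fun x y _ _ hx hy => by rw [map_add, hx, hy, add_zero])
    (fun c x _ hx => by rw [map_smul, hx, smul_zero]) hy
  rintro _ ⟨a, e, ha, he, rfl⟩
  rw [psi, hochLift_cls, psiMulti_apply]
  refine Finset.sum_eq_zero fun i _ => ?_
  have hi : ∀ j : Fin r, expo i (j + 1) = i j := fun j => by
    rw [expo, dif_pos ⟨by omega, by omega⟩]
    rfl
  by_cases h : ∀ j : Fin r, (i j : ℕ) ≤ e j.succ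
  · rw [D.psiVal_eq_zero_of_sum_lt r]
    · rfl
    · rw [← Fin.sum_univ_eq_sum_range (fun j => expo i (j + 1)) r]
      simp only [hi]
      rw [Fin.sum_univ_succ] at he
      have := Finset.sum_le_sum fun j (_ : j ∈ Finset.univ) => h j
      omega
  · push Not at h
    obtain ⟨j, hj⟩ := h
    have h1 : D.psiEntry (expo i) (j.succ : Fin (r + 1)) (a j.succ) = 0 := by
      rw [psiEntry, if_neg (by simp), Fin.val_succ, hi]
      simp [D.coord_eq_zero_of_mem (ha j.succ) hj]
    have h2 : (0 : D.Ext) ∈ List.ofFn fun j : Fin (r + 1) => D.psiEntry (expo i) j (a j) :=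
      List.mem_ofFn.2 ⟨j.succ, h1⟩
    obtain ⟨s, t, hst⟩ := List.append_of_mem h2
    rw [hst]
    simp

/-- The comparison maps and the homotopy of the connection form a retract. With `N = tw r + n - 1`,
`φ_r` takes values in filtration `N`, which `B` and `ω` preserve, while `ψ_{r+3}` vanishes in
filtration less than `tw (r + 3)`; this exceeds `N`. -/
theorem isRetract : IsRetract (hochB D.incl) (connesB D.incl) D.d D.phi D.psi
    D.conn_isConnection.omega fun r => hochFil D.incl D.degFil r (D.tw r + (D.n - 1)) where
  mixed := ⟨hochB_comp_hochB _, connesB_comp_connesB _, hochB_comp_connesB_zero _,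
    connesB_hochB_add _⟩
  b_phi := D.b_phi
  psi_phi := D.psi_phi
  homotopy_zero := D.homotopy_zero
  homotopy := D.homotopy
  phi_mem := D.phi_mem_hochFil
  omega_B_mem r v hv := by
    have h := D.conn_isConnection.omega_mem_hochFil D.isFiltration_degFil D.conn_mem_fil
      (connesB_mem_hochFil D.isFiltration_degFil hv)
    refine hochFil_mono _ _ _ ?_ h
    have : D.tw r ≤ D.tw (r + 2) := by
      rw [tw, tw, Nat.add_mod_right, Nat.add_div_right _ (by omega)]
      exact Nat.add_le_add_right (Nat.mul_le_mul_right _ (Nat.le_succ _)) _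
    omega
  psi_B_omega_B r v hv := by
    have h := connesB_mem_hochFil D.isFiltration_degFil
      (D.conn_isConnection.omega_mem_hochFil D.isFiltration_degFil D.conn_mem_fil
        (connesB_mem_hochFil D.isFiltration_degFil hv))
    refine D.psi_eq_zero_of_mem _ _ ?_ _ h
    have hn := D.two_le
    rcases Nat.even_or_odd' r with ⟨m, rfl | rfl⟩
    · rw [tw, tw, show 2 * m / 2 = m by omega, show (2 * m + 3) / 2 = m + 1 by omega]
      have := add_mul m 1 D.n
      omega
    · rw [tw, tw, show (2 * m + 1) / 2 = m by omega, show (2 * m + 1 + 3) / 2 = m + 1 + 1 by omega]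
      have := add_mul m 1 D.n
      have := add_mul (m + 1) 1 D.n
      omega

end MonogenicData
end MonogenicCyclic

theorem theorem3p2 {k K : Type*} [CommRing k] [Ring K] [Algebra k K]
    (D : MonogenicCyclic.MonogenicData k K) :
    MonogenicCyclic.IsMixedComplex D.d D.conD ∧
    ∃ F : ∀ r : ℕ, MonogenicCyclic.Tot D.CS r →ₗ[k]
        MonogenicCyclic.Tot (MonogenicCyclic.HochX D.incl) r,
      (∀ (r : ℕ) (z : MonogenicCyclic.Tot D.CS (r + 1)),
        F r (MonogenicCyclic.totD D.d D.conD r z) =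
          MonogenicCyclic.totD (MonogenicCyclic.hochB D.incl)
            (MonogenicCyclic.connesB D.incl) r (F (r + 1) z)) ∧
      (∀ (r : ℕ) (y : D.CS r),
        F r (MonogenicCyclic.firstColumn (k := k) (X := D.CS) r y) =
          MonogenicCyclic.firstColumn (k := k) (X := MonogenicCyclic.HochX D.incl) r
            (D.phi r y)) ∧
      (∀ (r : ℕ) (z : MonogenicCyclic.Tot D.CS (r + 2)),
        F r (MonogenicCyclic.periodicity (k := k) r z) =
          MonogenicCyclic.periodicity (k := k) r (F (r + 2) z)) ∧
      ∀ r : ℕ, ∃ e : MonogenicCyclic.HC D.d D.conD r ≃ₗ[k]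
          MonogenicCyclic.HC (MonogenicCyclic.hochB D.incl) (MonogenicCyclic.connesB D.incl) r,
        ∀ z : MonogenicCyclic.totCycles D.d D.conD r,
          ∃ h : F r z ∈ MonogenicCyclic.totCycles (MonogenicCyclic.hochB D.incl)
              (MonogenicCyclic.connesB D.incl) r,
            e (Submodule.Quotient.mk z) = Submodule.Quotient.mk ⟨F r z, h⟩ :=
  ⟨D.isRetract.mixed_transfer,
    MonogenicCyclic.pert (MonogenicCyclic.connesB D.incl) D.phi D.conn_isConnection.omega,
    D.isRetract.pert_totD, MonogenicCyclic.pert_firstColumn, MonogenicCyclic.pert_periodicity,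
    D.isRetract.exists_equiv⟩
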